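/- Let $F\in\mathbf{C}[x_0,\dots,x_3]$ be a homogeneous polynomial of degree $3$ defining a nonsingular cubic surface $X=\{F=0\}\subset\mathbf{P}^3$. Let $\Lambda(\mathbf{P}^3)$ be the Grassmannian of lines in $\mathbf{P}^3$, embedded in $\mathbf{P}^5$ by the Plücker embedding, and let $$Y=Y_3=\{(p,L)\in\mathbf{P}^3\times\Lambda(\mathbf{P}^3)\mid p\in L,\ L \text{ intersects } X \text{ at } p \text{ with multiplicity}\geq 3\}$$ (lines $L\ni p$ contained in $X$ are included), regarded as a (reduced) closed subvariety of $\mathbf{P}^3\times\mathbf{P}^5$. Let $\phi:Y\to X$, $(p,L)\mapsto p$, be the first projection. Let $R$ be the ramification divisor of $\phi$, that is, the divisor of zeros on $Y$ of the determinant of the differential $d\phi:T_Y\to\phi^*T_X$, and let $B=\phi_*R$ be the branch divisor, where $\phi_*$ is the push-forward of Weil divisors: for a prime divisor $D$ on $Y$, $\phi_*D=[\mathbf{C}(D):\mathbf{C}(\phi(D))]\cdot\phi(D)$ if $\phi(D)$ is a curve, and $\phi_*D=0$ if $\phi(D)$ is a point. Then $R$ is a well-defined effective divisor on $Y$ (the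 determinant does not vanish identically on any component of $Y$), the Hessian determinant $$\det\Bigl(\frac{\partial^2F}{\partial x_i\partial x_j}\Bigr)_{0\le i,j\le3}\in H^0(X,\mathcal{O}_{\mathbf{P}^3}(4)|_X)$$ is not identically zero on $X$, and its divisor of zeros on $X$ is $B$: for every irreducible curve $C\subset X$, the multiplicity of $C$ in $B=\phi_*R$ is the order of vanishing of the Hessian determinant along $C$. -/

import Mathlib

open MvPolynomial
open scoped LinearAlgebra.Projectivization TensorProduct

noncomputable section

/-! ### Closed subschemes of products of projective spaces

All polynomial rings `ℂ[σ]` below are bigraded by giving the variable `s` the bidegree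
`w s : ℕ × ℕ`.  Two cases are used:

* all variables have bidegree `(1, 0)`: bihomogeneous means homogeneous, and we are looking at
  closed subschemes of a single projective space;
* the variables are split as `α ⊕ β`, with bidegrees `(1, 0)` and `(0, 1)`: closed subschemes of
  a product of two projective spaces.
-/

namespace BiProj

section Points

variable {σ : Type}

/-- The piece of bidegree `d` of the bigraded ring `ℂ[σ]`. -/
abbrev piece (w : σ → ℕ × ℕ) (d : ℕ × ℕ) : Submodule ℂ (MvPolynomial σ ℂ) :=
  weightedHomogeneousSubmodule ℂ w d

instance instGraded (w : σ → ℕ × ℕ) : GradedAlgebra (piece w) :=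
  weightedGradedAlgebra ℂ w

/-- The points (in the sense of schemes) of the closed subscheme of a (product of) projective
space(s) defined by the bihomogeneous ideal `I`: the bihomogeneous prime ideals containing `I` that
are relevant, i.e. do not contain all the variables of one of the factors.  Such a point is the
same thing as an irreducible closed subvariety of the zero locus of `I`. -/
@[ext]
structure Point (w : σ → ℕ × ℕ) (I : Ideal (MvPolynomial σ ℂ)) where
  ideal : Ideal (MvPolynomial σ ℂ)
  isPrime : ideal.IsPrime
  isHomogeneous : ideal.IsHomogeneous (piece w)
  relevant : ∀ s, ∃ t, w t = w s ∧ (X t : MvPolynomial σ ℂ) ∉ ideal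
  le_ideal : I ≤ ideal

attribute [instance] Point.isPrime

/-- `ℂ`-algebra structure on the ring of fractions of degree zero at a prime. -/
instance instAlgebra (w : σ → ℕ × ℕ) (P : Ideal (MvPolynomial σ ℂ)) [P.IsPrime] :
    Algebra ℂ (HomogeneousLocalization.AtPrime (piece w) P) where
  algebraMap :=
    (HomogeneousLocalization.fromZeroRingHom (piece w) P.primeCompl).comp
      (algebraMap ℂ (piece w 0))
  commutes' _ _ := mul_comm _ _
  smul_def' c x := by
    apply HomogeneousLocalization.val_injective
    rw [HomogeneousLocalization.val_smul, HomogeneousLocalization.val_mul, Algebra.smul_def]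
    rfl

variable {w : σ → ℕ × ℕ} {I : Ideal (MvPolynomial σ ℂ)}

/-- The local ring at `z` of the ambient (product of) projective space(s): fractions `f / g` of
bihomogeneous polynomials of the same bidegree, with `g ∉ z`. -/
abbrev ambientRing (z : Point w I) : Type :=
  HomogeneousLocalization.AtPrime (piece w) z.ideal

/-- The ideal in the ambient local ring at `z` of the closed subscheme defined by `I`:
the fractions of degree zero that lie in `I · ℂ[σ]_z`. -/
def localIdeal (z : Point w I) : Ideal (ambientRing z) :=
  (I.map (algebraMap (MvPolynomial σ ℂ) (Localization.AtPrime z.ideal))).comap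
    (algebraMap (ambientRing z) (Localization.AtPrime z.ideal))

/-- The local ring `𝒪_{Z,z}` at `z` of the closed subscheme `Z` defined by `I`. -/
abbrev localRing (z : Point w I) : Type := ambientRing z ⧸ localIdeal z

/-- The residue field at `z` (the same for `Z` and for the ambient space). For a point `z`
corresponding to an irreducible subvariety, it is the function field of this subvariety. -/
abbrev residueField (z : Point w I) : Type := IsLocalRing.ResidueField (ambientRing z)

/-- `z` is the generic point of a prime divisor of `Z`. -/
def IsPrimeDivisor (z : Point w I) : Prop := ringKrullDim (localRing z) = 1

variable (w I) in
/-- Prime divisors: irreducible closed subvarieties of codimension one. -/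
abbrev PrimeDivisor : Type := {z : Point w I // IsPrimeDivisor z}

variable (w I) in
/-- Effective Weil divisors. -/
abbrev EffectiveDivisor : Type := PrimeDivisor w I →₀ ℕ

/-- The element `s / g` of `𝒪_{Z,z}`, for `s`, `g` of the same bidegree and `g` not vanishing
identically on the subvariety corresponding to `z`.  It is the expression of the section `s` of
`𝒪(d)` in the local trivialization given by `g`. -/
def localFraction (z : Point w I) {d : ℕ × ℕ} {s g : MvPolynomial σ ℂ}
    (hs : s ∈ piece w d) (hg : g ∈ piece w d) (hgz : g ∉ z.ideal) : localRing z :=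
  Ideal.Quotient.mk (localIdeal z) (HomogeneousLocalization.mk ⟨d, ⟨s, hs⟩, ⟨g, hg⟩, hgz⟩)

/-- `E` is the divisor of zeros on `Z` of the section of `𝒪_Z(d)` given by the bihomogeneous
polynomial `s` of bidegree `d`: its multiplicity along each prime divisor is the order of vanishing
of `s` there. (Since multiplicities are finite, `s` does not vanish identically along `Z`.) -/
def IsZeroDivisorOf {d : ℕ × ℕ} {s : MvPolynomial σ ℂ} (hs : s ∈ piece w d)
    (E : EffectiveDivisor w I) : Prop :=
  ∀ (C : PrimeDivisor w I) (g : MvPolynomial σ ℂ) (hg : g ∈ piece w d) (hgC : g ∉ C.1.ideal),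
    Ring.ord (localRing C.1) (localFraction C.1 hs hg hgC) = (E C : ℕ∞)

end Points

/-! ### The first projection of a product of two projective spaces -/

section Projection

variable {α β : Type}

/-- The bidegrees of the coordinates of a single projective space. -/
def oneWeight (α : Type) : α → ℕ × ℕ := fun _ => (1, 0)

/-- The bidegrees of the coordinates of a product of two projective spaces. -/
def twoWeight (α β : Type) : α ⊕ β → ℕ × ℕ := Sum.elim (fun _ => (1, 0)) (fun _ => (0, 1))

variable (α β) in
/-- The inclusion `ℂ[α] → ℂ[α ⊕ β]` as a graded homomorphism. -/
def inclGraded : piece (oneWeight α) →+*ᵍ piece (twoWeight α β) where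
  toRingHom := (rename (Sum.inl : α → α ⊕ β) : MvPolynomial α ℂ →ₐ[ℂ] _).toRingHom
  map_mem {i x} hx := by
    simp only [mem_weightedHomogeneousSubmodule] at hx ⊢
    intro d hd
    obtain ⟨u, rfl, hu⟩ := coeff_rename_ne_zero _ _ _ hd
    rw [← hx hu]
    rw [Finsupp.weight_apply, Finsupp.weight_apply, Finsupp.sum_mapDomain_index
      (h := fun a c => c • twoWeight α β a) (by simp) (by simp [add_mul])]
    rfl

variable {I : Ideal (MvPolynomial α ℂ)} {J : Ideal (MvPolynomial (α ⊕ β) ℂ)}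

/-- The first projection, from the closed subscheme defined by `J` to the closed subscheme defined
by `I`, on points: `z` is sent to the ideal of the polynomials in the first set of variables that
vanish on the subvariety corresponding to `z`, which is the ideal of the image of this
subvariety. -/
def proj (hIJ : I ≤ J.comap (inclGraded α β)) (z : Point (twoWeight α β) J) :
    Point (oneWeight α) I where
  ideal := z.ideal.comap (inclGraded α β)
  isPrime := inferInstance
  isHomogeneous := by
    intro i f hf
    rw [Ideal.mem_comap] at hf ⊢
    have h := z.isHomogeneous i hf
    rw [← GradedRingHom.map_directSumDecompose] at h
    exact h
  relevant s := by
    obtain ⟨t, ht, hX⟩ := z.relevant (Sum.inl s)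
    rcases t with t | t
    · refine ⟨t, rfl, fun h => hX ?_⟩
      have h' : rename (Sum.inl : α → α ⊕ β) (X t : MvPolynomial α ℂ) ∈ z.ideal := h
      simpa using h'
    · simp [twoWeight] at ht
  le_ideal := hIJ.trans (Ideal.comap_mono z.le_ideal)

lemma proj_ideal (hIJ : I ≤ J.comap (inclGraded α β)) (z : Point (twoWeight α β) J) :
    (proj hIJ z).ideal = z.ideal.comap (inclGraded α β) := rfl

/-- The homomorphism of ambient local rings given by pulling back functions. -/
def ambientMap (hIJ : I ≤ J.comap (inclGraded α β)) (z : Point (twoWeight α β) J) :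
    ambientRing (proj hIJ z) →+* ambientRing z :=
  HomogeneousLocalization.localRingHom (inclGraded α β) _ _ (proj_ideal hIJ z)

instance (hIJ : I ≤ J.comap (inclGraded α β)) (z : Point (twoWeight α β) J) :
    IsLocalHom (ambientMap hIJ z) := by
  unfold ambientMap; infer_instance

/-- The homomorphism of localizations `ℂ[α]_{φ(z)} → ℂ[α ⊕ β]_z` extending `ambientMap`. -/
def locMap (hIJ : I ≤ J.comap (inclGraded α β)) (z : Point (twoWeight α β) J) :
    Localization.AtPrime (proj hIJ z).ideal →+* Localization.AtPrime z.ideal :=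
  Localization.localRingHom _ _ (inclGraded α β) (proj_ideal hIJ z)

lemma val_ambientMap (hIJ : I ≤ J.comap (inclGraded α β)) (z : Point (twoWeight α β) J)
    (f : ambientRing (proj hIJ z)) : (ambientMap hIJ z f).val = locMap hIJ z f.val :=
  HomogeneousLocalization.val_localRingHom f

lemma locMap_algebraMap (hIJ : I ≤ J.comap (inclGraded α β)) (z : Point (twoWeight α β) J)
    (p : MvPolynomial α ℂ) :
    locMap hIJ z (algebraMap _ _ p) = algebraMap _ _ (inclGraded α β p) :=
  Localization.localRingHom_to_map _ _ _ (proj_ideal hIJ z) p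

lemma localIdeal_le_comap (hIJ : I ≤ J.comap (inclGraded α β)) (z : Point (twoWeight α β) J) :
    localIdeal (proj hIJ z) ≤ (localIdeal z).comap (ambientMap hIJ z) := by
  intro f hf
  have hf' : f.val ∈ I.map (algebraMap (MvPolynomial α ℂ)
      (Localization.AtPrime (proj hIJ z).ideal)) := hf
  change (ambientMap hIJ z f).val ∈ J.map (algebraMap (MvPolynomial (α ⊕ β) ℂ)
      (Localization.AtPrime z.ideal))
  rw [val_ambientMap]
  have h : I.map (algebraMap (MvPolynomial α ℂ) (Localization.AtPrime (proj hIJ z).ideal)) ≤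
      (J.map (algebraMap (MvPolynomial (α ⊕ β) ℂ) (Localization.AtPrime z.ideal))).comap
        (locMap hIJ z) := by
    rw [Ideal.map_le_iff_le_comap]
    intro p hp
    rw [Ideal.mem_comap, Ideal.mem_comap, locMap_algebraMap]
    exact Ideal.mem_map_of_mem _ (hIJ hp)
  exact h hf'

/-- The homomorphism `φ^* : 𝒪_{X,φ(z)} → 𝒪_{Y,z}` of `ℂ`-algebras, where `φ : Y → X` is the first
projection. -/
def pullback (hIJ : I ≤ J.comap (inclGraded α β)) (z : Point (twoWeight α β) J) :
    localRing (proj hIJ z) →ₐ[ℂ] localRing z where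
  toRingHom := Ideal.quotientMap (localIdeal z) (ambientMap hIJ z) (localIdeal_le_comap hIJ z)
  commutes' c := by
    have h : ambientMap hIJ z (algebraMap ℂ _ c) = algebraMap ℂ _ c := by
      apply HomogeneousLocalization.val_injective
      rw [val_ambientMap]
      change locMap hIJ z
        (algebraMap (MvPolynomial α ℂ) _ (C c)) = algebraMap (MvPolynomial (α ⊕ β) ℂ) _ (C c)
      rw [locMap_algebraMap]
      congr 1
      exact rename_C _ c
    exact congrArg (Ideal.Quotient.mk (localIdeal z)) h

/-- The degree `[κ(z) : κ(φ(z))]` of residue fields. -/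
def residueDegree (hIJ : I ≤ J.comap (inclGraded α β)) (z : Point (twoWeight α β) J) : ℕ :=
  letI : Algebra (residueField (proj hIJ z)) (residueField z) :=
    (IsLocalRing.ResidueField.map (ambientMap hIJ z)).toAlgebra
  Module.finrank (residueField (proj hIJ z)) (residueField z)

open Classical in
/-- The push-forward `φ_* D` of a prime divisor: `[κ(D) : κ(φ(D))] • φ(D)` if `φ(D)` is a prime
divisor, and `0` otherwise. -/
def pushPrime (hIJ : I ≤ J.comap (inclGraded α β)) (D : PrimeDivisor (twoWeight α β) J) :
    EffectiveDivisor (oneWeight α) I :=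
  if h : IsPrimeDivisor (proj hIJ D.1) then
    Finsupp.single ⟨proj hIJ D.1, h⟩ (residueDegree hIJ D.1)
  else 0

/-- The push-forward `φ_*` of effective Weil divisors under the first projection. -/
def push (hIJ : I ≤ J.comap (inclGraded α β)) (R : EffectiveDivisor (twoWeight α β) J) :
    EffectiveDivisor (oneWeight α) I :=
  R.sum fun D n => n • pushPrime hIJ D

/-- For a homomorphism `f : A → B` of local rings of smooth surfaces, the order of vanishing of the
determinant of the differential `df^* : B ⊗_A Ω_A → Ω_B`: the length of the cokernel of
`⋀² df^* : ⋀² (B ⊗_A Ω_A) → ⋀² Ω_B`, i.e. of `B / det(df^*)` when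
bases are chosen (`Ω_A`, `Ω_B` being free of rank 2). -/
def jacobianOrder {A B : Type} [CommRing A] [CommRing B] [Algebra ℂ A] [Algebra ℂ B]
    (f : A →ₐ[ℂ] B) : ℕ∞ :=
  letI : Algebra A B := f.toRingHom.toAlgebra
  haveI : IsScalarTower ℂ A B := IsScalarTower.of_algebraMap_eq fun c => (f.commutes c).symm
  Module.length B
    ((⋀[B]^2 (Ω[B⁄ℂ])) ⧸
      LinearMap.range (exteriorPower.map 2 (KaehlerDifferential.mapBaseChange ℂ A B)))

/-- `R` is the ramification divisor of the first projection `φ : Y → X` between surfaces: the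
divisor of zeros of the determinant of the differential of `φ`. -/
def IsRamificationDivisor (hIJ : I ≤ J.comap (inclGraded α β))
    (R : EffectiveDivisor (twoWeight α β) J) : Prop :=
  ∀ D : PrimeDivisor (twoWeight α β) J, jacobianOrder (pullback hIJ D.1) = (R D : ℕ∞)

end Projection

end BiProj

/-! ### Cubic surfaces and the variety of lines with a triple contact -/

namespace CubicSurface

open BiProj

/-- The projective surface `F = 0` is nonsingular. -/
def IsNonsingular (F : MvPolynomial (Fin 4) ℂ) : Prop :=
  ∀ a : Fin 4 → ℂ, a ≠ 0 → eval a F = 0 → ∃ i, eval a (pderiv i F) ≠ 0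

/-- The Hessian determinant. -/
def hessian (F : MvPolynomial (Fin 4) ℂ) : MvPolynomial (Fin 4) ℂ :=
  (Matrix.of fun i j => pderiv i (pderiv j F)).det

lemma hessian_mem {F : MvPolynomial (Fin 4) ℂ} (hF : F.IsHomogeneous 3) :
    hessian F ∈ piece (oneWeight (Fin 4)) (4, 0) := by
  have hF' : F.IsWeightedHomogeneous (oneWeight (Fin 4)) (3, 0) := by
    intro d hd
    have h := hF hd
    rw [Finsupp.weight_eq_sum] at h ⊢
    simp only [Pi.one_apply, smul_eq_mul, mul_one] at h
    rw [← h]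
    ext <;> simp [oneWeight, Prod.fst_sum, Prod.snd_sum]
  have h2 (i j : Fin 4) : (pderiv i (pderiv j F)).IsWeightedHomogeneous
      (oneWeight (Fin 4)) (1, 0) :=
    IsWeightedHomogeneous.pderiv (n := (2, 0)) (IsWeightedHomogeneous.pderiv hF' rfl) rfl
  rw [hessian, Matrix.det_apply]
  refine Submodule.sum_mem _ fun g _ => ?_
  rw [Units.smul_def]
  refine zsmul_mem ?_ _
  have h := IsWeightedHomogeneous.prod (R := ℂ) (w := oneWeight (Fin 4)) (Finset.univ : Finset (Fin 4))
    (fun i => pderiv (g i) (pderiv i F)) (fun _ => (1, 0)) (fun i _ => h2 _ _)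
  simpa using h

/-- The homogeneous ideal of the surface `X` defined by `F`. -/
def surfaceIdeal (F : MvPolynomial (Fin 4) ℂ) : Ideal (MvPolynomial (Fin 4) ℂ) := Ideal.span {F}

/-- The Grassmannian `Λ(ℙ³)` of lines in `ℙ³`. -/
abbrev Line : Type := {L : Submodule ℂ (Fin 4 → ℂ) // Module.finrank ℂ L = 2}

/-- The line `L` intersects the surface `F = 0` at `p` with multiplicity at least `m`: for
`p = [a]` and all `b ∈ L`, the polynomial `F (a + b T)` in `T` is divisible by `T ^ m`.
(This includes the case where `L` is contained in the surface.) -/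
def MeetsWithMultiplicity (F : MvPolynomial (Fin 4) ℂ) (p : ℙ ℂ (Fin 4 → ℂ)) (L : Line) (m : ℕ) :
    Prop :=
  ∀ b ∈ L.1, (Polynomial.X : Polynomial ℂ) ^ m ∣
    aeval (fun i => Polynomial.C (p.rep i) + Polynomial.C (b i) * Polynomial.X) F

/-- The variety `Y_m` of pairs `(p, L)`, where `L` is a line through `p` which intersects the
surface `F = 0` at `p` with multiplicity at least `m`. -/
def lineVariety (F : MvPolynomial (Fin 4) ℂ) (m : ℕ) : Set (ℙ ℂ (Fin 4 → ℂ) × Line) :=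
  {y | y.1.submodule ≤ y.2.1 ∧ MeetsWithMultiplicity F y.1 y.2 m}

/-- The index set of the Plücker coordinates. -/
abbrev Pair : Type := {ij : Fin 4 × Fin 4 // ij.1 < ij.2}

/-- `q` is a vector of Plücker coordinates of the line `L`. -/
def IsPlucker (L : Line) (q : Pair → ℂ) : Prop :=
  ∃ b c : Fin 4 → ℂ, Submodule.span ℂ {b, c} = L.1 ∧
    ∀ ij : Pair, q ij = b ij.1.1 * c ij.1.2 - b ij.1.2 * c ij.1.1

/-- `v` is a vector of bihomogeneous coordinates of `(p, L) ∈ ℙ³ × Λ(ℙ³) ⊆ ℙ³ × ℙ⁵`. -/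
def IsCoordinateVector (y : ℙ ℂ (Fin 4 → ℂ) × Line) (v : Fin 4 ⊕ Pair → ℂ) : Prop :=
  (∃ h : (fun i => v (Sum.inl i)) ≠ 0, Projectivization.mk ℂ (fun i => v (Sum.inl i)) h = y.1) ∧
    IsPlucker y.2 fun ij => v (Sum.inr ij)

/-- The bihomogeneous ideal of the variety `Y = Y₃ ⊆ ℙ³ × ℙ⁵`: the ideal of the polynomials
vanishing on the coordinate vectors of all elements of `Y₃`. -/
def tripleContactIdeal (F : MvPolynomial (Fin 4) ℂ) : Ideal (MvPolynomial (Fin 4 ⊕ Pair) ℂ) :=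
  vanishingIdeal ℂ {v | ∃ y ∈ lineVariety F 3, IsCoordinateVector y v}

/-- The first projection maps `Y₃` to the surface `X` defined by `F`. -/
lemma surfaceIdeal_le {F : MvPolynomial (Fin 4) ℂ} (hF : F.IsHomogeneous 3) :
    surfaceIdeal F ≤ (tripleContactIdeal F).comap (inclGraded (Fin 4) Pair) := by
  rw [surfaceIdeal, Ideal.span_le, Set.singleton_subset_iff, SetLike.mem_coe, Ideal.mem_comap]
  rintro v ⟨y, ⟨-, hm⟩, ⟨hv, hy⟩, -⟩
  have h0 : eval y.1.rep F = 0 := by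
    have h := hm 0 (Submodule.zero_mem _)
    have h1 : (aeval (fun i => Polynomial.C (y.1.rep i) +
        Polynomial.C ((0 : Fin 4 → ℂ) i) * Polynomial.X) F : Polynomial ℂ) =
        Polynomial.C (eval y.1.rep F) := by
      have h2 : (fun i => Polynomial.C (y.1.rep i) + Polynomial.C ((0 : Fin 4 → ℂ) i) *
          (Polynomial.X : Polynomial ℂ)) = algebraMap ℂ (Polynomial ℂ) ∘ y.1.rep := by
        funext i; simp
      rw [h2, aeval_algebraMap_apply]
      rfl
    rw [h1] at h
    have h2 := (Polynomial.X_pow_dvd_iff.mp h) 0 (by norm_num)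
    simpa using h2
  rw [← Projectivization.mk_rep y.1, Projectivization.mk_eq_mk_iff'] at hy
  obtain ⟨c, hc⟩ := hy
  have h3 : (fun i => v (Sum.inl i)) = fun i => c * y.1.rep i := by
    rw [← hc]; rfl
  change aeval v (rename (Sum.inl : Fin 4 → Fin 4 ⊕ Pair) F) = 0
  rw [aeval_rename, MvPolynomial.aeval_eq_eval]
  change eval (fun i => v (Sum.inl i)) F = 0
  rw [h3]
  have h4 : eval (fun i => c * y.1.rep i) F = c ^ 3 * eval y.1.rep F := by
    rw [eval_eq', eval_eq', Finset.mul_sum]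
    refine Finset.sum_congr rfl fun d hd => ?_
    have h5 := hF (mem_support_iff.mp hd)
    rw [Finsupp.weight_eq_sum] at h5
    simp only [Pi.one_apply, smul_eq_mul, mul_one] at h5
    simp only [mul_pow, Finset.prod_mul_distrib, Finset.prod_pow_eq_pow_sum, h5]
    ring
  rw [h4, h0, mul_zero]

end CubicSurface

end

open BiProj CubicSurface

/-! Let `T` be the polarization of `F`, so that `T x x x = 6 F(x)` and the Hessian matrix at `x` is
the matrix of the bilinear form `T x`. The line spanned by `x` and `v` has triple contact at `x`
exactly when `T x x x = T x x v = T x v v = 0`, that is, when the plane of `x` and `v` is isotropic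
for `T x`. A symmetric form in four variables with an isotropic plane has a square as determinant,
so on `Y` the Hessian pulls back to `δ ^ 2` (`det_formMatrix_eq_sq`, `map_rename_hessian`), where
`δ` is the `2 × 2` determinant of the linear forms `T x x` and `T x v` on a complement of that
plane. Differentiating the contact equations with `x` fixed shows, by Cramer's rule, that `δ` kills
the relative differentials of `φ` (`jacobian_smul_mem`). Hence `φ` ramifies only over `Hess = 0`,
and a curve along which the Hessian does not vanish has multiplicity 0 on both sides.

Now let the Hessian vanish along a curve `C`. Nonsingularity enters through
`Trilinear.IsNondegenerate`: `T x y` and `T y y` are both multiples of `T x x` only if `y` is a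
multiple of `x`. This bounds tangent spaces, and the inequality "tangent dimension plus height is at
least the number of coordinates", with its converse criterion for generators, turns such bounds into
statements on dimension and reducedness.

On `X`: the Hessian matrix has rank at most two only at isolated points
(`four_le_height_of_adjugate_eq_zero`), so at the generic point of `C` its kernel is spanned by one
vector `u`. The derivative of the Hessian in the direction `y` is proportional to `T y u u`, which
is independent of `T x x y`; so the Hessian vanishes along `C` to order exactly one
(`exists_mul_mem_span_hessian`).

Over `C`: the only line with triple contact at the generic point is the one through `x` and `u`.
Hence there is exactly one point `D` of `Y` over `C`; it is a prime divisor with residue degree one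
(`exists_proj_eq`, `eq_of_proj_eq`, `isPrimeDivisor_of_proj`, `residueDegree_eq_one`).

On `Y`: at `D` the equations of `Y` together with `δ = 0` have a one-dimensional tangent space
(`finrank_tangent_le_one`). So `δ` generates the maximal ideal of the local ring, and the Jacobian
vanishes to order exactly one (`jacobianOrder_eq_one_aux`).

Both multiplicities along `C` are therefore 1. Ramification divisors which do not lie over a curve
do not contribute to the push-forward; for them only finiteness of the order is needed, which holds
because `Hess = 0` has dimension at most one on `Y` (`nine_le_height`). -/

noncomputable section

namespace BiProj

/-! ### Tangent spaces at field-valued points and heights of primes -/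

section Tangent

/-- The maximal ideal of the localization of a regular ring at a prime `q` is generated by
`q.height` elements of `q`. -/
lemma exists_generators_of_isRegularRing {R : Type*} [CommRing R] [IsRegularRing R]
    (q : Ideal R) [q.IsPrime] :
    ∃ (n : ℕ) (g : Fin n → R), q.height = n ∧ (∀ t, g t ∈ q) ∧
      ∀ f ∈ q, ∃ s ∉ q, s * f ∈ Ideal.span (Set.range g) := by
  let L := Localization.AtPrime q
  have hreg : IsRegularLocalRing L := IsRegularRing.isRegularLocalRing_localization q
  have hfg := (IsLocalRing.maximalIdeal L).fg_of_isNoetherianRing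
  have hfin := Submodule.FG.finite_generators hfg
  -- Regularity enters here: the minimal number of generators of the maximal ideal is the dimension
  -- of `L`, i.e. the height of `q`.
  have hdim := (isRegularLocalRing_iff L).mp hreg
  rw [IsLocalization.AtPrime.ringKrullDim_eq_height q L] at hdim
  have hcard : (IsLocalRing.maximalIdeal L).generators.ncard =
      (IsLocalRing.maximalIdeal L).spanFinrank := Submodule.FG.generators_ncard hfg
  set G := (IsLocalRing.maximalIdeal L).generators with hG
  obtain ⟨n, e, hinj, hrange⟩ := hfin.fin_param
  have hn : G.ncard = n := by
    rw [← hrange, ← Set.image_univ, Set.ncard_image_of_injective _ hinj]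
    simp
  have hmem : ∀ t, e t ∈ IsLocalRing.maximalIdeal L := fun t =>
    Submodule.FG.generators_mem _ (by rw [← hG, ← hrange]; exact Set.mem_range_self t)
  have hx : ∀ t, ∃ a ∈ q, ∃ s : q.primeCompl, e t * algebraMap R L s = algebraMap R L a := by
    intro t
    obtain ⟨⟨a, s⟩, has⟩ := IsLocalization.surj q.primeCompl (e t)
    refine ⟨a, ?_, s, has⟩
    rw [← IsLocalization.AtPrime.to_map_mem_maximal_iff L q, ← has]
    exact Ideal.mul_mem_right _ _ (hmem t)
  choose g hgq s hs using hx
  refine ⟨n, g, ?_, hgq, fun f hf => ?_⟩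
  · rw [← hn, hcard]
    exact_mod_cast hdim.symm
  · have hspan : (Ideal.span (Set.range g)).map (algebraMap R L) = IsLocalRing.maximalIdeal L := by
      apply le_antisymm
      · rw [Ideal.map_span, Ideal.span_le]
        rintro _ ⟨_, ⟨t, rfl⟩, rfl⟩
        exact (IsLocalization.AtPrime.to_map_mem_maximal_iff L q _).2 (hgq t)
      · rw [← (IsLocalRing.maximalIdeal L).span_generators]
        refine Ideal.span_le.2 fun y hy => ?_
        rw [← hG, ← hrange] at hy
        obtain ⟨t, rfl⟩ := hy
        have hu : IsUnit (algebraMap R L (s t)) := IsLocalization.map_units L (s t)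
        refine (Ideal.mul_unit_mem_iff_mem _ hu).1 ?_
        rw [hs t]
        exact Ideal.mem_map_of_mem _ (Ideal.subset_span ⟨t, rfl⟩)
    have h1 : algebraMap R L f ∈ (Ideal.span (Set.range g)).map (algebraMap R L) := by
      rw [hspan]
      exact (IsLocalization.AtPrime.to_map_mem_maximal_iff L q _).2 hf
    obtain ⟨m, hm, h⟩ := (IsLocalization.algebraMap_mem_map_algebraMap_iff q.primeCompl L _ _).1 h1
    exact ⟨m, hm, h⟩

variable {σ : Type*} [Fintype σ] (K : Type*) [Field K] [Algebra ℂ K]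
  [Algebra (MvPolynomial σ ℂ) K] [IsScalarTower ℂ (MvPolynomial σ ℂ) K]

variable {K} in
lemma mkDerivation_eq_sum (ξ : σ → K) (g : MvPolynomial σ ℂ) :
    mkDerivation ℂ ξ g = ∑ s, algebraMap (MvPolynomial σ ℂ) K (pderiv s g) * ξ s := by
  classical
  let D : Derivation ℂ (MvPolynomial σ ℂ) K :=
    ∑ s, (LinearMap.toSpanSingleton (MvPolynomial σ ℂ) K (ξ s)).compDer (pderiv s)
  have hD (f) : D f = ∑ s, (LinearMap.toSpanSingleton (MvPolynomial σ ℂ) K (ξ s)) (pderiv s f) := by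
    have := congrFun (map_sum Derivation.coeFnAddMonoidHom (fun s => (LinearMap.toSpanSingleton
      (MvPolynomial σ ℂ) K (ξ s)).compDer (pderiv s)) Finset.univ) f
    rw [Finset.sum_apply] at this
    exact this
  have h : mkDerivation ℂ ξ = D := by
    refine derivation_ext fun i => ?_
    rw [mkDerivation_X, hD, Finset.sum_eq_single i]
    · simp
    · intro b _ hb
      simp [pderiv_X_of_ne hb.symm]
    · simp
  rw [h, hD]
  refine Finset.sum_congr rfl fun s _ => ?_
  rw [← Algebra.smul_def]
  rfl

/-- The gradient of a polynomial at a `K`-point, as a linear form. -/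
def gradient (g : MvPolynomial σ ℂ) : (σ → K) →ₗ[K] K :=
  ∑ s, algebraMap (MvPolynomial σ ℂ) K (pderiv s g) • LinearMap.proj s

variable {K} in
lemma gradient_apply (ξ : σ → K) (g : MvPolynomial σ ℂ) :
    gradient K g ξ = mkDerivation ℂ ξ g := by
  simp [gradient, mkDerivation_eq_sum, Algebra.smul_def]

/-- The vectors `ξ` at a `K`-point of affine space for which the derivative of every element of `S`
in the direction `ξ` vanishes. -/
def tangent (S : Set (MvPolynomial σ ℂ)) : Submodule K (σ → K) :=
  ⨅ g ∈ S, LinearMap.ker (gradient K g)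

variable {K} in
lemma mem_tangent {S : Set (MvPolynomial σ ℂ)} {ξ : σ → K} :
    ξ ∈ tangent K S ↔ ∀ g ∈ S, mkDerivation ℂ ξ g = 0 := by
  simp [tangent, gradient_apply]

/-- In the Leibniz rule, the terms with derivatives of the coefficients `a t` carry a factor `g t`,
which vanishes at the point. -/
lemma gradient_sum_mul {n : ℕ} (a g : Fin n → MvPolynomial σ ℂ)
    (hg : ∀ t, algebraMap (MvPolynomial σ ℂ) K (g t) = 0) :
    gradient K (∑ t, a t * g t) = ∑ t, algebraMap (MvPolynomial σ ℂ) K (a t) • gradient K (g t) := by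
  ext1 ξ
  rw [gradient_apply, map_sum, LinearMap.sum_apply]
  refine Finset.sum_congr rfl fun t _ => ?_
  rw [Derivation.leibniz, LinearMap.smul_apply, gradient_apply, Algebra.smul_def, Algebra.smul_def,
    hg, zero_mul, add_zero, smul_eq_mul]

omit [Algebra ℂ K] [IsScalarTower ℂ (MvPolynomial σ ℂ) K] in
-- Rank-nullity: the tangent space is the annihilator of the span of the gradients.
lemma finrank_tangent_add (S : Set (MvPolynomial σ ℂ)) :
    Module.finrank K (tangent K S) +
      Module.finrank K (Submodule.span K (gradient K '' S)) = Fintype.card σ := by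
  have h : tangent K S = (Submodule.span K (gradient K '' S)).dualCoannihilator := by
    ext ξ
    simp only [tangent, Submodule.mem_iInf, LinearMap.mem_ker, Submodule.mem_dualCoannihilator]
    constructor
    · intro h φ hφ
      induction hφ using Submodule.span_induction with
      | mem x hx => obtain ⟨g, hg, rfl⟩ := hx; exact h g hg
      | zero => rfl
      | add x y _ _ hx hy => rw [LinearMap.add_apply, hx, hy, add_zero]
      | smul a x _ hx => rw [LinearMap.smul_apply, hx, smul_zero]
    · exact fun h g hg => h _ (Submodule.subset_span ⟨g, hg, rfl⟩)
  rw [h, add_comm, Subspace.finrank_add_finrank_dualCoannihilator_eq, Module.finrank_fintype_fun_eq_card]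

variable (q : Ideal (MvPolynomial σ ℂ)) [q.IsPrime]
  (hq : ∀ f, algebraMap (MvPolynomial σ ℂ) K f = 0 ↔ f ∈ q)

include hq

omit [q.IsPrime] in
-- Local generators of `q` also generate the gradients, by the Leibniz rule applied to `s * f = ∑ a
-- t * g t`; the factor `s` is harmless since it does not vanish at the point.
lemma exists_gradient_eq {n : ℕ} {g : Fin n → MvPolynomial σ ℂ} (hgq : ∀ t, g t ∈ q)
    (hg : ∀ f ∈ q, ∃ s ∉ q, s * f ∈ Ideal.span (Set.range g)) (f : MvPolynomial σ ℂ) (hf : f ∈ q) :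
    ∃ s ∉ q, ∃ a : Fin n → MvPolynomial σ ℂ, s * f = ∑ t, a t * g t ∧
      algebraMap (MvPolynomial σ ℂ) K s • gradient K f =
        ∑ t, algebraMap (MvPolynomial σ ℂ) K (a t) • gradient K (g t) := by
  obtain ⟨s, hs, h⟩ := hg f hf
  obtain ⟨a, ha⟩ := (Ideal.mem_span_range_iff_exists_fun).1 h
  refine ⟨s, hs, a, ha.symm, ?_⟩
  rw [← gradient_sum_mul K a g fun t => (hq _).2 (hgq t), ha]
  have := gradient_sum_mul K (fun _ : Fin 1 => s) (fun _ => f) fun t => (hq _).2 hf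
  simpa using this.symm

/-- The tangent space at a point of height `h` has dimension at least `n - h`. -/
theorem le_finrank_tangent_add_height (S : Set (MvPolynomial σ ℂ)) (hS : S ⊆ q) :
    (Fintype.card σ : ℕ∞) ≤ Module.finrank K (tangent K S) + q.height := by
  obtain ⟨n, g, hn, hgq, hg⟩ := exists_generators_of_isRegularRing q
  rw [hn, ← finrank_tangent_add K S]
  norm_cast
  gcongr
  have h : Submodule.span K (gradient K '' S) ≤
      Submodule.span K (Set.range fun t => gradient K (g t)) := by
    rw [Submodule.span_le]
    rintro _ ⟨f, hf, rfl⟩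
    obtain ⟨s, hs, a, -, h⟩ := exists_gradient_eq K q hq hgq hg f (hS hf)
    have hs' : algebraMap (MvPolynomial σ ℂ) K s ≠ 0 := fun h => hs ((hq s).1 h)
    rw [SetLike.mem_coe, ← Submodule.smul_mem_iff _ hs', h]
    exact Submodule.sum_mem _ fun t _ => Submodule.smul_mem _ _ (Submodule.subset_span ⟨t, rfl⟩)
  exact (Submodule.finrank_mono h).trans ((finrank_range_le_card _).trans (by simp))

/-- Polynomials vanishing at a point of height `h`, whose common tangent space has dimension at
most `n - h`, generate the ideal of the point locally. -/
theorem exists_mul_mem_span_of_finrank_tangent_le (S : Set (MvPolynomial σ ℂ)) (hS : S ⊆ q)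
    (h : Module.finrank K (tangent K S) + q.height ≤ Fintype.card σ)
    (f : MvPolynomial σ ℂ) (hf : f ∈ q) : ∃ s ∉ q, s * f ∈ Ideal.span S := by
  classical
  obtain ⟨n, g, hn, hgq, hg⟩ := exists_generators_of_isRegularRing q
  have hle : n ≤ Module.finrank K (Submodule.span K (gradient K '' S)) := by
    rw [hn, ← finrank_tangent_add K S] at h
    norm_cast at h
    exact Nat.le_of_add_le_add_left h
  -- By `hle`, the set `S` contains `n` elements with linearly independent gradients.
  obtain ⟨b, hbS, hbspan, hbli⟩ := exists_linearIndependent K (gradient K '' S)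
  have hbfin : b.Finite := hbli.setFinite
  have hcard : n ≤ b.ncard := by
    rw [← hbspan] at hle
    have := hbfin.fintype
    rwa [finrank_span_set_eq_card hbli, ← Set.ncard_eq_toFinset_card'] at hle
  have he : Nonempty (Fin n ↪ b) := by
    have := hbfin.fintype
    rw [Function.Embedding.nonempty_iff_card_le, Fintype.card_fin]
    rwa [Set.ncard_eq_toFinset_card', Set.toFinset_card] at hcard
  obtain ⟨e⟩ := he
  choose p hpS hp using fun r => hbS (e r).2
  choose s hs a ha hgrad using fun r => exists_gradient_eq K q hq hgq hg (p r) (hS (hpS r))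
  have hli : LinearIndependent K fun r => gradient K (p r) := by
    have : (fun r => gradient K (p r)) = fun r => (e r : (σ → K) →ₗ[K] K) := funext hp
    rw [this]
    exact hbli.comp e e.injective
  -- `A` expresses the chosen elements of `S`, up to the factors `s r`, through the generators `g`.
  -- If its determinant vanished at the point, a null vector of `A` there would be a relation
  -- between the independent gradients.
  let A : Matrix (Fin n) (Fin n) (MvPolynomial σ ℂ) := Matrix.of a
  have hdet : A.det ∉ q := by
    intro hA
    rw [← hq, RingHom.map_det] at hA
    obtain ⟨c, hc0, hc⟩ := Matrix.exists_vecMul_eq_zero_iff.2 hA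
    refine hc0 (funext fun r => ?_)
    have hs' : algebraMap (MvPolynomial σ ℂ) K (s r) ≠ 0 := fun h => hs r ((hq _).1 h)
    have h0 := Fintype.linearIndependent_iff.1 hli
      (fun r => c r * algebraMap (MvPolynomial σ ℂ) K (s r)) ?_ r
    · exact (mul_eq_zero.1 h0).resolve_right hs'
    · simp_rw [mul_smul, hgrad, Finset.smul_sum, smul_smul]
      rw [Finset.sum_comm]
      refine Finset.sum_eq_zero fun t _ => ?_
      rw [← Finset.sum_smul]
      have := congrFun hc t
      simp only [Matrix.vecMul, dotProduct, RingHom.mapMatrix_apply, Matrix.map_apply, A,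
        Matrix.of_apply, Pi.zero_apply] at this
      rw [this, zero_smul]
  -- Since `A` is invertible at the point, its adjugate recovers each generator from elements of
  -- `S`, up to the factor `A.det`.
  have hmem (t : Fin n) : A.det * g t ∈ Ideal.span S := by
    have h1 : A.det * g t = ∑ r, A.adjugate t r * (s r * p r) := by
      have h2 : A.mulVec g = fun r => s r * p r := by
        ext1 r; rw [ha r]; rfl
      have h3 : (A.adjugate * A).mulVec g = A.adjugate.mulVec (fun r => s r * p r) := by
        rw [← Matrix.mulVec_mulVec, h2]
      rw [Matrix.adjugate_mul, Matrix.smul_mulVec, Matrix.one_mulVec] at h3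
      exact congrFun h3 t
    rw [h1]
    exact Ideal.sum_mem _ fun r _ => Ideal.mul_mem_left _ _
      (Ideal.mul_mem_left _ _ (Ideal.subset_span (hpS r)))
  obtain ⟨s', hs', hf'⟩ := hg f hf
  refine ⟨A.det * s', fun h => (‹q.IsPrime›.mem_or_mem h).elim hdet hs', ?_⟩
  obtain ⟨d, hd⟩ := (Ideal.mem_span_range_iff_exists_fun).1 hf'
  rw [mul_assoc, ← hd, Finset.mul_sum]
  refine Ideal.sum_mem _ fun t _ => ?_
  rw [mul_left_comm]
  exact Ideal.mul_mem_left _ _ (hmem t)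

end Tangent

end BiProj

namespace BiProj

/-! ### Affine charts: dehomogenization at a point -/

section Chart

variable {σ : Type} {w : σ → ℕ × ℕ} {I : Ideal (MvPolynomial σ ℂ)}

/-- A dehomogenization at `z`: a multiplicative family `t d` of bihomogeneous polynomials of
bidegree `d` which do not vanish at `z`. -/
structure Chart (z : Point w I) where
  t : ℕ × ℕ → MvPolynomial σ ℂ
  t_zero : t 0 = 1
  t_add : ∀ a b, t (a + b) = t a * t b
  t_mem : ∀ s, t (w s) ∈ piece w (w s)
  t_notMem : ∀ d, t d ∉ z.ideal

namespace Chart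

variable {z : Point w I} (c : Chart z)

lemma t_nsmul (n : ℕ) (d : ℕ × ℕ) : c.t (n • d) = c.t d ^ n := by
  induction n with
  | zero => simp [c.t_zero]
  | succ n ih => rw [succ_nsmul, c.t_add, ih, pow_succ]

lemma t_weight (m : σ →₀ ℕ) : c.t (Finsupp.weight w m) = m.prod fun s n => c.t (w s) ^ n := by
  induction m using Finsupp.induction_linear with
  | zero => simp [c.t_zero]
  | add f g hf hg =>
    rw [map_add, c.t_add, hf, hg, Finsupp.prod_add_index' (by simp) (by simp [pow_add])]
  | single s n => rw [Finsupp.weight_single, c.t_nsmul, Finsupp.prod_single_index (by simp)]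

lemma t_weight_mem (m : σ →₀ ℕ) :
    c.t (Finsupp.weight w m) ∈ piece w (Finsupp.weight w m) := by
  induction m using Finsupp.induction_linear with
  | zero => rw [map_zero, c.t_zero]; exact SetLike.GradedOne.one_mem
  | add f g hf hg => rw [map_add, c.t_add]; exact SetLike.GradedMul.mul_mem hf hg
  | single s n =>
    rw [Finsupp.weight_single, c.t_nsmul]
    exact SetLike.pow_mem_graded n (c.t_mem s)

/-- The ideal of the closed subscheme `t = 1` of affine space. -/
def ideal : Ideal (MvPolynomial σ ℂ) := Ideal.span (Set.range fun s => c.t (w s) - 1)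

lemma t_weight_sub_one_mem (m : σ →₀ ℕ) : c.t (Finsupp.weight w m) - 1 ∈ c.ideal := by
  rw [← Ideal.Quotient.mk_eq_mk_iff_sub_mem, c.t_weight, Finsupp.prod, map_prod, map_one]
  refine Finset.prod_eq_one fun s _ => ?_
  have : Ideal.Quotient.mk c.ideal (c.t (w s)) = 1 := by
    rw [← map_one (Ideal.Quotient.mk c.ideal), Ideal.Quotient.mk_eq_mk_iff_sub_mem]
    exact Ideal.subset_span ⟨s, rfl⟩
  rw [map_pow, this, one_pow]

/-- Dehomogenization, as a map to the ambient local ring. -/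
def ambientEval : MvPolynomial σ ℂ →ₐ[ℂ] ambientRing z :=
  aeval fun s => HomogeneousLocalization.mk (𝒜 := piece w) (x := z.ideal.primeCompl)
    ⟨w s, ⟨X s, isWeightedHomogeneous_X ℂ w s⟩, ⟨c.t (w s), c.t_mem s⟩, c.t_notMem _⟩

lemma val_ambientEval_monomial_mul (m : σ →₀ ℕ) (a : ℂ) :
    (c.ambientEval (monomial m a)).val *
      algebraMap _ (Localization.AtPrime z.ideal) (c.t (Finsupp.weight w m)) =
        algebraMap (MvPolynomial σ ℂ) _ (monomial m a) := by
  let V : MvPolynomial σ ℂ →+* Localization.AtPrime z.ideal :=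
    (algebraMap (ambientRing z) (Localization.AtPrime z.ideal)).comp c.ambientEval.toRingHom
  change V (monomial m a) * _ = _
  have hX (s : σ) : V (X s) *
      algebraMap _ (Localization.AtPrime z.ideal) (c.t (w s)) =
        algebraMap (MvPolynomial σ ℂ) _ (X s) := by
    change (c.ambientEval (X s)).val * _ = _
    rw [ambientEval, aeval_X, HomogeneousLocalization.val_mk, Localization.mk_eq_mk']
    exact IsLocalization.mk'_spec _ (X s : MvPolynomial σ ℂ) (⟨c.t (w s), c.t_notMem _⟩ : z.ideal.primeCompl)
  have hC : V (C a) = algebraMap (MvPolynomial σ ℂ) _ (C a) := by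
    change (c.ambientEval (C a)).val = _
    rw [← algebraMap_eq, AlgHom.commutes]
    rfl
  rw [c.t_weight, monomial_eq, map_mul, map_mul, hC, mul_assoc, Finsupp.prod, Finsupp.prod,
    map_prod, map_prod, map_prod, ← Finset.prod_mul_distrib]
  refine congrArg _ (Finset.prod_congr rfl fun s _ => ?_)
  rw [map_pow, map_pow, map_pow, ← mul_pow, hX]

/-- Dehomogenizing divides each variable by a chart function of the same bidegree. A monomial is
thereby divided by `c.t` of its weight, and this denominator is common to all monomials of `f`. -/
lemma val_ambientEval_mul {d : ℕ × ℕ} {f : MvPolynomial σ ℂ} (hf : f ∈ piece w d) :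
    (c.ambientEval f).val * algebraMap _ (Localization.AtPrime z.ideal) (c.t d) =
      algebraMap _ _ f := by
  change algebraMap (ambientRing z) (Localization.AtPrime z.ideal) (c.ambientEval f) * _ = _
  conv_lhs => rw [f.as_sum]
  conv_rhs => rw [f.as_sum]
  rw [map_sum, map_sum, map_sum, Finset.sum_mul]
  refine Finset.sum_congr rfl fun m hm => ?_
  rw [← hf (mem_support_iff.1 hm)]
  exact c.val_ambientEval_monomial_mul m _

lemma ambientEval_t (m : σ →₀ ℕ) : c.ambientEval (c.t (Finsupp.weight w m)) = 1 := by
  apply HomogeneousLocalization.val_injective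
  have h := c.val_ambientEval_mul (c.t_weight_mem m)
  have hu : IsUnit (algebraMap _ (Localization.AtPrime z.ideal) (c.t (Finsupp.weight w m))) :=
    IsLocalization.map_units (M := z.ideal.primeCompl) _ ⟨_, c.t_notMem _⟩
  rw [HomogeneousLocalization.val_one]
  exact hu.mul_right_cancel (h.trans (one_mul _).symm)

lemma isUnit_ambientEval {d : ℕ × ℕ} {f : MvPolynomial σ ℂ} (hf : f ∈ piece w d) :
    IsUnit (c.ambientEval f) ↔ f ∉ z.ideal := by
  have hu : IsUnit (algebraMap _ (Localization.AtPrime z.ideal) (c.t d)) :=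
    IsLocalization.map_units (M := z.ideal.primeCompl) _ ⟨_, c.t_notMem _⟩
  rw [← HomogeneousLocalization.isUnit_iff_isUnit_val, ← hu.mul_right_iff,
    c.val_ambientEval_mul hf, IsLocalization.AtPrime.isUnit_to_map_iff _ z.ideal]
  rfl

lemma mk_mul_ambientEval {d : ℕ × ℕ} {f g : MvPolynomial σ ℂ} (hf : f ∈ piece w d)
    (hg : g ∈ piece w d) (hgz : g ∉ z.ideal) :
    HomogeneousLocalization.mk ⟨d, ⟨f, hf⟩, ⟨g, hg⟩, hgz⟩ * c.ambientEval g = c.ambientEval f := by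
  apply HomogeneousLocalization.val_injective
  have hu : IsUnit (algebraMap _ (Localization.AtPrime z.ideal) (c.t d)) :=
    IsLocalization.map_units (M := z.ideal.primeCompl) _ ⟨_, c.t_notMem _⟩
  refine hu.mul_right_cancel ?_
  rw [HomogeneousLocalization.val_mul, mul_assoc, c.val_ambientEval_mul hf,
    c.val_ambientEval_mul hg, HomogeneousLocalization.val_mk, Localization.mk_eq_mk']
  exact IsLocalization.mk'_spec _ f (⟨g, hgz⟩ : z.ideal.primeCompl)

/-- Dehomogenization, as a map to the local ring. -/
def eval : MvPolynomial σ ℂ →ₐ[ℂ] localRing z :=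
  (Ideal.Quotient.mkₐ ℂ (localIdeal z)).comp c.ambientEval

lemma localIdeal_ne_top : localIdeal z ≠ ⊤ := by
  rw [Ideal.ne_top_iff_one]
  intro h
  change (algebraMap (ambientRing z) (Localization.AtPrime z.ideal)) 1 ∈
    I.map (algebraMap (MvPolynomial σ ℂ) (Localization.AtPrime z.ideal)) at h
  rw [map_one, ← Ideal.eq_top_iff_one] at h
  have h1 : I.map (algebraMap (MvPolynomial σ ℂ) (Localization.AtPrime z.ideal)) ≤
      IsLocalRing.maximalIdeal _ := by
    rw [← Localization.AtPrime.map_eq_maximalIdeal]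
    exact Ideal.map_mono z.le_ideal
  rw [h] at h1
  exact Ideal.IsPrime.ne_top' (top_le_iff.1 h1)

instance (z : Point w I) : Nontrivial (localRing z) :=
  Ideal.Quotient.nontrivial_iff.2 localIdeal_ne_top

instance (z : Point w I) : IsLocalRing (localRing z) :=
  IsLocalRing.of_surjective' (Ideal.Quotient.mk (localIdeal z)) Ideal.Quotient.mk_surjective

lemma isUnit_quotientMk (x : ambientRing z) :
    IsUnit (Ideal.Quotient.mk (localIdeal z) x) ↔ IsUnit x := by
  refine ⟨fun h => ?_, fun h => h.map _⟩
  by_contra hx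
  have h1 := IsLocalRing.le_maximalIdeal (localIdeal_ne_top (z := z))
  obtain ⟨y, hy⟩ := h.exists_right_inv
  obtain ⟨y, rfl⟩ := Ideal.Quotient.mk_surjective y
  rw [← map_mul, ← map_one (Ideal.Quotient.mk (localIdeal z)),
    Ideal.Quotient.mk_eq_mk_iff_sub_mem] at hy
  have h2 := h1 hy
  have h3 : x * y ∈ IsLocalRing.maximalIdeal (ambientRing z) := Ideal.mul_mem_right _ _ hx
  have h4 := Ideal.sub_mem _ h3 h2
  rw [sub_sub_cancel] at h4
  exact (Ideal.ne_top_iff_one _).1 (IsLocalRing.maximalIdeal.isMaximal _).ne_top h4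

lemma isUnit_eval {d : ℕ × ℕ} {f : MvPolynomial σ ℂ} (hf : f ∈ piece w d) :
    IsUnit (c.eval f) ↔ f ∉ z.ideal := by
  rw [← c.isUnit_ambientEval hf]
  exact isUnit_quotientMk _

lemma eval_t (m : σ →₀ ℕ) : c.eval (c.t (Finsupp.weight w m)) = 1 :=
  (congrArg (Ideal.Quotient.mk (localIdeal z)) (c.ambientEval_t m)).trans (map_one _)

/-- The prime ideal of the point of affine space corresponding to `z`. -/
def prime : Ideal (MvPolynomial σ ℂ) := (IsLocalRing.maximalIdeal (localRing z)).comap c.eval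

instance : c.prime.IsPrime := by unfold prime; infer_instance

lemma mem_prime {f : MvPolynomial σ ℂ} : f ∈ c.prime ↔ ¬ IsUnit (c.eval f) := Iff.rfl

lemma mem_prime_iff {d : ℕ × ℕ} {f : MvPolynomial σ ℂ} (hf : f ∈ piece w d) :
    f ∈ c.prime ↔ f ∈ z.ideal := by
  rw [mem_prime, c.isUnit_eval hf, not_not]

lemma ideal_le_ker : c.ideal ≤ RingHom.ker c.eval := by
  rw [ideal, Ideal.span_le]
  rintro _ ⟨s, rfl⟩
  have := c.eval_t (Finsupp.single s 1)
  rw [Finsupp.weight_single, one_smul] at this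
  rw [SetLike.mem_coe, RingHom.mem_ker, map_sub, map_one, this, sub_self]

lemma le_prime : c.ideal ≤ c.prime := by
  intro f hf
  rw [mem_prime, RingHom.mem_ker.1 (c.ideal_le_ker hf)]
  exact not_isUnit_zero

/-- Numerator and denominator of a fraction of bidegree zero can be dehomogenized separately.
Questions about elements of the local ring are reduced to polynomials in this way throughout. -/
lemma exists_eval_mul_eq (x : localRing z) :
    ∃ f g : MvPolynomial σ ℂ, g ∉ c.prime ∧ x * c.eval g = c.eval f := by
  obtain ⟨x, rfl⟩ := Ideal.Quotient.mk_surjective x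
  obtain ⟨⟨d, ⟨f, hf⟩, ⟨g, hg⟩, hgz⟩, rfl⟩ := HomogeneousLocalization.mk_surjective x
  refine ⟨f, g, fun h => hgz ((c.mem_prime_iff hg).1 h), ?_⟩
  exact congrArg (Ideal.Quotient.mk (localIdeal z)) (c.mk_mul_ambientEval hf hg hgz)

lemma localFraction_mul_eval {d : ℕ × ℕ} {f g : MvPolynomial σ ℂ} (hf : f ∈ piece w d)
    (hg : g ∈ piece w d) (hgz : g ∉ z.ideal) :
    localFraction z hf hg hgz * c.eval g = c.eval f :=
  congrArg (Ideal.Quotient.mk (localIdeal z)) (c.mk_mul_ambientEval hf hg hgz)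

lemma eval_eq_zero_iff {d : ℕ × ℕ} {f : MvPolynomial σ ℂ} (hf : f ∈ piece w d) :
    c.eval f = 0 ↔ ∃ s ∉ z.ideal, s * f ∈ I := by
  have hu : IsUnit (algebraMap _ (Localization.AtPrime z.ideal) (c.t d)) :=
    IsLocalization.map_units (M := z.ideal.primeCompl) _ ⟨_, c.t_notMem _⟩
  have h1 : c.eval f = 0 ↔ c.ambientEval f ∈ localIdeal z := Ideal.Quotient.eq_zero_iff_mem
  rw [h1]
  change (c.ambientEval f).val ∈ I.map (algebraMap (MvPolynomial σ ℂ) _) ↔ _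
  rw [← Ideal.mul_unit_mem_iff_mem _ hu, c.val_ambientEval_mul hf,
    IsLocalization.algebraMap_mem_map_algebraMap_iff z.ideal.primeCompl]
  rfl

/-- Every polynomial can be homogenized modulo `t = 1`. -/
lemma exists_homogenization (f : MvPolynomial σ ℂ) :
    ∃ (m : σ →₀ ℕ) (g : MvPolynomial σ ℂ), g ∈ piece w (Finsupp.weight w m) ∧ f - g ∈ c.ideal := by
  classical
  refine ⟨∑ m ∈ f.support, m, ∑ m ∈ f.support,
    c.t (Finsupp.weight w (∑ n ∈ f.support.erase m, n)) * monomial m (coeff m f), ?_, ?_⟩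
  · refine Submodule.sum_mem _ fun m hm => ?_
    rw [← Finset.sum_erase_add _ _ hm, map_add]
    refine SetLike.GradedMul.mul_mem (c.t_weight_mem _) ?_
    exact isWeightedHomogeneous_monomial w m _ rfl
  · nth_rw 1 [f.as_sum]
    rw [← Finset.sum_sub_distrib]
    refine Ideal.sum_mem _ fun m hm => ?_
    rw [← neg_mem_iff, neg_sub, ← sub_one_mul]
    exact Ideal.mul_mem_right _ _ (c.t_weight_sub_one_mem _)

/-- Replace `f` by a homogenization `g`, which changes it only modulo `t = 1`. Some `s` outside `z`
multiplies `g` into `I`; as `I` and `g` are homogeneous, a bihomogeneous component of `s` not in `z`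
does so as well, and for such a component membership in `z.ideal` and in `c.prime` agree. -/
lemma exists_mul_mem_of_eval_eq_zero (hI : I.IsHomogeneous (piece w)) {f : MvPolynomial σ ℂ}
    (hf : c.eval f = 0) : ∃ s ∉ c.prime, s * f ∈ I ⊔ c.ideal := by
  classical
  obtain ⟨m, g, hg, hfg⟩ := c.exists_homogenization f
  have h0 : c.eval g = 0 := by
    have := RingHom.mem_ker.1 (c.ideal_le_ker hfg)
    rwa [map_sub, hf, zero_sub, neg_eq_zero] at this
  obtain ⟨s, hs, hsg⟩ := (c.eval_eq_zero_iff hg).1 h0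
  have hex : ∃ d, (DirectSum.decompose (piece w) s d : MvPolynomial σ ℂ) ∉ z.ideal := by
    by_contra! h
    refine hs ?_
    rw [← DirectSum.sum_support_decompose (piece w) s]
    exact Ideal.sum_mem _ fun d _ => h d
  obtain ⟨d, hd⟩ := hex
  refine ⟨_, fun h => hd ((c.mem_prime_iff (Subtype.mem _)).1 h), ?_⟩
  have h1 := hI (d + Finsupp.weight w m) hsg
  rw [DirectSum.coe_decompose_mul_add_of_right_mem (piece w) hg] at h1
  have h2 : ((DirectSum.decompose (piece w) s d : MvPolynomial σ ℂ)) * f =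
      (DirectSum.decompose (piece w) s d : MvPolynomial σ ℂ) * g +
      (DirectSum.decompose (piece w) s d : MvPolynomial σ ℂ) * (f - g) := by ring
  rw [h2]
  exact Submodule.add_mem_sup h1 (Ideal.mul_mem_left _ _ hfg)

lemma le_ker_eval (hI : I.IsHomogeneous (piece w)) : I ≤ RingHom.ker c.eval := by
  classical
  intro f hf
  rw [← DirectSum.sum_support_decompose (piece w) f]
  refine Ideal.sum_mem _ fun d _ => ?_
  rw [RingHom.mem_ker, c.eval_eq_zero_iff (Subtype.mem _)]
  exact ⟨1, (Ideal.ne_top_iff_one _).1 z.isPrime.ne_top, by rw [one_mul]; exact hI d hf⟩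

lemma sup_le_ker_eval (hI : I.IsHomogeneous (piece w)) : I ⊔ c.ideal ≤ RingHom.ker c.eval :=
  sup_le (c.le_ker_eval hI) c.ideal_le_ker

end Chart

end Chart

end BiProj

namespace CubicSurface

/-! ### Linear algebra of a symmetric trilinear form along a line with triple contact -/

section FieldLemmas

/-- Trilinear forms on `S⁴`. -/
abbrev Trilinear (S : Type*) [CommRing S] : Type _ :=
  (Fin 4 → S) →ₗ[S] (Fin 4 → S) →ₗ[S] (Fin 4 → S) →ₗ[S] S

/-- The standard basis vectors. -/
abbrev basisVec (S : Type*) [CommRing S] (a : Fin 4) : Fin 4 → S := Pi.single a 1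

lemma sum_smul_basisVec {S : Type*} [CommRing S] (z : Fin 4 → S) :
    ∑ a, z a • basisVec S a = z := by
  ext b
  simp [Pi.single_apply]

lemma linearMap_eq_sum {S : Type*} [CommRing S] (φ : (Fin 4 → S) →ₗ[S] S) (z : Fin 4 → S) :
    φ z = ∑ a, z a * φ (basisVec S a) := by
  conv_lhs => rw [← sum_smul_basisVec z]
  simp

/-- An enumeration of the four indices. -/
structure IsEnum (i j k l : Fin 4) : Prop where
  ij : i ≠ j
  ik : i ≠ k
  il : i ≠ l
  jk : j ≠ k
  jl : j ≠ l
  kl : k ≠ l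

lemma exists_isEnum : ∀ {i j : Fin 4}, i ≠ j → ∃ k l, IsEnum i j k l := by
  intro i j h
  have : ∀ i j : Fin 4, i ≠ j → ∃ k l, i ≠ k ∧ i ≠ l ∧ j ≠ k ∧ j ≠ l ∧ k ≠ l := by decide
  obtain ⟨k, l, h1, h2, h3, h4, h5⟩ := this i j h
  exact ⟨k, l, h, h1, h2, h3, h4, h5⟩

namespace IsEnum

variable {i j k l : Fin 4} (e : IsEnum i j k l)

include e

lemma cases (a : Fin 4) : a = i ∨ a = j ∨ a = k ∨ a = l := by
  obtain ⟨h1, h2, h3, h4, h5, h6⟩ := e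
  lia

lemma sum_eq {M : Type*} [AddCommMonoid M] (f : Fin 4 → M) :
    ∑ a, f a = f i + f j + f k + f l := by
  have h : (Finset.univ : Finset (Fin 4)) = {i, j, k, l} := by
    ext a
    simpa using e.cases a
  rw [h, Finset.sum_insert, Finset.sum_insert, Finset.sum_insert, Finset.sum_singleton]
  · simp only [add_assoc]
  · simpa using e.kl
  · simpa using ⟨e.jk, e.jl⟩
  · simpa using ⟨e.ij, e.ik, e.il⟩

lemma funext {S : Type*} {x y : Fin 4 → S} (hi : x i = y i) (hj : x j = y j) (hk : x k = y k)
    (hl : x l = y l) : x = y := by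
  ext a
  rcases e.cases a with rfl | rfl | rfl | rfl <;> assumption

end IsEnum

/-- Symmetric trilinear forms. -/
structure Trilinear.IsSymm {S : Type*} [CommRing S] (T : Trilinear S) : Prop where
  left : ∀ x y z, T x y z = T y x z
  right : ∀ x y z, T x y z = T x z y

/-- The vector in the tangent plane `T x x = 0` with coordinates in two given directions. -/
def tangentVec {S : Type*} [CommRing S] (T : Trilinear S) (x : Fin 4 → S) (a b : Fin 4) :
    Fin 4 → S :=
  T x x (basisVec S a) • basisVec S b - T x x (basisVec S b) • basisVec S a

lemma apply_tangentVec {S : Type*} [CommRing S] (T : Trilinear S) (x : Fin 4 → S) (a b : Fin 4) :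
    T x x (tangentVec T x a b) = 0 := by
  simp only [tangentVec, map_sub, map_smul, smul_eq_mul]
  ring

/-- The determinant of the linear forms `T x x` and `T x v` restricted to two coordinates. -/
def minor {S : Type*} [CommRing S] (T : Trilinear S) (x v : Fin 4 → S) (k l : Fin 4) : S :=
  T x v (tangentVec T x k l)

lemma minor_eq {S : Type*} [CommRing S] (T : Trilinear S) (x v : Fin 4 → S) (k l : Fin 4) :
    minor T x v k l = T x x (basisVec S k) * T x v (basisVec S l) -
      T x x (basisVec S l) * T x v (basisVec S k) := by
  simp only [minor, tangentVec, map_sub, map_smul, smul_eq_mul]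

/-- The matrix of the bilinear form `T x`. -/
def formMatrix {S : Type*} [CommRing S] (T : Trilinear S) (x : Fin 4 → S) :
    Matrix (Fin 4) (Fin 4) S :=
  Matrix.of fun a b => T x (basisVec S a) (basisVec S b)

lemma formMatrix_mulVec {S : Type*} [CommRing S] (T : Trilinear S) (x y : Fin 4 → S) (a : Fin 4) :
    (formMatrix T x).mulVec y a = T x (basisVec S a) y := by
  rw [linearMap_eq_sum (T x (basisVec S a)) y]
  simp [Matrix.mulVec, dotProduct, formMatrix, mul_comm]

lemma det_four_of_block {S : Type*} [CommRing S] (M : Matrix (Fin 4) (Fin 4) S)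
    (h00 : M 0 0 = 0) (h01 : M 0 1 = 0) (h10 : M 1 0 = 0) (h11 : M 1 1 = 0) :
    M.det = (M 0 2 * M 1 3 - M 0 3 * M 1 2) * (M 2 0 * M 3 1 - M 3 0 * M 2 1) := by
  rw [Matrix.det_succ_row_zero]
  simp [Fin.sum_univ_four, Matrix.det_fin_three, Fin.succAbove, h00, h01, h10, h11]
  ring

/-- The determinant of a symmetric form on a four-dimensional space with a totally isotropic plane
is a square. -/
lemma det_formMatrix_eq_sq {S : Type*} [CommRing S] {T : Trilinear S} (hT : T.IsSymm)
    {x v : Fin 4 → S} {i j k l : Fin 4} (e : IsEnum i j k l) (hx : x i = 1) (hvi : v i = 0)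
    (hvj : v j = 1) (h0 : T x x x = 0) (h1 : T x x v = 0) (h2 : T x v v = 0) :
    (formMatrix T x).det = minor T x v k l ^ 2 := by
  -- `M` is the change of basis with columns `x`, `v` and the basis vectors of the indices `k`, `l`.
  let M : Matrix (Fin 4) (Fin 4) S := Matrix.of fun a b =>
    (![x, v, basisVec S k, basisVec S l] b) a
  have hbij : Function.Bijective ![i, j, k, l] := by
    rw [Fintype.bijective_iff_injective_and_card]
    refine ⟨?_, rfl⟩
    obtain ⟨h1, h2, h3, h4, h5, h6⟩ := e
    intro a b
    fin_cases a <;> fin_cases b <;> simp [*, Ne.symm]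
  -- With its rows in the order `i, j, k, l`, the matrix is lower triangular with ones on the
  -- diagonal, so its determinant is a sign.
  have hM : M.det ^ 2 = 1 := by
    have h := Matrix.det_permute (Equiv.ofBijective _ hbij) M
    have h1 : (M.submatrix (Equiv.ofBijective _ hbij) id).det = 1 := by
      rw [Matrix.det_of_isLowerTriangular]
      · simp [Fin.prod_univ_four, M, hx, hvj]
      · intro a b hab
        rw [OrderDual.toDual_lt_toDual] at hab
        fin_cases a <;> fin_cases b <;>
          simp [M, hvi, e.ik, e.il, e.jk, e.jl, e.kl] at hab ⊢
    rw [h1] at h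
    have h2 := congrArg (· ^ 2) h
    simp only [one_pow, mul_pow] at h2
    rw [← Int.cast_pow, ← Units.val_pow_eq_pow_val, Int.units_sq, Units.val_one, Int.cast_one,
      one_mul] at h2
    exact h2.symm
  have hprod (a b : Fin 4) : (M.transpose * formMatrix T x * M) a b =
      T x (![x, v, basisVec S k, basisVec S l] a) (![x, v, basisVec S k, basisVec S l] b) := by
    rw [Matrix.mul_assoc, Matrix.mul_apply, hT.right, linearMap_eq_sum (T x _)]
    refine Finset.sum_congr rfl fun c _ => congrArg _ ?_
    rw [hT.right, ← formMatrix_mulVec]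
    rfl
  -- In the new basis the upper left `2 × 2` block vanishes, because `x` and `v` span an isotropic
  -- plane. The two factors of the determinant agree up to sign by symmetry.
  have hdet := det_four_of_block (M.transpose * formMatrix T x * M)
    ((hprod 0 0).trans h0) ((hprod 0 1).trans h1)
    ((hprod 1 0).trans ((hT.right _ _ _).trans h1)) ((hprod 1 1).trans h2)
  rw [Matrix.det_mul, Matrix.det_mul, Matrix.det_transpose, mul_comm, ← mul_assoc, ← sq, hM,
    one_mul] at hdet
  simp only [hprod] at hdet
  rw [hdet, minor_eq]
  simp [hT.right x (Pi.single _ _)]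
  ring

section Field

variable {K : Type*} [Field K] {T : Trilinear K}

lemma exists_eq_mul_of_ker_le {V : Type*} [AddCommGroup V] [Module K V] {g φ : V →ₗ[K] K}
    (h : ∀ z, g z = 0 → φ z = 0) : ∃ c, ∀ z, φ z = c * g z := by
  by_cases hg : g = 0
  · exact ⟨0, fun z => by rw [h z (by simp [hg])]; simp⟩
  · obtain ⟨e, he⟩ := DFunLike.ne_iff.1 hg
    rw [LinearMap.zero_apply] at he
    refine ⟨φ e / g e, fun z => ?_⟩
    have h1 := h (z - (g z / g e) • e) (by simp [he])
    rw [map_sub, map_smul, sub_eq_zero, smul_eq_mul] at h1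
    rw [h1]
    ring

/-- The consequences of nonsingularity for the cubic form `T x x x`. -/
structure Trilinear.IsNondegenerate (T : Trilinear K) : Prop where
  ne_zero : ∀ x, (∀ z, T x x z = 0) → x = 0
  pencil : ∀ x y a b, x ≠ 0 → (∀ z, T x y z = a * T x x z) → (∀ z, T y y z = b * T x x z) →
    ∃ r : K, y = r • x

/-- The data of a line through the point `x` spanned by `x` and `v`, with triple contact with the
cubic surface `T x x x = 0`, in the chart `x i = 1`, `v i = 0`, `v j = 1`. -/
structure IsTripleContact {S : Type*} [CommRing S] (T : Trilinear S) (i j : Fin 4)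
    (x v : Fin 4 → S) : Prop where
  xi : x i = 1
  vi : v i = 0
  vj : v j = 1
  xxx : T x x x = 0
  xxv : T x x v = 0
  xvv : T x v v = 0

namespace IsTripleContact

variable {i j k l : Fin 4} {x v : Fin 4 → K} (h : IsTripleContact T i j x v) (e : IsEnum i j k l)

include h e

lemma eq_combination (z : Fin 4 → K) : z = z i • x + (z j - z i * x j) • v +
    ((z k - z i * x k - (z j - z i * x j) * v k) • basisVec K k +
      (z l - z i * x l - (z j - z i * x j) * v l) • basisVec K l) := by
  refine e.funext ?_ ?_ ?_ ?_
  · simp [h.xi, h.vi, e.ik, e.il]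
  · simp [h.vj, e.jk, e.jl]
  · simp [e.kl]
  · simp [e.kl.symm]

/-- `T x x` already vanishes on `x` and `v`, which together with the basis vectors of indices `k`,
`l` span everything. If it vanished on those as well, `x` would be a singular point. -/
lemma gradient_ne_zero (hN : T.IsNondegenerate) :
    T x x (basisVec K k) ≠ 0 ∨ T x x (basisVec K l) ≠ 0 := by
  by_contra! hkl
  have : x = 0 := hN.ne_zero x fun z => by
    rw [h.eq_combination e z]
    simp [h.xxx, h.xxv, hkl.1, hkl.2]
  simpa [this] using h.xi

/-- `T x x` and `T x v` both vanish on `x` and `v`, so they descend to a plane, where `minor` is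
their determinant. As `T x x` is nonzero there, a zero determinant makes `T x v` a multiple of it:
the tangent plane is stationary in the direction of the line. -/
lemma exists_eq_mul (hT : T.IsSymm) (hN : T.IsNondegenerate) (hm : minor T x v k l = 0) :
    ∃ c, ∀ z, T x v z = c * T x x z := by
  rw [minor_eq] at hm
  have key (c : K) (hk : T x v (basisVec K k) = c * T x x (basisVec K k))
      (hl : T x v (basisVec K l) = c * T x x (basisVec K l)) (z) : T x v z = c * T x x z := by
    rw [h.eq_combination e z]
    simp only [map_add, map_smul, smul_eq_mul, hk, hl, h.xxx, h.xxv, h.xvv, hT.right x v x]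
    ring
  rcases h.gradient_ne_zero e hN with h0 | h0
  · refine ⟨T x v (basisVec K k) / T x x (basisVec K k), key _ (by field_simp) ?_⟩
    field_simp
    linear_combination hm
  · refine ⟨T x v (basisVec K l) / T x x (basisVec K l), key _ ?_ (by field_simp)⟩
    field_simp
    linear_combination -hm

omit h in
lemma tangentVec_i : tangentVec T x k l i = 0 := by
  simp [tangentVec, e.ik, e.il]

omit h in
lemma tangentVec_j : tangentVec T x k l j = 0 := by
  simp [tangentVec, e.jk, e.jl]

/-- `x`, `v` and `tangentVec T x k l` form a basis of the tangent plane `T x x = 0`. -/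
lemma exists_eq_combination (hN : T.IsNondegenerate) {z : Fin 4 → K} (hz : T x x z = 0) :
    ∃ r : K, z = z i • x + (z j - z i * x j) • v + r • tangentVec T x k l := by
  have hz' := hz
  rw [h.eq_combination e z] at hz'
  simp only [map_add, map_smul, smul_eq_mul, h.xxx, h.xxv, mul_zero, zero_add] at hz'
  rcases h.gradient_ne_zero e hN with h0 | h0
  · refine ⟨(z l - z i * x l - (z j - z i * x j) * v l) / T x x (basisVec K k), ?_⟩
    conv_lhs => rw [h.eq_combination e z]
    congr 1
    refine e.funext ?_ ?_ ?_ ?_ <;> simp [tangentVec, e.ik, e.il, e.jk, e.jl, e.kl, e.kl.symm] <;>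
      field_simp
    all_goals first | ring1 | linear_combination hz'
  · refine ⟨-(z k - z i * x k - (z j - z i * x j) * v k) / T x x (basisVec K l), ?_⟩
    conv_lhs => rw [h.eq_combination e z]
    congr 1
    refine e.funext ?_ ?_ ?_ ?_ <;> simp [tangentVec, e.ik, e.il, e.jk, e.jl, e.kl, e.kl.symm] <;>
      field_simp
    all_goals first | ring1 | linear_combination hz'

end IsTripleContact

/-- If the second fundamental form vanishes at `x` and to first order in the direction `y`,
then `y` is proportional to `x`. -/
lemma exists_eq_smul_of_flat (hT : T.IsSymm) (hN : T.IsNondegenerate) {x y : Fin 4 → K}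
    (hx : x ≠ 0) (hxy : T x x y = 0)
    (hII : ∀ w w', T x x w = 0 → T x x w' = 0 → T x w w' = 0)
    (hy : ∀ a b c d,
      T y (tangentVec T x a b) (tangentVec T x c d) +
      T x ((2 * T x y (basisVec K a)) • basisVec K b - (2 * T x y (basisVec K b)) • basisVec K a)
        (tangentVec T x c d) +
      T x (tangentVec T x a b)
        ((2 * T x y (basisVec K c)) • basisVec K d - (2 * T x y (basisVec K d)) • basisVec K c)
        = 0) :
    ∃ r : K, y = r • x := by
  have hprop (w) (hw : T x x w = 0) : ∃ c, ∀ z, T x w z = c * T x x z :=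
    exists_eq_mul_of_ker_le fun z hz => hII w z hw hz
  obtain ⟨m, hm⟩ := hprop y hxy
  -- Since `T x y` is `m` times `T x x`, moving along `y` changes a tangent vector by `2 * m` times
  -- itself. By flatness at `x` this does not contribute, and only the term in `T y` remains of
  -- `hy`.
  have h1 (a b c d) : T y (tangentVec T x a b) (tangentVec T x c d) = 0 := by
    have h2 := hy a b c d
    obtain ⟨m1, hm1⟩ := hprop _ (apply_tangentVec T x a b)
    obtain ⟨m2, hm2⟩ := hprop _ (apply_tangentVec T x c d)
    rw [hT.right x _ (tangentVec T x c d), hm1, hm2] at h2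
    simp only [map_sub, map_smul, smul_eq_mul, hm] at h2
    linear_combination h2
  have hne : ∃ a, T x x (basisVec K a) ≠ 0 := by
    by_contra! h0
    refine hx (hN.ne_zero x fun z => ?_)
    rw [linearMap_eq_sum]
    simp [h0]
  obtain ⟨a, ha⟩ := hne
  -- With `a` chosen so that the partial derivative is nonzero, the vectors `tangentVec T x a b`
  -- span the tangent plane.
  have hspan (w) (hw : T x x w = 0) : T x x (basisVec K a) • w = ∑ b, w b • tangentVec T x a b := by
    rw [linearMap_eq_sum] at hw
    simp only [tangentVec, smul_sub, Finset.sum_sub_distrib, smul_smul, ← Finset.sum_smul]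
    rw [hw, zero_smul, sub_zero]
    simp_rw [mul_comm _ (T x x (basisVec K a)), mul_smul]
    rw [← Finset.smul_sum, sum_smul_basisVec]
  have h2 (w w') (hw : T x x w = 0) (hw' : T x x w' = 0) : T y w w' = 0 := by
    have h3 : T y (T x x (basisVec K a) • w) (T x x (basisVec K a) • w') = 0 := by
      rw [hspan w hw, hspan w' hw']
      simp [h1]
    simpa [ha] using h3
  -- Both `T x y` and `T y y` are now multiples of `T x x`, so nondegeneracy applies.
  obtain ⟨b, hb⟩ := exists_eq_mul_of_ker_le (g := T x x) (φ := T y y) fun z hz => h2 y z hxy hz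
  exact hN.pencil x y m b hx hm hb

/-- First order deformations of a line with triple contact along which the minor stays zero: they
are controlled by one parameter. -/
lemma IsTripleContact.exists_functional (hT : T.IsSymm) (hN : T.IsNondegenerate)
    {i j k l : Fin 4} {x v : Fin 4 → K}
    (h : IsTripleContact T i j x v) (e : IsEnum i j k l) (hm : minor T x v k l = 0)
    (P : (Fin 4 → K) → Prop)
    (hP : T x (tangentVec T x k l) (tangentVec T x k l) = 0 → ∀ y, P y → T x x y = 0 →
      ∃ r : K, y = r • x) :
    ∃ f f' : (Fin 4 → K) →ₗ[K] K, ∀ y u : Fin 4 → K, P y → y i = 0 → u i = 0 → u j = 0 →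
      T x x y = 0 → 2 * T x v y + T x x u = 0 → T v v y + 2 * T x v u = 0 →
      T y v (tangentVec T x k l) + T x u (tangentVec T x k l) +
        T x v ((2 * T x y (basisVec K k)) • basisVec K l -
          (2 * T x y (basisVec K l)) • basisVec K k) = 0 →
      f y + f' u = 0 → y = 0 ∧ u = 0 := by
  obtain ⟨c, hc⟩ := h.exists_eq_mul e hT hN hm
  set w := tangentVec T x k l with hw
  have hx0 : x ≠ 0 := fun h0 => by simpa [h0] using h.xi
  -- As `T x v` is a multiple of `T x x`, the second contact equation reduces to `T x x u = 0`. The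
  -- normalizations of `u` remove its components along `x` and `v`, leaving a multiple of `w`.
  have hu (y u : Fin 4 → K) (hui : u i = 0) (huj : u j = 0) (hy0 : T x x y = 0)
      (hy1 : 2 * T x v y + T x x u = 0) : T x x u = 0 ∧ ∃ s : K, u = s • w := by
    have h0 : T x x u = 0 := by simpa [hc, hy0] using hy1
    obtain ⟨s, hs⟩ := h.exists_eq_combination e hN h0
    exact ⟨h0, s, by simpa [hui, huj] using hs⟩
  have hw0 : w ≠ 0 := by
    intro h0
    have h1 := congrFun h0 k
    have h2 := congrFun h0 l
    simp [hw, tangentVec, e.kl, e.kl.symm] at h1 h2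
    rcases h.gradient_ne_zero e hN with h3 | h3
    · exact h3 h2
    · exact h3 h1
  by_cases hww : T x w w = 0
  -- Flat point: the point cannot move, so `y = 0`, and the one parameter is the multiple of `w` in
  -- `u`. This is the only case which uses `P`.
  · obtain ⟨a, ha⟩ := Function.ne_iff.1 hw0
    refine ⟨0, LinearMap.proj a, fun y u hPy hyi hui huj hy0 hy1 hy2 hy3 hf => ?_⟩
    obtain ⟨r, rfl⟩ := hP hww y hPy hy0
    have hr : r = 0 := by simpa [h.xi] using hyi
    obtain ⟨-, s, rfl⟩ := hu _ u hui huj hy0 hy1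
    have hs : s = 0 := (smul_eq_zero.1 (by simpa using hf : s • w a = 0)).resolve_right ha
    simp [hr, hs]
  -- Nonflat point. If `T v v` vanished on both `v` and `w`, it would be a multiple of `T x x`, like
  -- `T x v`, and nondegeneracy would make `v` a multiple of `x`.
  · have hvv : T v v v ≠ 0 ∨ T v v w ≠ 0 := by
      by_contra! h0
      obtain ⟨b, hb⟩ := exists_eq_mul_of_ker_le (g := T x x) (φ := T v v) fun z hz => by
        obtain ⟨r, hr⟩ := h.exists_eq_combination e hN hz
        rw [hr, ← hw]
        have : T v v x = 0 := by rw [hT.right, hT.left, h.xvv]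
        simp [h0.1, h0.2, this]
      obtain ⟨r, hr⟩ := hN.pencil x v c b hx0 hc hb
      have h3 := congrFun hr i
      have h4 := congrFun hr j
      simp [h.vi, h.xi, h.vj] at h3 h4
      simp [← h3] at h4
    have hproj : ∃ p : (Fin 4 → K) →ₗ[K] K, p v = 0 ∧ p w ≠ 0 := by
      rcases h.gradient_ne_zero e hN with h0 | h0
      · refine ⟨LinearMap.proj l - v l • LinearMap.proj j, by simp [h.vj], ?_⟩
        simpa [hw, tangentVec, e.jk, e.jl, e.kl.symm] using h0
      · refine ⟨LinearMap.proj k - v k • LinearMap.proj j, by simp [h.vj], ?_⟩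
        simpa [hw, tangentVec, e.jk, e.jl, e.kl] using h0
    obtain ⟨p, hpv, hpw⟩ := hproj
    -- The third contact equation becomes `T v v y = 0`, one nontrivial relation between the
    -- coordinates of `y` along `v` and `w`. Which coordinate serves as parameter depends on the
    -- coefficient known to be nonzero.
    obtain ⟨f, hf⟩ : ∃ f : (Fin 4 → K) →ₗ[K] K, ∀ (y : Fin 4 → K) (r : K), y = y j • v + r • w →
        y j * T v v v + r * T v v w = 0 → f y = 0 → y j = 0 ∧ r = 0 := by
      rcases hvv with h0 | h0
      · refine ⟨p, fun y r hy h5 hf => ?_⟩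
        have hpy : p y = r * p w := by
          conv_lhs => rw [hy]
          simp [hpv]
        have hr : r = 0 := by simpa [hpy, hpw] using hf
        exact ⟨by simpa [hr, h0] using h5, hr⟩
      · refine ⟨LinearMap.proj j, fun y r hy h5 hf => ?_⟩
        have hyj : y j = 0 := hf
        exact ⟨hyj, by simpa [hyj, h0] using h5⟩
    refine ⟨f, 0, fun y u hPy hyi hui huj hy0 hy1 hy2 hy3 hfy => ?_⟩
    obtain ⟨hu0, s, hs⟩ := hu y u hui huj hy0 hy1
    obtain ⟨r, hr⟩ := h.exists_eq_combination e hN hy0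
    have hwj : w j = 0 := IsTripleContact.tangentVec_j e
    have hy : y = y j • v + r • w := by simpa [hyi] using hr
    have hvy : T v v y = 0 := by simpa [hc, hu0] using hy2
    have h5 : y j * T v v v + r * T v v w = 0 := by
      rw [hy] at hvy
      simpa [h.vj, hwj] using hvy
    obtain ⟨hyj, hr0⟩ := hf y r hy h5 (by simpa using hfy)
    have hy' : y = 0 := by rw [hy, hyj, hr0]; simp
    refine ⟨hy', ?_⟩
    -- Once `y = 0`, the derivative of the minor is `s * T x w w`, and `T x w w` is nonzero in this
    -- case.
    have hs0 : s = 0 := by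
      simpa [hy', hs, hww] using hy3
    rw [hs, hs0, zero_smul]

end Field

end FieldLemmas
end CubicSurface

namespace CubicSurface

/-! ### The kernel of a degenerate Hessian matrix -/

section Adjugate

/-- Replacing row `b` of `M` by the basis row `a` gives a matrix `N` with determinant the adjugate
entry `a b` and with `N y` equal to `y a` times a basis vector. Applying the adjugate of `N` gives
the relation over any commutative ring. Over a field it says that a kernel vector is proportional to
every nonzero column of the adjugate. -/
lemma adjugate_mul_comm_of_mulVec_eq_zero {S n : Type*} [CommRing S] [Fintype n] [DecidableEq n]
    {M : Matrix n n S} {y : n → S} (hy : M.mulVec y = 0) (a b c : n) :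
    M.adjugate a b * y c = y a * M.adjugate c b := by
  set N := M.updateRow b (Pi.single a 1) with hN
  have hNy : N.mulVec y = y a • Pi.single b 1 := by
    ext d
    by_cases hd : d = b
    · subst hd
      simp [hN, Matrix.mulVec]
    · have := congrFun hy d
      simpa [hN, Matrix.mulVec, hd] using this
  have h1 : N.det • y = y a • N.adjugate.mulVec (Pi.single b 1) := by
    rw [← Matrix.mulVec_smul, ← hNy, Matrix.mulVec_mulVec, Matrix.adjugate_mul,
      Matrix.smul_mulVec, Matrix.one_mulVec]
  have h2 := congrFun h1 c
  simp only [Pi.smul_apply, smul_eq_mul, Matrix.mulVec_single_one, Matrix.col_apply] at h2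
  rw [Matrix.adjugate_apply, h2, Matrix.adjugate_apply, hN, Matrix.updateRow_idem,
    ← Matrix.adjugate_apply]

lemma formMatrix_transpose {S : Type*} [CommRing S] {T : Trilinear S} (hT : T.IsSymm)
    (x : Fin 4 → S) : (formMatrix T x).transpose = formMatrix T x := by
  ext a b
  exact hT.right _ _ _

lemma formMatrix_adjugate_symm {S : Type*} [CommRing S] {T : Trilinear S} (hT : T.IsSymm)
    (x : Fin 4 → S) (a b : Fin 4) :
    (formMatrix T x).adjugate a b = (formMatrix T x).adjugate b a := by
  conv_lhs => rw [← formMatrix_transpose hT, ← Matrix.adjugate_transpose]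
  rfl

/-- A column of the adjugate matrix. -/
def kernelVec {S : Type*} [CommRing S] (T : Trilinear S) (x : Fin 4 → S) (b : Fin 4) :
    Fin 4 → S :=
  fun a => (formMatrix T x).adjugate a b

lemma formMatrix_mulVec_kernelVec {S : Type*} [CommRing S] {T : Trilinear S} {x : Fin 4 → S}
    (hdet : (formMatrix T x).det = 0) (b : Fin 4) :
    (formMatrix T x).mulVec (kernelVec T x b) = 0 := by
  ext a
  have h := congrFun (congrFun (Matrix.mul_adjugate (formMatrix T x)) a) b
  rw [hdet, zero_smul] at h
  exact h

lemma apply_kernelVec {S : Type*} [CommRing S] {T : Trilinear S} (hT : T.IsSymm) {x : Fin 4 → S}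
    (hdet : (formMatrix T x).det = 0) (b : Fin 4) (z : Fin 4 → S) :
    T x (kernelVec T x b) z = 0 := by
  rw [linearMap_eq_sum]
  refine Finset.sum_eq_zero fun a _ => ?_
  rw [hT.right, ← formMatrix_mulVec, formMatrix_mulVec_kernelVec hdet, Pi.zero_apply, mul_zero]

/-- A symmetric adjugate of a degenerate matrix has rank one: its `b b` entry times its `c d` entry
is the product of entries `c` and `d` of column `b`. The double sum is the one in Jacobi's formula,
so this computes the derivative of the Hessian along `y`. -/
lemma adjugate_mul_sum_adjugate {S : Type*} [CommRing S] {T : Trilinear S} (hT : T.IsSymm)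
    {x : Fin 4 → S} (hdet : (formMatrix T x).det = 0) (b : Fin 4) (y : Fin 4 → S) :
    (formMatrix T x).adjugate b b *
      ∑ c, ∑ d, (formMatrix T x).adjugate c d * T y (basisVec S d) (basisVec S c) =
    T y (kernelVec T x b) (kernelVec T x b) := by
  rw [hT.right, linearMap_eq_sum (T y _), Finset.mul_sum]
  refine Finset.sum_congr rfl fun c _ => ?_
  rw [hT.right, linearMap_eq_sum (T y _), Finset.mul_sum, Finset.mul_sum]
  refine Finset.sum_congr rfl fun d _ => ?_
  have h := adjugate_mul_comm_of_mulVec_eq_zero (formMatrix_mulVec_kernelVec hdet d) b b c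
  simp only [kernelVec] at h ⊢
  rw [formMatrix_adjugate_symm hT x b d] at h
  rw [hT.right y (basisVec S c)]
  linear_combination T y (basisVec S d) (basisVec S c) * h

variable {K : Type*} [Field K] {T : Trilinear K}

/-- If the adjugate of the matrix of `T x` vanishes, then so does the second fundamental form. -/
lemma apply_eq_zero_of_adjugate_eq_zero (hT : T.IsSymm) (hN : T.IsNondegenerate)
    (h2 : (2 : K) ≠ 0) {x : Fin 4 → K} (hx : x ≠ 0) (hxx : T x x x = 0)
    (hadj : (formMatrix T x).adjugate = 0) (w w' : Fin 4 → K) (hw : T x x w = 0)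
    (hw' : T x x w' = 0) : T x w w' = 0 := by
  have key (w : Fin 4 → K) (hw : T x x w = 0) : T x w w = 0 := by
    obtain ⟨y, hy⟩ : ∃ y, T x x y ≠ 0 := by
      by_contra! h
      exact hx (hN.ne_zero x h)
    -- The zero column makes the last cofactor of the transformed matrix the Gram determinant of
    -- `x`, `w`, `y`. That determinant equals `-(T x x y) ^ 2 * T x w w`, while the adjugate
    -- hypothesis makes it zero.
    let P : Matrix (Fin 4) (Fin 4) K := Matrix.of fun a b => (![x, w, y, 0] b) a
    have hprod (a b : Fin 4) : (P.transpose * (formMatrix T x * P)) a b =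
        T x (![x, w, y, 0] a) (![x, w, y, 0] b) := by
      rw [Matrix.mul_apply, hT.right, linearMap_eq_sum (T x _)]
      refine Finset.sum_congr rfl fun c _ => congrArg _ ?_
      rw [hT.right, ← formMatrix_mulVec]
      rfl
    have h0 : (P.transpose * (formMatrix T x * P)).adjugate = 0 := by
      rw [Matrix.adjugate_mul_distrib, Matrix.adjugate_mul_distrib, hadj]
      simp
    have h1 := congrFun (congrFun h0 (Fin.last 3)) (Fin.last 3)
    rw [Matrix.adjugate_fin_succ_eq_det_submatrix, Matrix.det_fin_three] at h1
    simp only [Matrix.submatrix_apply, hprod, Fin.succAbove_last, Matrix.zero_apply] at h1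
    simp [hxx, hw, hT.right x w x] at h1
    rw [hT.right x y x] at h1
    tauto
  -- Polarization, which needs `2` to be invertible.
  have h3 := key (w + w') (by simp [hw, hw'])
  simp only [map_add, LinearMap.add_apply, key w hw, key w' hw', hT.right x w' w] at h3
  have h4 : 2 * T x w w' = 0 := by linear_combination h3
  exact (mul_eq_zero.1 h4).resolve_left h2

/-- Rank one and symmetry make the square of the `a b` entry the product of the diagonal entries, so
a zero diagonal forces the whole adjugate to vanish. -/
lemma exists_adjugate_diag_ne_zero (hT : T.IsSymm) {x : Fin 4 → K}
    (hdet : (formMatrix T x).det = 0) (hadj : (formMatrix T x).adjugate ≠ 0) :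
    ∃ b, (formMatrix T x).adjugate b b ≠ 0 := by
  by_contra! h
  refine hadj ?_
  ext a b
  have h1 := adjugate_mul_comm_of_mulVec_eq_zero (formMatrix_mulVec_kernelVec hdet a) a b b
  simp only [kernelVec, h, zero_mul, formMatrix_adjugate_symm hT x b a] at h1
  simpa using h1

/-- A line with triple contact at a parabolic point is the asymptotic line. -/
lemma IsTripleContact.exists_eq_add_smul_kernelVec (hT : T.IsSymm) (hN : T.IsNondegenerate)
    {i j : Fin 4} {x v : Fin 4 → K} (h : IsTripleContact T i j x v) (hij : i ≠ j)
    (hdet : (formMatrix T x).det = 0) {b : Fin 4} (hb : (formMatrix T x).adjugate b b ≠ 0) :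
    ∃ r s : K, s ≠ 0 ∧ v = r • x + s • kernelVec T x b := by
  obtain ⟨k, l, e⟩ := exists_isEnum hij
  have hm : minor T x v k l = 0 := by
    have := det_formMatrix_eq_sq hT e h.xi h.vi h.vj h.xxx h.xxv h.xvv
    rw [hdet] at this
    exact (pow_eq_zero_iff two_ne_zero).1 this.symm
  obtain ⟨c, hc⟩ := h.exists_eq_mul e hT hN hm
  -- Stationarity of the tangent plane along the line puts `v - c • x` in the kernel of the Hessian
  -- matrix, which is spanned by the column `b` of the adjugate.
  have hker : (formMatrix T x).mulVec (v - c • x) = 0 := by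
    ext a
    rw [formMatrix_mulVec, hT.right, map_sub, LinearMap.sub_apply, hc, map_smul,
      LinearMap.smul_apply, smul_eq_mul, sub_self, Pi.zero_apply]
  have hv : v = c • x + ((v - c • x) b / (formMatrix T x).adjugate b b) • kernelVec T x b := by
    ext a
    have := adjugate_mul_comm_of_mulVec_eq_zero hker b b a
    rw [Pi.add_apply, Pi.smul_apply _ (kernelVec T x b), smul_eq_mul, kernelVec, div_mul_eq_mul_div,
      ← this, mul_div_cancel_left₀ _ hb]
    simp
  refine ⟨c, _, fun hs => ?_, hv⟩
  rw [hs, zero_smul, add_zero] at hv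
  have h1 := congrFun hv i
  have h2 := congrFun hv j
  simp [h.vi, h.xi, h.vj] at h1 h2
  simp [← h1] at h2

/-- The `i`-th coordinate is independent of `φ` and `ψ`, since these vanish at `x` and it does not.
Any `f` completing the three forms to a basis of the dual space will do. -/
lemma exists_functional_of_not_proportional {i : Fin 4} {x : Fin 4 → K} (hx : x i = 1)
    {φ ψ : (Fin 4 → K) →ₗ[K] K} (hφx : φ x = 0) (hψx : ψ x = 0) (hφ : φ ≠ 0)
    (hψ : ∀ c, ¬ ∀ z, ψ z = c * φ z) :
    ∃ f : (Fin 4 → K) →ₗ[K] K, ∀ y, y i = 0 → φ y = 0 → ψ y = 0 → f y = 0 → y = 0 := by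
  have hli : LinearIndependent K ![LinearMap.proj i, φ, ψ] := by
    rw [Fintype.linearIndependent_iff]
    intro c hc
    simp only [Fin.sum_univ_three, Matrix.cons_val_zero, Matrix.cons_val_one, Matrix.cons_val] at hc
    have h0 : c 0 = 0 := by
      have := LinearMap.congr_fun hc x
      simpa [hφx, hψx, hx] using this
    rw [h0, zero_smul, zero_add] at hc
    have h2 : c 2 = 0 := by
      by_contra h2
      refine hψ (-c 1 / c 2) fun z => ?_
      have := LinearMap.congr_fun hc z
      simp at this
      field_simp
      linear_combination this
    rw [h2, zero_smul, add_zero, smul_eq_zero] at hc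
    have h1 : c 1 = 0 := hc.resolve_right hφ
    intro a
    fin_cases a <;> assumption
  obtain ⟨f, hf⟩ := exists_linearIndependent_snoc_of_lt_finrank (R := K)
    (M := (Fin 4 → K) →ₗ[K] K) hli (by simp)
  refine ⟨f, fun y h0 h1 h2 h3 => ?_⟩
  have hspan : Submodule.span K (Set.range (Fin.snoc ![LinearMap.proj i, φ, ψ] f :
      Fin 4 → (Fin 4 → K) →ₗ[K] K)) = ⊤ :=
    hf.span_eq_top_of_card_eq_finrank' (by simp)
  have hall (p : (Fin 4 → K) →ₗ[K] K) : p y = 0 := by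
    have hp : p ∈ Submodule.span K (Set.range (Fin.snoc ![LinearMap.proj i, φ, ψ] f :
      Fin 4 → (Fin 4 → K) →ₗ[K] K)) := hspan ▸ Submodule.mem_top
    induction hp using Submodule.span_induction with
    | mem q hq =>
      obtain ⟨a, rfl⟩ := hq
      fin_cases a
      · exact h0
      · exact h1
      · exact h2
      · exact h3
    | zero => rfl
    | add p q _ _ hp hq => rw [LinearMap.add_apply, hp, hq, add_zero]
    | smul c p _ hp => rw [LinearMap.smul_apply, hp, smul_zero]
  ext a
  exact hall (LinearMap.proj a)

/-- `T u u` is not a multiple of `T x x`: since `T x u = 0`, nondegeneracy would make `u` a nonzero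
multiple of `x`, and then `T x x = 0`. -/
lemma exists_functional_of_parabolic (hT : T.IsSymm) (hN : T.IsNondegenerate)
    {i : Fin 4} {x u : Fin 4 → K} (hx : x i = 1) (hxx : T x x x = 0) (hu : u ≠ 0)
    (hxu : ∀ z, T x u z = 0) :
    ∃ f : (Fin 4 → K) →ₗ[K] K, ∀ y, y i = 0 → T x x y = 0 → T y u u = 0 → f y = 0 → y = 0 := by
  have hx0 : x ≠ 0 := fun h => by simp [h] at hx
  have huu (y) : T u u y = T y u u := by rw [hT.right, hT.left]
  obtain ⟨f, hf⟩ := exists_functional_of_not_proportional (φ := T x x) (ψ := T u u) hx hxx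
    (by rw [huu, hxu]) (fun h => hx0 (hN.ne_zero x fun z => by rw [h]; rfl)) (fun c hc => by
      obtain ⟨r, hr⟩ := hN.pencil x u 0 c hx0 (fun z => by rw [hxu, zero_mul]) hc
      have hr0 : r ≠ 0 := fun h => hu (by rw [hr, h, zero_smul])
      refine hx0 (hN.ne_zero x fun z => ?_)
      have := hxu z
      rw [hr, map_smul, LinearMap.smul_apply, smul_eq_mul] at this
      exact (mul_eq_zero.1 this).resolve_left hr0)
  exact ⟨f, fun y h1 h2 h3 => hf y h1 h2 ((huu y).trans h3)⟩

end Adjugate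

end CubicSurface

namespace CubicSurface

/-! ### Polarization of the cubic and the use of nonsingularity -/

section CubicForm

/-- The third partial derivatives of a cubic form. -/
def thirdPartial (F : MvPolynomial (Fin 4) ℂ) (a b c : Fin 4) : ℂ :=
  coeff 0 (pderiv a (pderiv b (pderiv c F)))

/-- The symmetric trilinear form with `T x x x = 6 F(x)`. -/
def cubicForm (S : Type*) [CommRing S] [Algebra ℂ S] (F : MvPolynomial (Fin 4) ℂ) : Trilinear S :=
  ∑ a, ∑ b, ∑ c, algebraMap ℂ S (thirdPartial F a b c) •
    (LinearMap.proj a).smulRight ((LinearMap.proj b).smulRight (LinearMap.proj c))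

variable {S : Type*} [CommRing S] [Algebra ℂ S] {F : MvPolynomial (Fin 4) ℂ}

lemma cubicForm_apply (x y z : Fin 4 → S) : cubicForm S F x y z =
    ∑ a, ∑ b, ∑ c, algebraMap ℂ S (thirdPartial F a b c) * (x a * (y b * z c)) := by
  simp [cubicForm, Algebra.smul_def]

lemma pderiv_comm {σ : Type*} (a b : σ) (G : MvPolynomial σ ℂ) :
    pderiv a (pderiv b G) = pderiv b (pderiv a G) := by
  have h : ⁅(pderiv a : Derivation ℂ (MvPolynomial σ ℂ) (MvPolynomial σ ℂ)),
      (pderiv b : Derivation ℂ (MvPolynomial σ ℂ) (MvPolynomial σ ℂ))⁆ = 0 := by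
    classical
    refine derivation_ext fun i => ?_
    rw [Derivation.commutator_apply, pderiv_X, pderiv_X]
    simp only [Pi.single_apply]
    split_ifs <;> simp
  have := congrArg (fun D => D G) h
  rw [Derivation.commutator_apply] at this
  exact sub_eq_zero.1 this

lemma cubicForm_basisVec (a b c : Fin 4) :
    cubicForm S F (basisVec S a) (basisVec S b) (basisVec S c) =
      algebraMap ℂ S (thirdPartial F a b c) := by
  rw [cubicForm_apply, Finset.sum_eq_single a, Finset.sum_eq_single b, Finset.sum_eq_single c]
  · simp
  all_goals simp +contextual [Pi.single_apply]

lemma cubicForm_isSymm : (cubicForm S F).IsSymm := by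
  constructor
  · intro x y z
    rw [cubicForm_apply, cubicForm_apply, Finset.sum_comm]
    refine Finset.sum_congr rfl fun a _ => Finset.sum_congr rfl fun b _ =>
      Finset.sum_congr rfl fun c _ => ?_
    rw [thirdPartial, pderiv_comm, ← thirdPartial]
    ring
  · intro x y z
    rw [cubicForm_apply, cubicForm_apply]
    refine Finset.sum_congr rfl fun a _ => ?_
    rw [Finset.sum_comm]
    refine Finset.sum_congr rfl fun b _ => Finset.sum_congr rfl fun c _ => ?_
    rw [thirdPartial, pderiv_comm c b, ← thirdPartial]
    ring

lemma map_cubicForm {S' : Type*} [CommRing S'] [Algebra ℂ S'] (φ : S →ₐ[ℂ] S')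
    (x y z : Fin 4 → S) :
    φ (cubicForm S F x y z) = cubicForm S' F (φ ∘ x) (φ ∘ y) (φ ∘ z) := by
  simp [cubicForm_apply]

lemma comp_basisVec {S' : Type*} [CommRing S'] [Algebra ℂ S'] (φ : S →ₐ[ℂ] S') (a : Fin 4) :
    φ ∘ basisVec S a = basisVec S' a := by
  ext b
  simp only [Function.comp_apply, basisVec, Pi.single_apply]
  split_ifs <;> simp

lemma derivation_cubicForm {M : Type*} [AddCommGroup M] [Module S M] [Module ℂ M]
    [IsScalarTower ℂ S M] (D : Derivation ℂ S M) (x y z : Fin 4 → S) :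
    D (cubicForm S F x y z) = ∑ a, (cubicForm S F (basisVec S a) y z • D (x a) +
      cubicForm S F x (basisVec S a) z • D (y a) + cubicForm S F x y (basisVec S a) • D (z a)) := by
  have h1 (φ : (Fin 4 → S) →ₗ[S] S) (z : Fin 4 → S) : D (φ z) =
      ∑ c, (φ (basisVec S c) • D (z c) + z c • D (φ (basisVec S c))) := by
    rw [linearMap_eq_sum φ z, map_sum]
    exact Finset.sum_congr rfl fun c _ => by rw [Derivation.leibniz, add_comm]
  have h2 (φ : (Fin 4 → S) →ₗ[S] S) (z : Fin 4 → S) (m : M) :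
      ∑ c, z c • φ (basisVec S c) • m = φ z • m := by
    rw [linearMap_eq_sum φ z, Finset.sum_smul]
    exact Finset.sum_congr rfl fun c _ => by rw [mul_smul]
  have h3 (a b : Fin 4) (z : Fin 4 → S) : D (cubicForm S F (basisVec S a) (basisVec S b) z) =
      ∑ c, cubicForm S F (basisVec S a) (basisVec S b) (basisVec S c) • D (z c) := by
    rw [h1]
    refine Finset.sum_congr rfl fun c _ => ?_
    rw [cubicForm_basisVec, D.map_algebraMap, smul_zero, add_zero]
  have h4 (a : Fin 4) (y z : Fin 4 → S) : D (cubicForm S F (basisVec S a) y z) =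
      ∑ b, (cubicForm S F (basisVec S a) (basisVec S b) z • D (y b) +
        cubicForm S F (basisVec S a) y (basisVec S b) • D (z b)) := by
    rw [cubicForm_isSymm.right, h1]
    simp only [Finset.sum_add_distrib]
    congr 1
    · exact Finset.sum_congr rfl fun b _ => by rw [cubicForm_isSymm.right]
    · simp_rw [cubicForm_isSymm.right (basisVec S a) z, h3, Finset.smul_sum]
      rw [Finset.sum_comm]
      refine Finset.sum_congr rfl fun c _ => ?_
      rw [cubicForm_isSymm.right, ← h2]
      exact Finset.sum_congr rfl fun b _ => by rw [cubicForm_isSymm.right]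
  have hrot (x y z : Fin 4 → S) : cubicForm S F x y z = cubicForm S F y z x := by
    rw [cubicForm_isSymm.left, cubicForm_isSymm.right]
  rw [hrot, h1]
  simp only [Finset.sum_add_distrib]
  rw [add_assoc]
  congr 1
  · exact Finset.sum_congr rfl fun b _ => by rw [hrot (basisVec S b)]
  · simp_rw [fun a => (hrot (basisVec S a) y z).symm, h4, Finset.smul_sum, smul_add, Finset.sum_add_distrib]
    congr 1
    · rw [Finset.sum_comm]
      refine Finset.sum_congr rfl fun c _ => ?_
      rw [hrot, ← h2]
      exact Finset.sum_congr rfl fun b _ => by rw [hrot]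
    · rw [Finset.sum_comm]
      refine Finset.sum_congr rfl fun c _ => ?_
      rw [hrot, ← h2]
      exact Finset.sum_congr rfl fun b _ => by rw [hrot]

lemma derivation_cubicForm_field {K : Type*} [Field K] [Algebra ℂ K] [Algebra S K]
    [IsScalarTower ℂ S K] (D : Derivation ℂ S K) (x y z : Fin 4 → S) :
    D (cubicForm S F x y z) =
      cubicForm K F (D ∘ x) (algebraMap S K ∘ y) (algebraMap S K ∘ z) +
      cubicForm K F (algebraMap S K ∘ x) (D ∘ y) (algebraMap S K ∘ z) +
      cubicForm K F (algebraMap S K ∘ x) (algebraMap S K ∘ y) (D ∘ z) := by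
  have hm (x y z : Fin 4 → S) : algebraMap S K (cubicForm S F x y z) =
      cubicForm K F (algebraMap S K ∘ x) (algebraMap S K ∘ y) (algebraMap S K ∘ z) :=
    map_cubicForm (IsScalarTower.toAlgHom ℂ S K) x y z
  have hb (a : Fin 4) : algebraMap S K ∘ basisVec S a = basisVec K a :=
    comp_basisVec (IsScalarTower.toAlgHom ℂ S K) a
  rw [derivation_cubicForm]
  simp only [Algebra.smul_def, hm, hb, Finset.sum_add_distrib]
  congr 1
  · congr 1
    · rw [cubicForm_isSymm.left, cubicForm_isSymm.right, linearMap_eq_sum]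
      refine Finset.sum_congr rfl fun a _ => ?_
      rw [cubicForm_isSymm.left, cubicForm_isSymm.right, mul_comm]
      rfl
    · rw [cubicForm_isSymm.right, linearMap_eq_sum]
      refine Finset.sum_congr rfl fun a _ => ?_
      rw [cubicForm_isSymm.right, mul_comm]
      rfl
  · rw [linearMap_eq_sum]
    exact Finset.sum_congr rfl fun a _ => mul_comm _ _

section Homogeneous

variable (hF : F.IsHomogeneous 3)

include hF

/-- Euler's identity for a linear form, whose partial derivatives are constants; the lower
derivatives are recovered in the same way. -/
lemma pderiv_pderiv_eq (a b : Fin 4) :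
    pderiv a (pderiv b F) = cubicForm (MvPolynomial (Fin 4) ℂ) F (basisVec _ a) (basisVec _ b) X := by
  have h2 : (pderiv a (pderiv b F)).IsHomogeneous 1 := (hF.pderiv (n := 3)).pderiv
  have h3 (c : Fin 4) : pderiv c (pderiv a (pderiv b F)) = C (thirdPartial F c a b) :=
    (totalDegree_eq_zero_iff_eq_C).1 (Nat.le_zero.1 h2.pderiv.totalDegree_le)
  have h4 := h2.sum_X_mul_pderiv
  rw [one_smul] at h4
  rw [← h4, linearMap_eq_sum]
  refine Finset.sum_congr rfl fun c _ => ?_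
  rw [h3, ← cubicForm_isSymm.right, ← cubicForm_isSymm.left, cubicForm_basisVec]
  rfl

lemma two_mul_pderiv_eq (a : Fin 4) :
    2 * pderiv a F = cubicForm (MvPolynomial (Fin 4) ℂ) F X X (basisVec _ a) := by
  have h2 : (pderiv a F).IsHomogeneous 2 := hF.pderiv
  have h4 := h2.sum_X_mul_pderiv
  rw [nsmul_eq_mul, Nat.cast_ofNat] at h4
  rw [← h4, cubicForm_isSymm.right, linearMap_eq_sum]
  refine Finset.sum_congr rfl fun c _ => ?_
  rw [pderiv_pderiv_eq hF, ← cubicForm_isSymm.right X, cubicForm_isSymm.left X,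
    cubicForm_isSymm.right _ X, cubicForm_isSymm.left]

lemma six_mul_eq : 6 * F = cubicForm (MvPolynomial (Fin 4) ℂ) F X X X := by
  have h4 := hF.sum_X_mul_pderiv
  rw [nsmul_eq_mul, Nat.cast_ofNat] at h4
  have : 6 * F = 2 * (3 * F) := by ring
  rw [this, ← h4, linearMap_eq_sum, Finset.mul_sum]
  refine Finset.sum_congr rfl fun a _ => ?_
  rw [← two_mul_pderiv_eq hF]
  ring

lemma hessian_eq_det : hessian F = (formMatrix (cubicForm _ F) X).det := by
  rw [hessian]
  congr 1
  ext1 a b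
  rw [Matrix.of_apply, pderiv_pderiv_eq hF, formMatrix, Matrix.of_apply, cubicForm_isSymm.right,
    cubicForm_isSymm.left]

lemma map_hessian (φ : MvPolynomial (Fin 4) ℂ →ₐ[ℂ] S) :
    φ (hessian F) = (formMatrix (cubicForm S F) (φ ∘ X)).det := by
  rw [hessian_eq_det hF, AlgHom.map_det]
  congr 1
  ext1 a b
  simp only [AlgHom.mapMatrix_apply, Matrix.map_apply, formMatrix, Matrix.of_apply]
  rw [map_cubicForm, comp_basisVec, comp_basisVec]

variable {K : Type*} [Field K] [Algebra ℂ K]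

omit hF in
lemma aeval_comp_X {A : Type*} [CommRing A] [Algebra ℂ A] (x : Fin 4 → A) : aeval (R := ℂ) x ∘ X = x := by
  ext
  simp

lemma aeval_pderiv_eq (x : Fin 4 → K) (a : Fin 4) :
    2 * aeval x (pderiv a F) = cubicForm K F x x (basisVec K a) := by
  have h := congrArg (aeval x) (two_mul_pderiv_eq hF a)
  rw [map_mul, map_ofNat, map_cubicForm, comp_basisVec, aeval_comp_X] at h
  exact h

lemma six_mul_aeval_eq {A : Type*} [CommRing A] [Algebra ℂ A] (x : Fin 4 → A) :
    6 * aeval x F = cubicForm A F x x x := by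
  have h := congrArg (aeval x) (six_mul_eq hF)
  rw [map_mul, map_ofNat, map_cubicForm, aeval_comp_X] at h
  exact h

omit hF in
lemma algebra_charZero (K : Type*) [Field K] [Algebra ℂ K] : CharZero K :=
  charZero_of_injective_algebraMap (algebraMap ℂ K).injective

/-- Nonsingularity is assumed at complex points only. By the Nullstellensatz, some power of each
variable lies in the ideal of the partial derivatives, and this transfers to points over every
extension field, in particular to generic points of subvarieties. -/
lemma eq_zero_of_cubicForm_eq_zero (hns : IsNonsingular F) (x : Fin 4 → K)
    (hx : ∀ z, cubicForm K F x x z = 0) : x = 0 := by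
  have hchar : CharZero K := algebra_charZero K
  have hpd (a : Fin 4) : aeval x (pderiv a F) = 0 := by
    have := aeval_pderiv_eq hF x a
    rw [hx] at this
    exact (mul_eq_zero.1 this).resolve_left two_ne_zero
  ext s
  have hmem : (X s : MvPolynomial (Fin 4) ℂ) ∈
      (Ideal.span (Set.range fun a => pderiv a F)).radical := by
    rw [← vanishingIdeal_zeroLocus_eq_radical (K := ℂ), mem_vanishingIdeal_iff]
    intro y hy
    rw [zeroLocus_span] at hy
    have hy' (a : Fin 4) : eval y (pderiv a F) = 0 := by
      have := hy (pderiv a F) ⟨a, rfl⟩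
      rwa [MvPolynomial.aeval_eq_eval] at this
    have hy0 : y = 0 := by
      by_contra h0
      have hFy : eval y F = 0 := by
        have := congrArg (eval y) hF.sum_X_mul_pderiv
        simpa [hy'] using this
      obtain ⟨a, ha⟩ := hns y h0 hFy
      exact ha (hy' a)
    simp [hy0]
  obtain ⟨n, hn⟩ := hmem
  have h0 : Ideal.span (Set.range fun a => pderiv a F) ≤
      RingHom.ker (aeval x : MvPolynomial (Fin 4) ℂ →ₐ[ℂ] K) := by
    rw [Ideal.span_le]
    rintro _ ⟨a, rfl⟩
    exact hpd a
  have h1 := h0 hn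
  rw [RingHom.mem_ker, map_pow, aeval_X] at h1
  exact pow_eq_zero_iff (fun h => by simp [h] at h1) |>.1 h1

/-- If `T x y` is `a` times and `T y y` is `b` times `T x x`, then the gradient at `r • x + y` is `r
^ 2 + 2 * a * r + b` times the gradient at `x`. A root `r` in the algebraic closure makes `r • x +
y` singular, hence zero; comparing coordinates brings the proportionality back to `K`. -/
lemma cubicForm_isNondegenerate (hns : IsNonsingular F) : (cubicForm K F).IsNondegenerate := by
  refine ⟨fun x hx => eq_zero_of_cubicForm_eq_zero hF hns x hx, fun x y a b hx hxy hyy => ?_⟩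
  let L := AlgebraicClosure K
  obtain ⟨r, hr⟩ : ∃ r : L, r * r + 2 * algebraMap K L a * r + algebraMap K L b = 0 := by
    obtain ⟨r, hr⟩ := IsAlgClosed.exists_root (k := L)
      (Polynomial.C 1 * Polynomial.X ^ 2 + Polynomial.C (2 * algebraMap K L a) * Polynomial.X +
        Polynomial.C (algebraMap K L b)) (by rw [Polynomial.degree_quadratic one_ne_zero]; decide)
    refine ⟨r, ?_⟩
    simp [Polynomial.IsRoot] at hr
    linear_combination hr
  let φ : K →ₐ[ℂ] L := IsScalarTower.toAlgHom ℂ K L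
  have hm (x y z : Fin 4 → K) : cubicForm L F (φ ∘ x) (φ ∘ y) (φ ∘ z) = φ (cubicForm K F x y z) :=
    (map_cubicForm φ x y z).symm
  have h0 : r • (φ ∘ x) + φ ∘ y = 0 := by
    refine eq_zero_of_cubicForm_eq_zero hF hns _ fun z => ?_
    rw [linearMap_eq_sum]
    refine Finset.sum_eq_zero fun c _ => ?_
    rw [← comp_basisVec φ c]
    simp only [map_add, map_smul, LinearMap.add_apply, LinearMap.smul_apply, hm,
      cubicForm_isSymm.left y x, hxy, hyy, map_mul, smul_eq_mul]
    have ha : φ a = algebraMap K L a := rfl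
    have hb : φ b = algebraMap K L b := rfl
    rw [ha, hb]
    linear_combination z c * φ (cubicForm K F x x (basisVec K c)) * hr
  obtain ⟨s, hs⟩ := Function.ne_iff.1 hx
  rw [Pi.zero_apply] at hs
  refine ⟨y s / x s, funext fun c => (algebraMap K L).injective ?_⟩
  change φ _ = φ _
  have h1 := congrFun h0 s
  have h2 := congrFun h0 c
  simp only [Pi.add_apply, Pi.smul_apply, Function.comp_apply, smul_eq_mul, Pi.zero_apply] at h1 h2
  have h3 : φ (x s) ≠ 0 := by simpa using hs
  rw [Pi.smul_apply, smul_eq_mul, map_mul, map_div₀, div_mul_eq_mul_div, eq_div_iff h3]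
  linear_combination φ (x s) * h2 - φ (x c) * h1

end Homogeneous

end CubicForm

end CubicSurface

namespace CubicSurface

open BiProj

/-! ### Plücker coordinates and equations of `Y` in a chart -/

section Plucker

/-- The alternating matrix with given entries above the diagonal. -/
def pluckerMatrix {S : Type*} [CommRing S] (q : Pair → S) (a b : Fin 4) : S :=
  if h : a < b then q ⟨(a, b), h⟩ else if h : b < a then -q ⟨(b, a), h⟩ else 0

lemma pluckerMatrix_self {S : Type*} [CommRing S] (q : Pair → S) (a : Fin 4) :
    pluckerMatrix q a a = 0 := by
  simp [pluckerMatrix]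

lemma pluckerMatrix_pair {S : Type*} [CommRing S] (q : Pair → S) (p : Pair) :
    pluckerMatrix q p.1.1 p.1.2 = q p := by
  simp [pluckerMatrix, p.2]

lemma pluckerMatrix_swap {S : Type*} [CommRing S] (q : Pair → S) (a b : Fin 4) :
    pluckerMatrix q a b = -pluckerMatrix q b a := by
  unfold pluckerMatrix
  rcases lt_trichotomy a b with h | rfl | h
  · simp [h, h.not_gt]
  · simp
  · simp [h, h.not_gt]

lemma map_pluckerMatrix {S S' : Type*} [CommRing S] [CommRing S'] {φ : Type*} [FunLike φ S S']
    [RingHomClass φ S S'] (f : φ) (q : Pair → S) (a b : Fin 4) :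
    f (pluckerMatrix q a b) = pluckerMatrix (f ∘ q) a b := by
  unfold pluckerMatrix
  split_ifs <;> simp

/-- The vector spanning together with `x` the line with Plücker coordinates `q`. -/
def direction {S : Type*} [CommRing S] (q : Pair → S) (i : Fin 4) : Fin 4 → S :=
  fun a => pluckerMatrix q i a

lemma comp_direction {S S' : Type*} [CommRing S] [CommRing S'] {φ : Type*} [FunLike φ S S']
    [RingHomClass φ S S'] (f : φ) (q : Pair → S) (i : Fin 4) :
    f ∘ direction q i = direction (f ∘ q) i := by
  ext a
  exact map_pluckerMatrix f q i a

/-- The Plücker coordinates of the line spanned by `b` and `c`. -/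
def wedge {S : Type*} [CommRing S] (b c : Fin 4 → S) (p : Pair) : S :=
  b p.1.1 * c p.1.2 - b p.1.2 * c p.1.1

lemma pluckerMatrix_wedge {S : Type*} [CommRing S] (b c : Fin 4 → S) (i a : Fin 4) :
    pluckerMatrix (wedge b c) i a = b i * c a - b a * c i := by
  unfold pluckerMatrix wedge
  rcases lt_trichotomy i a with h | rfl | h
  · simp [h]
  · simp
  · simp [h, h.not_gt]

lemma direction_wedge {S : Type*} [CommRing S] (b c : Fin 4 → S) (i : Fin 4) :
    direction (wedge b c) i = b i • c - c i • b := by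
  ext a
  simp only [direction, pluckerMatrix_wedge, Pi.sub_apply, Pi.smul_apply, smul_eq_mul]
  ring

/-- The bihomogeneous coordinate ring of `ℙ³ × ℙ⁵`. -/
abbrev IncidenceRing : Type := MvPolynomial (Fin 4 ⊕ Pair) ℂ

/-- The coordinates of the point. -/
def pointCoord : Fin 4 → IncidenceRing := fun a => X (Sum.inl a)

/-- The coordinates of the line. -/
def lineCoord : Pair → IncidenceRing := fun p => X (Sum.inr p)

lemma pointCoord_mem (a : Fin 4) : pointCoord a ∈ piece (twoWeight (Fin 4) Pair) (1, 0) :=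
  isWeightedHomogeneous_X ℂ _ _

lemma lineCoord_mem (p : Pair) : lineCoord p ∈ piece (twoWeight (Fin 4) Pair) (0, 1) :=
  isWeightedHomogeneous_X ℂ _ _

lemma pluckerMatrix_lineCoord_mem (a b : Fin 4) :
    pluckerMatrix lineCoord a b ∈ piece (twoWeight (Fin 4) Pair) (0, 1) := by
  unfold pluckerMatrix
  split_ifs
  · exact lineCoord_mem _
  · exact neg_mem (lineCoord_mem _)
  · exact zero_mem _

/-- The incidence relations between a point and a line. -/
def incidence (i : Fin 4) (p : Pair) : IncidenceRing :=
  pointCoord i * lineCoord p - (pointCoord p.1.1 * direction lineCoord i p.1.2 -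
    pointCoord p.1.2 * direction lineCoord i p.1.1)

variable (F : MvPolynomial (Fin 4) ℂ)

/-- The equations of lines with triple contact: the coefficients of the restriction of the cubic
form to a line. -/
def contact (i : Fin 4) : Fin 3 → IncidenceRing :=
  ![cubicForm _ F pointCoord pointCoord pointCoord,
    cubicForm _ F pointCoord pointCoord (direction lineCoord i),
    cubicForm _ F pointCoord (direction lineCoord i) (direction lineCoord i)]

/-- Equations of the variety of lines with triple contact in the affine chart `x i = 1`,
`q i j = 1`. -/
def chartEquations (i j : Fin 4) : Set IncidenceRing :=
  {pointCoord i - 1, pluckerMatrix lineCoord i j - 1} ∪ Set.range (contact F i) ∪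
    incidence i '' {p | p.1.1 ≠ i ∧ p.1.2 ≠ i}

/-- Two normalizations, three contact equations and three incidence relations: eight equations for a
surface in affine space of dimension ten. -/
lemma encard_chartEquations_le (i j : Fin 4) : (chartEquations F i j).encard ≤ 8 := by
  have h1 : (Set.range (contact F i)).encard ≤ 3 := by
    rw [← Set.image_univ]
    refine (Set.encard_image_le _ _).trans ?_
    simp
  have h2 : (incidence i '' {p | p.1.1 ≠ i ∧ p.1.2 ≠ i}).encard ≤ 3 := by
    refine (Set.encard_image_le _ _).trans ?_
    rw [Set.encard_eq_coe_toFinset_card]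
    have : ∀ i : Fin 4, (Set.toFinset {p : Pair | p.1.1 ≠ i ∧ p.1.2 ≠ i}).card ≤ 3 := by decide
    exact_mod_cast this i
  refine (Set.encard_union_le _ _).trans ((add_le_add (Set.encard_union_le _ _) le_rfl).trans ?_)
  refine (add_le_add (add_le_add ((Set.encard_insert_le _ _).trans (by rw [Set.encard_singleton]; norm_num : _ ≤ (2 : ℕ∞))) h1) h2).trans ?_
  norm_num

variable {F}

/-- The geometric meaning of the chart equations. -/
lemma isTripleContact_of_chartEquations {K : Type*} [CommRing K] [Algebra ℂ K]
    (φ : IncidenceRing →ₐ[ℂ] K) {i j : Fin 4}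
    (h : ∀ f ∈ chartEquations F i j, φ f = 0) :
    IsTripleContact (cubicForm K F) i j (φ ∘ pointCoord) (direction (φ ∘ lineCoord) i) ∧
      φ ∘ lineCoord = wedge (φ ∘ pointCoord) (direction (φ ∘ lineCoord) i) := by
  have hc (n : Fin 3) : φ (contact F i n) = 0 := h _ (.inl (.inr ⟨n, rfl⟩))
  have hxi : φ (pointCoord i) = 1 := by
    have := h _ (.inl (.inl (.inl rfl)))
    rwa [map_sub, map_one, sub_eq_zero] at this
  have hvj : direction (φ ∘ lineCoord) i j = 1 := by
    have := h _ (.inl (.inl (.inr rfl)))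
    rwa [map_sub, map_one, sub_eq_zero, map_pluckerMatrix] at this
  have hvi : direction (φ ∘ lineCoord) i i = 0 := pluckerMatrix_self _ _
  have h0 := hc 0
  have h1 := hc 1
  have h2 := hc 2
  simp only [contact, Matrix.cons_val_zero, Matrix.cons_val_one, Matrix.cons_val, map_cubicForm,
    comp_direction] at h0 h1 h2
  refine ⟨⟨hxi, hvi, hvj, h0, h1, h2⟩, ?_⟩
  ext p
  -- The relations for pairs containing `i` hold automatically after normalizing, which is why they
  -- are not among the chart equations.
  by_cases hp : p.1.1 ≠ i ∧ p.1.2 ≠ i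
  · have := h _ (.inr ⟨p, hp, rfl⟩)
    rw [incidence, map_sub, map_sub, map_mul, map_mul, map_mul, hxi, one_mul, sub_eq_zero] at this
    simp only [direction, map_pluckerMatrix] at this
    exact this
  · rw [not_and_or, not_not, not_not] at hp
    rcases hp with rfl | rfl
    · simp only [wedge, Function.comp_apply, hxi, hvi, one_mul, mul_zero, sub_zero]
      exact (pluckerMatrix_pair (φ ∘ lineCoord) p).symm
    · simp only [wedge, Function.comp_apply, hxi, hvi, one_mul, mul_zero, zero_sub]
      rw [direction, pluckerMatrix_swap, neg_neg]
      exact (pluckerMatrix_pair (φ ∘ lineCoord) p).symm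

end Plucker

end CubicSurface

namespace CubicSurface

open BiProj

/-! ### Homogeneity of the defining ideals -/

section Homogeneous

lemma aeval_scale {σ : Type} {w : σ → ℕ × ℕ} {d : ℕ × ℕ} {f : MvPolynomial σ ℂ}
    (hf : f ∈ piece w d) {S : Type*} [CommRing S] [Algebra ℂ S] (a b : S) (v : σ → S) :
    aeval (fun s => a ^ (w s).1 * b ^ (w s).2 * v s) f = a ^ d.1 * b ^ d.2 * aeval v f := by
  rw [aeval_def, aeval_def, MvPolynomial.eval₂_eq, MvPolynomial.eval₂_eq, Finset.mul_sum]
  refine Finset.sum_congr rfl fun m hm => ?_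
  have h := hf (mem_support_iff.mp hm)
  rw [Finsupp.weight_apply, Finsupp.sum] at h
  rw [← h, Prod.fst_sum, Prod.snd_sum]
  simp only [mul_pow, Finset.prod_mul_distrib, Prod.smul_fst, Prod.smul_snd, smul_eq_mul,
    ← pow_mul, Finset.prod_pow_eq_pow_sum, mul_comm (m _)]
  ring

lemma eval_scale {σ : Type} {w : σ → ℕ × ℕ} {d : ℕ × ℕ} {f : MvPolynomial σ ℂ} (hf : f ∈ piece w d)
    (a b : ℂ) (v : σ → ℂ) :
    MvPolynomial.eval (fun s => a ^ (w s).1 * b ^ (w s).2 * v s) f =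
      a ^ d.1 * b ^ d.2 * MvPolynomial.eval v f := by
  rw [← coe_aeval_eq_eval, ← coe_aeval_eq_eval]
  exact aeval_scale hf a b v

/-- The sum is the value of a polynomial in two variables. Multiplied by both variables, this
polynomial vanishes off the torus as well, so it is zero. -/
lemma eq_zero_of_sum_pow_mul_eq_zero (s : Finset (ℕ × ℕ)) (c : ℕ × ℕ → ℂ)
    (h : ∀ a b : ℂ, a ≠ 0 → b ≠ 0 → ∑ d ∈ s, a ^ d.1 * b ^ d.2 * c d = 0) :
    ∀ d ∈ s, c d = 0 := by
  set e : ℕ × ℕ → (Fin 2 →₀ ℕ) := fun d => Finsupp.single 0 d.1 + Finsupp.single 1 d.2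
  have he : Function.Injective e := fun d d' h => by
    ext
    · simpa [e] using DFunLike.congr_fun h 0
    · simpa [e] using DFunLike.congr_fun h 1
  set P : MvPolynomial (Fin 2) ℂ := ∑ d ∈ s, monomial (e d) (c d)
  have hP (v : Fin 2 → ℂ) : MvPolynomial.eval v P = ∑ d ∈ s, v 0 ^ d.1 * v 1 ^ d.2 * c d := by
    rw [map_sum]
    refine Finset.sum_congr rfl fun d _ => ?_
    rw [eval_monomial, Finsupp.prod_add_index' (by simp) (by intros; ring)]
    simp
    ring
  have h0 : P * (X 0 * X 1) = 0 := by
    refine MvPolynomial.funext fun v => ?_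
    rw [map_mul, hP, map_zero, map_mul, eval_X, eval_X]
    by_cases h0 : v 0 = 0
    · simp [h0]
    by_cases h1 : v 1 = 0
    · simp [h1]
    · rw [h _ _ h0 h1, zero_mul]
  have h1 : P = 0 := by
    simpa [X_ne_zero] using h0
  intro d hd
  have h2 : coeff (e d) P = c d := by
    rw [coeff_sum, Finset.sum_eq_single d]
    · simp
    · intro d' _ hd'
      rw [coeff_monomial, if_neg fun h => hd' (he h)]
    · exact fun h => absurd hd h
  rw [← h2, h1, coeff_zero]

/-- The ideal of a set stable under the scalings is homogeneous. -/
lemma isHomogeneous_vanishingIdeal {σ : Type} (w : σ → ℕ × ℕ) (V : Set (σ → ℂ))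
    (hV : ∀ v ∈ V, ∀ a b : ℂ, a ≠ 0 → b ≠ 0 → (fun s => a ^ (w s).1 * b ^ (w s).2 * v s) ∈ V) :
    (vanishingIdeal ℂ V).IsHomogeneous (piece w) := by
  classical
  intro i f hf v hv
  rw [aeval_eq_eval]
  have key := eq_zero_of_sum_pow_mul_eq_zero
    (DirectSum.decompose (piece w) f).support
    (fun d => MvPolynomial.eval v (DirectSum.decompose (piece w) f d : MvPolynomial σ ℂ)) ?_
  · by_cases hi : i ∈ (DirectSum.decompose (piece w) f).support
    · exact key i hi
    · rw [DFinsupp.notMem_support_iff.mp hi]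
      simp
  · intro a b ha hb
    have h := hf _ (hV v hv a b ha hb)
    rw [aeval_eq_eval] at h
    change MvPolynomial.eval _ f = 0 at h
    rw [← DirectSum.sum_support_decompose (piece w) f, map_sum] at h
    rw [← h]
    refine Finset.sum_congr rfl fun d _ => (eval_scale (SetLike.coe_mem _) a b v).symm

variable (F : MvPolynomial (Fin 4) ℂ)

lemma tripleContactIdeal_isHomogeneous :
    (tripleContactIdeal F).IsHomogeneous (piece (twoWeight (Fin 4) Pair)) := by
  refine isHomogeneous_vanishingIdeal _ _ ?_
  rintro v ⟨y, hy, ⟨h0, h1⟩, b', c', hL, hq⟩ a b ha hb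
  -- Scaling the Plücker vector by `b` amounts to scaling one of the two spanning vectors.
  refine ⟨y, hy, ?_, b • b', c', ?_, ?_⟩
  · have h2 : (fun i => a ^ (twoWeight (Fin 4) Pair (Sum.inl i)).1 *
        b ^ (twoWeight (Fin 4) Pair (Sum.inl i)).2 * v (Sum.inl i)) =
        a • fun i => v (Sum.inl i) := by
      ext i
      simp [twoWeight]
    simp only [h2]
    refine ⟨smul_ne_zero ha h0, ?_⟩
    rw [← h1, Projectivization.mk_eq_mk_iff']
    exact ⟨a, rfl⟩
  · rw [← hL, Submodule.span_insert, Submodule.span_insert,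
      Submodule.span_singleton_smul_eq hb.isUnit]
  · intro ij
    simp only [twoWeight, Sum.elim_inr, pow_zero, pow_one, one_mul, hq, Pi.smul_apply, smul_eq_mul]
    ring

variable {F}

lemma mem_piece_three (hF : F.IsHomogeneous 3) : F ∈ piece (oneWeight (Fin 4)) (3, 0) := by
  intro d hd
  have h := hF hd
  rw [Finsupp.weight_eq_sum] at h ⊢
  simp only [Pi.one_apply, smul_eq_mul, mul_one] at h
  rw [← h]
  ext <;> simp [oneWeight, Prod.fst_sum, Prod.snd_sum]

lemma surfaceIdeal_isHomogeneous (hF : F.IsHomogeneous 3) :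
    (surfaceIdeal F).IsHomogeneous (piece (oneWeight (Fin 4))) := by
  refine Ideal.homogeneous_span _ _ ?_
  rintro _ rfl
  exact ⟨_, mem_piece_three hF⟩

end Homogeneous

end CubicSurface

namespace CubicSurface

open BiProj

/-! ### The ideal of `Y` and its equations -/

section TripleContactIdeal

variable {F : MvPolynomial (Fin 4) ℂ} (hF : F.IsHomogeneous 3)

include hF

/-- By Taylor expansion, the coefficients of `6 F(p + b X)` in degrees 0, 1 and 2 are `T p p p`, `3
* T p p b` and `3 * T p b b`. -/
lemma meetsWithMultiplicity_three_iff (p : ℙ ℂ (Fin 4 → ℂ)) (L : Line) :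
    MeetsWithMultiplicity F p L 3 ↔ ∀ b ∈ L.1, cubicForm ℂ F p.rep p.rep p.rep = 0 ∧
      cubicForm ℂ F p.rep p.rep b = 0 ∧ cubicForm ℂ F p.rep b b = 0 := by
  refine forall₂_congr fun b _ => ?_
  set T := cubicForm ℂ F
  have hT : T.IsSymm := cubicForm_isSymm
  have key : (6 : Polynomial ℂ) * aeval (fun i => Polynomial.C (p.rep i) +
      Polynomial.C (b i) * Polynomial.X) F =
      Polynomial.C (T p.rep p.rep p.rep) + Polynomial.C (3 * T p.rep p.rep b) * Polynomial.X +
      Polynomial.C (3 * T p.rep b b) * Polynomial.X ^ 2 +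
      Polynomial.C (T b b b) * Polynomial.X ^ 3 := by
    rw [six_mul_aeval_eq hF]
    have h1 : (fun i => Polynomial.C (p.rep i) + Polynomial.C (b i) * Polynomial.X) =
        (Polynomial.C (R := ℂ) ∘ p.rep) + Polynomial.X (R := ℂ) • (Polynomial.C (R := ℂ) ∘ b) := by
      ext i : 1
      simp only [Pi.add_apply, Pi.smul_apply, Function.comp_apply, smul_eq_mul]
      ring
    have hm (x y z : Fin 4 → ℂ) : cubicForm (Polynomial ℂ) F (Polynomial.C (R := ℂ) ∘ x)
        (Polynomial.C (R := ℂ) ∘ y) (Polynomial.C (R := ℂ) ∘ z) = Polynomial.C (T x y z) :=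
      (map_cubicForm (Algebra.ofId ℂ (Polynomial ℂ)) x y z).symm
    rw [h1]
    simp only [map_add, map_smul, LinearMap.add_apply, LinearMap.smul_apply, hm, smul_eq_mul]
    rw [hT.right p.rep b p.rep, hT.left b p.rep p.rep, hT.right p.rep b p.rep, hT.left b p.rep b,
      hT.right b b p.rep, hT.left b p.rep b]
    simp only [map_mul, map_ofNat]
    ring
  have h6 : IsUnit (6 : Polynomial ℂ) := by
    have : (6 : Polynomial ℂ) = Polynomial.C 6 := (map_ofNat Polynomial.C 6).symm
    rw [this, Polynomial.isUnit_C]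
    norm_num
  rw [← h6.dvd_mul_left (a := Polynomial.X ^ 3), key, Polynomial.X_pow_dvd_iff]
  constructor
  · intro h
    have h0 := h 0 (by norm_num)
    have h1 := h 1 (by norm_num)
    have h2 := h 2 (by norm_num)
    simp [Polynomial.coeff_X, Polynomial.coeff_C, -map_mul] at h0 h1 h2
    exact ⟨h0, h1, h2⟩
  · rintro ⟨h0, h1, h2⟩ n hn
    rw [h0, h1, h2]
    simp [Polynomial.coeff_X_pow]
    lia

/-- The equations satisfied by the coordinate vectors of the variety of lines with triple
contact. -/
lemma equations_of_isCoordinateVector {y : ℙ ℂ (Fin 4 → ℂ) × Line} (hy : y ∈ lineVariety F 3)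
    {v : Fin 4 ⊕ Pair → ℂ} (hv : IsCoordinateVector y v) (i : Fin 4) :
    (∀ n, aeval v (contact F i n) = 0) ∧ ∀ p, aeval v (incidence i p) = 0 := by
  obtain ⟨⟨h0, h1⟩, b, c, hL, hq⟩ := hv
  set x : Fin 4 → ℂ := fun i => v (Sum.inl i)
  have hq' : (fun p => v (Sum.inr p)) = wedge b c := funext hq
  have hx : aeval v ∘ pointCoord = x := by
    ext a
    simp [pointCoord, x]
  have hl : aeval v ∘ lineCoord = wedge b c := by
    rw [← hq']
    ext a
    simp [lineCoord]
  have hm := (meetsWithMultiplicity_three_iff hF y.1 y.2).1 hy.2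
  obtain ⟨s, hs⟩ : ∃ s : ℂ, s • y.1.rep = x := by
    have h2 := h1
    rw [← Projectivization.mk_rep y.1, Projectivization.mk_eq_mk_iff'] at h2
    exact h2
  have hxL : x ∈ y.2.1 := by
    refine hy.1 ?_
    rw [← h1, Projectivization.submodule_mk]
    exact Submodule.mem_span_singleton_self _
  have hdL : direction (wedge b c) i ∈ y.2.1 := by
    rw [direction_wedge, ← hL]
    exact sub_mem (Submodule.smul_mem _ _ (Submodule.subset_span (by simp)))
      (Submodule.smul_mem _ _ (Submodule.subset_span (by simp)))
  obtain ⟨e0, e1, e2⟩ := hm _ hdL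
  constructor
  · intro n
    fin_cases n
    · change aeval v (contact F i 0) = 0
      simp only [contact, Matrix.cons_val_zero, map_cubicForm, hx]
      simp [← hs, e0]
    · change aeval v (contact F i 1) = 0
      simp only [contact, Matrix.cons_val_one, Matrix.cons_val_zero, map_cubicForm, comp_direction, hx, hl]
      simp [← hs, e1]
    · change aeval v (contact F i 2) = 0
      simp only [contact, Matrix.cons_val, map_cubicForm, comp_direction, hx, hl]
      simp [← hs, e2]
  · intro p
    rw [← hL, Submodule.mem_span_pair] at hxL
    obtain ⟨r, r', hr⟩ := hxL
    have hxc (a : Fin 4) : aeval v (pointCoord a) = r * b a + r' * c a := by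
      rw [← Function.comp_apply (f := aeval v), hx, ← hr]
      simp
    have hdc (a : Fin 4) : aeval v (direction lineCoord i a) = b i * c a - b a * c i := by
      rw [← Function.comp_apply (f := aeval v), comp_direction, hl, direction,
        pluckerMatrix_wedge]
    have hlc : aeval v (lineCoord p) = b p.1.1 * c p.1.2 - b p.1.2 * c p.1.1 := by
      rw [← Function.comp_apply (f := aeval v), hl, wedge]
    simp only [incidence, map_sub, map_mul, hxc, hdc, hlc]
    ring

lemma contact_mem (i : Fin 4) (n : Fin 3) : contact F i n ∈ tripleContactIdeal F := by
  rintro v ⟨y, hy, hv⟩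
  exact (equations_of_isCoordinateVector hF hy hv i).1 n

lemma incidence_mem (i : Fin 4) (p : Pair) : incidence i p ∈ tripleContactIdeal F := by
  rintro v ⟨y, hy, hv⟩
  exact (equations_of_isCoordinateVector hF hy hv i).2 p

/-- By the Nullstellensatz it is enough that every complex zero of the chart equations comes from a
pair in `Y`, namely the point `x` on the line spanned by `x` and `u`. Only the radical is obtained;
generation of the ideal itself is proved later, locally at parabolic divisors. -/
lemma tripleContactIdeal_le_radical (i j : Fin 4) :
    tripleContactIdeal F ≤ (Ideal.span (chartEquations F i j)).radical := by
  rw [← vanishingIdeal_zeroLocus_eq_radical (K := ℂ), zeroLocus_span]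
  refine vanishingIdeal_anti_mono fun v hv => ?_
  obtain ⟨h, hq⟩ := isTripleContact_of_chartEquations (aeval v) (i := i) (j := j) hv
  set x := aeval v ∘ pointCoord with hx
  set u := direction (aeval v ∘ lineCoord) i with hu
  have hx' : (fun a => v (Sum.inl a)) = x := by
    ext a
    simp [x, pointCoord]
  have hx0 : x ≠ 0 := fun h0 => by simpa [h0] using h.xi
  have hxv : LinearIndependent ℂ ![x, u] := by
    rw [LinearIndependent.pair_iff]
    intro s t hst
    have hi := congrFun hst i
    have hj := congrFun hst j
    simp only [Pi.add_apply, Pi.smul_apply, smul_eq_mul, h.xi, h.vi, h.vj, Pi.zero_apply] at hi hj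
    have hs : s = 0 := by simpa using hi
    subst hs
    exact ⟨rfl, by simpa using hj⟩
  have hT : (cubicForm ℂ F).IsSymm := cubicForm_isSymm
  have hrank : Module.finrank ℂ (Submodule.span ℂ {x, u}) = 2 := by
    have h2 := finrank_span_eq_card hxv
    rwa [Matrix.range_cons_cons_empty, Fintype.card_fin] at h2
  set p : ℙ ℂ (Fin 4 → ℂ) := Projectivization.mk ℂ x hx0
  have hp : p.rep ∈ Submodule.span ℂ {x} := by
    have h2 : p.submodule = Submodule.span ℂ {x} := Projectivization.submodule_mk _ _
    rw [← h2, Projectivization.submodule_eq]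
    exact Submodule.mem_span_singleton_self _
  obtain ⟨s, hs⟩ := Submodule.mem_span_singleton.1 hp
  refine ⟨(p, ⟨Submodule.span ℂ {x, u}, hrank⟩), ⟨?_, ?_⟩, ⟨hx' ▸ hx0, ?_⟩, x, u, rfl, ?_⟩
  · change p.submodule ≤ _
    rw [Projectivization.submodule_mk]
    exact Submodule.span_mono (by simp)
  · rw [meetsWithMultiplicity_three_iff hF]
    intro b hb
    obtain ⟨r, r', rfl⟩ := Submodule.mem_span_pair.1 hb
    simp [← hs, h.xxx, h.xxv, h.xvv, hT.right x u x]
  · simp only [hx']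
    rfl
  · intro ij
    have h3 := congrFun hq ij
    simpa [lineCoord, wedge] using h3

end TripleContactIdeal

/-! ### Coordinate charts of the projective spaces -/

section Charts

variable {F : MvPolynomial (Fin 4) ℂ}

/-- The chart of `ℙ³ × ℙ⁵` where a coordinate of the point and one of the line do not vanish. -/
def incidenceChart (D : Point (twoWeight (Fin 4) Pair) (tripleContactIdeal F)) {i j : Fin 4}
    (hi : pointCoord i ∉ D.ideal) (hj : pluckerMatrix lineCoord i j ∉ D.ideal) : Chart D where
  t d := pointCoord i ^ d.1 * pluckerMatrix lineCoord i j ^ d.2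
  t_zero := by simp
  t_add d d' := by simp only [Prod.fst_add, Prod.snd_add, pow_add]; ring
  t_mem s := by
    rcases s with s | s
    · simpa [twoWeight] using pointCoord_mem i
    · simpa [twoWeight] using pluckerMatrix_lineCoord_mem i j
  t_notMem d := fun h => (D.isPrime.mem_or_mem h).elim
    (fun h => hi (D.isPrime.mem_of_pow_mem _ h)) (fun h => hj (D.isPrime.mem_of_pow_mem _ h))

/-- The incidence relation writes the `i`-th point coordinate times any Plücker coordinate through
row `i` of the Plücker matrix. If that row vanished on `D`, all Plücker coordinates would. -/
lemma exists_pluckerMatrix_notMem (hF : F.IsHomogeneous 3)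
    (D : Point (twoWeight (Fin 4) Pair) (tripleContactIdeal F)) {i : Fin 4}
    (hi : pointCoord i ∉ D.ideal) : ∃ j, i ≠ j ∧ pluckerMatrix lineCoord i j ∉ D.ideal := by
  obtain ⟨p, hp⟩ : ∃ p, lineCoord p ∉ D.ideal := by
    obtain ⟨s | s, h1, h2⟩ := D.relevant (Sum.inr ⟨(0, 1), by decide⟩)
    · simp [twoWeight] at h1
    · exact ⟨s, h2⟩
  have h1 : ∃ j, pluckerMatrix lineCoord i j ∉ D.ideal := by
    by_contra! h
    have h2 := D.le_ideal (incidence_mem hF i p)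
    replace h2 := add_mem h2 (sub_mem (Ideal.mul_mem_left D.ideal (pointCoord p.1.1) (h p.1.2))
      (Ideal.mul_mem_left D.ideal (pointCoord p.1.2) (h p.1.1)))
    rw [incidence, direction, direction, sub_add_cancel] at h2
    exact (D.isPrime.mem_or_mem h2).elim hi hp
  obtain ⟨j, hj⟩ := h1
  refine ⟨j, ?_, hj⟩
  rintro rfl
  exact hj (by rw [pluckerMatrix_self]; exact zero_mem _)

lemma exists_incidenceChart (hF : F.IsHomogeneous 3)
    (D : Point (twoWeight (Fin 4) Pair) (tripleContactIdeal F)) :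
    ∃ i j, i ≠ j ∧ pointCoord i ∉ D.ideal ∧ pluckerMatrix lineCoord i j ∉ D.ideal := by
  obtain ⟨i, hi⟩ : ∃ i, pointCoord i ∉ D.ideal := by
    obtain ⟨s | s, h1, h2⟩ := D.relevant (Sum.inl 0)
    · exact ⟨s, h2⟩
    · simp [twoWeight] at h1
  obtain ⟨j, hij, hj⟩ := exists_pluckerMatrix_notMem hF D hi
  exact ⟨i, j, hij, hi, hj⟩

section

variable {D : Point (twoWeight (Fin 4) Pair) (tripleContactIdeal F)} {i j : Fin 4}
    (hi : pointCoord i ∉ D.ideal) (hj : pluckerMatrix lineCoord i j ∉ D.ideal)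

lemma incidenceChart_ideal : (incidenceChart D hi hj).ideal =
    Ideal.span {pointCoord i - 1, pluckerMatrix lineCoord i j - 1} := by
  unfold Chart.ideal
  congr 1
  ext f
  simp only [Set.mem_range, Sum.exists, incidenceChart, twoWeight, Sum.elim_inl, Sum.elim_inr]
  constructor
  · rintro (⟨_, rfl⟩ | ⟨_, rfl⟩) <;> simp
  · rintro (rfl | rfl)
    · exact .inl ⟨0, by simp⟩
    · exact .inr ⟨⟨(0, 1), by decide⟩, by simp⟩

variable (hF : F.IsHomogeneous 3)

include hF

lemma chartEquations_subset : chartEquations F i j ⊆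
    (tripleContactIdeal F ⊔ (incidenceChart D hi hj).ideal : Ideal IncidenceRing) := by
  rintro f ((hf | ⟨n, rfl⟩) | ⟨p, -, rfl⟩)
  · refine Ideal.mem_sup_right ?_
    rw [incidenceChart_ideal]
    exact Ideal.subset_span hf
  · exact Ideal.mem_sup_left (contact_mem hF i n)
  · exact Ideal.mem_sup_left (incidence_mem hF i p)

/-- Together with `chartEquations_subset` this traps the ideal of `Y` in the chart between the eight
equations and their radical, which is enough for all dimension counts. -/
lemma sup_ideal_le_radical : tripleContactIdeal F ⊔ (incidenceChart D hi hj).ideal ≤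
    (Ideal.span (chartEquations F i j)).radical := by
  refine sup_le (tripleContactIdeal_le_radical hF i j) ?_
  rw [incidenceChart_ideal]
  exact (Ideal.span_mono fun f hf => .inl (.inl hf)).trans Ideal.le_radical

end

/-- The chart of `ℙ³` where a coordinate does not vanish. -/
def pointChart {I : Ideal (MvPolynomial (Fin 4) ℂ)} (C : Point (oneWeight (Fin 4)) I) {i : Fin 4}
    (hi : X i ∉ C.ideal) : Chart C where
  t d := X i ^ d.1
  t_zero := by simp
  t_add d d' := by simp only [Prod.fst_add, pow_add]
  t_mem s := by simpa [oneWeight] using isWeightedHomogeneous_X ℂ (oneWeight (Fin 4)) i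
  t_notMem d := fun h => hi (C.isPrime.mem_of_pow_mem _ h)

lemma exists_X_notMem {I : Ideal (MvPolynomial (Fin 4) ℂ)} (C : Point (oneWeight (Fin 4)) I) :
    ∃ i, X i ∉ C.ideal := by
  obtain ⟨s, -, h2⟩ := C.relevant 0
  exact ⟨s, h2⟩

lemma pointChart_ideal {I : Ideal (MvPolynomial (Fin 4) ℂ)} (C : Point (oneWeight (Fin 4)) I)
    {i : Fin 4} (hi : X i ∉ C.ideal) : (pointChart C hi).ideal = Ideal.span {X i - 1} := by
  unfold Chart.ideal
  congr 1
  ext f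
  simp [pointChart, oneWeight]

end Charts

end CubicSurface

namespace BiProj

/-! ### Primes and heights in local rings, via charts -/

namespace Chart

variable {σ : Type} {w : σ → ℕ × ℕ} {I : Ideal (MvPolynomial σ ℂ)} {z : Point w I} (c : Chart z)

/-- The local ring as a quotient of a local ring of an affine space. -/
def locEval : Localization.AtPrime c.prime →ₐ[ℂ] localRing z :=
  IsLocalization.liftAlgHom (M := c.prime.primeCompl) (f := c.eval)
    fun g => not_not.1 (mt c.mem_prime.2 g.2)

lemma locEval_algebraMap (f : MvPolynomial σ ℂ) :
    c.locEval (algebraMap _ _ f) = c.eval f :=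
  IsLocalization.lift_eq _ f

lemma isUnit_eval_of_notMem {g : MvPolynomial σ ℂ} (hg : g ∉ c.prime) : IsUnit (c.eval g) :=
  not_not.1 (mt c.mem_prime.2 hg)

lemma locEval_surjective : Function.Surjective c.locEval := by
  intro x
  obtain ⟨f, g, hg, h⟩ := c.exists_eval_mul_eq x
  refine ⟨IsLocalization.mk' _ f (⟨g, hg⟩ : c.prime.primeCompl), ?_⟩
  refine (c.isUnit_eval_of_notMem hg).mul_right_cancel ?_
  rw [h, ← c.locEval_algebraMap g, ← c.locEval_algebraMap f, ← map_mul]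
  exact congrArg _ (IsLocalization.mk'_spec _ f (⟨g, hg⟩ : c.prime.primeCompl))

include c in
lemma isNoetherianRing_localRing [Finite σ] : IsNoetherianRing (localRing z) :=
  isNoetherianRing_of_surjective _ _ c.locEval.toRingHom c.locEval_surjective

variable (hI : I.IsHomogeneous (piece w))

include hI

/-- The universal property of the local ring. -/
lemma exists_lift {S : Type*} [CommRing S] [Algebra ℂ S] (φ : MvPolynomial σ ℂ →ₐ[ℂ] S)
    (hφ : ∀ f ∈ I ⊔ c.ideal, φ f = 0) (hu : ∀ g ∉ c.prime, IsUnit (φ g)) :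
    ∃ ψ : localRing z →ₐ[ℂ] S, ∀ f, ψ (c.eval f) = φ f := by
  let ψ' : Localization.AtPrime c.prime →ₐ[ℂ] S :=
    IsLocalization.liftAlgHom (M := c.prime.primeCompl) (f := φ) fun g => hu g g.2
  have hψ' (f : MvPolynomial σ ℂ) : ψ' (algebraMap _ _ f) = φ f := IsLocalization.lift_eq _ f
  have hker : RingHom.ker c.locEval ≤ RingHom.ker ψ' := by
    intro x hx
    obtain ⟨⟨f, g⟩, h⟩ := IsLocalization.surj c.prime.primeCompl x
    have h0 : c.eval f = 0 := by
      rw [← c.locEval_algebraMap, ← h, map_mul, RingHom.mem_ker.1 hx, zero_mul]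
    obtain ⟨s, hs, hsf⟩ := c.exists_mul_mem_of_eval_eq_zero hI h0
    have h1 : φ f = 0 := by
      have := hφ _ hsf
      rw [map_mul] at this
      exact (hu s hs).mul_right_eq_zero.1 this
    rw [← hψ', ← h, map_mul, hψ'] at h1
    exact (hu g g.2).mul_left_eq_zero.1 h1
  refine ⟨AlgHom.liftOfSurjective c.locEval c.locEval_surjective ψ' hker, fun f => ?_⟩
  rw [← c.locEval_algebraMap, ← hψ']
  exact AlgHom.liftOfSurjective_apply c.locEval c.locEval_surjective ψ' hker _

omit hI in
lemma mem_iff_of_comap {p : Ideal (localRing z)} {x : localRing z} {f g : MvPolynomial σ ℂ}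
    (hg : g ∉ c.prime) (h : x * c.eval g = c.eval f) : x ∈ p ↔ f ∈ p.comap c.eval := by
  rw [Ideal.mem_comap, ← h, Ideal.mul_unit_mem_iff_mem _ (c.isUnit_eval_of_notMem hg)]

omit hI in
lemma le_of_comap_le {p p' : Ideal (localRing z)} (h : p.comap c.eval ≤ p'.comap c.eval) :
    p ≤ p' := by
  intro x hx
  obtain ⟨f, g, hg, e⟩ := c.exists_eval_mul_eq x
  rw [c.mem_iff_of_comap hg e] at hx ⊢
  exact h hx

/-- The local ring is a localization of a quotient of the polynomial ring. The candidate is the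
extension of `Q`, whose elements are fractions with numerator in `Q`. -/
lemma exists_comap_eq {Q : Ideal (MvPolynomial σ ℂ)} [Q.IsPrime] (hQ : I ⊔ c.ideal ≤ Q)
    (hQp : Q ≤ c.prime) : ∃ p : Ideal (localRing z), p.IsPrime ∧ p.comap c.eval = Q := by
  have key (x : localRing z) (hx : x ∈ Q.map c.eval) : ∃ f ∈ Q, ∃ g ∉ c.prime,
      x * c.eval g = c.eval f := by
    refine Submodule.span_induction ?_ ?_ ?_ ?_ hx
    · rintro _ ⟨f, hf, rfl⟩
      exact ⟨f, hf, 1, (Ideal.ne_top_iff_one _).1 Ideal.IsPrime.ne_top', by simp⟩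
    · exact ⟨0, zero_mem _, 1, (Ideal.ne_top_iff_one _).1 Ideal.IsPrime.ne_top', by simp⟩
    · rintro x y - - ⟨f, hf, g, hg, e⟩ ⟨f', hf', g', hg', e'⟩
      refine ⟨f * g' + f' * g, add_mem (Ideal.mul_mem_right _ _ hf) (Ideal.mul_mem_right _ _ hf'),
        g * g', fun h => (Ideal.IsPrime.mem_or_mem inferInstance h).elim hg hg', ?_⟩
      rw [map_mul, map_add, map_mul, map_mul, ← e, ← e']
      ring
    · rintro a x - ⟨f, hf, g, hg, e⟩
      obtain ⟨f', g', hg', e'⟩ := c.exists_eval_mul_eq a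
      refine ⟨f' * f, Ideal.mul_mem_left _ _ hf, g' * g,
        fun h => (Ideal.IsPrime.mem_or_mem inferInstance h).elim hg' hg, ?_⟩
      rw [map_mul, map_mul, ← e, ← e', smul_eq_mul]
      ring
  have hcomap : (Q.map c.eval).comap c.eval = Q := by
    refine le_antisymm (fun f hf => ?_) Ideal.le_comap_map
    obtain ⟨f', hf', g, hg, e⟩ := key _ hf
    have h0 : c.eval (f * g - f') = 0 := by rw [map_sub, map_mul, e, sub_self]
    obtain ⟨s, hs, h1⟩ := c.exists_mul_mem_of_eval_eq_zero hI h0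
    have h2 := ((inferInstance : Q.IsPrime).mem_or_mem (hQ h1)).resolve_left fun h => hs (hQp h)
    have h3 : f * g ∈ Q := by
      have := add_mem h2 hf'
      rwa [sub_add_cancel] at this
    exact ((inferInstance : Q.IsPrime).mem_or_mem h3).resolve_right fun h => hg (hQp h)
  refine ⟨Q.map c.eval, ?_, hcomap⟩
  constructor
  · intro h
    rw [h, Ideal.comap_top] at hcomap
    exact (inferInstance : Q.IsPrime).ne_top hcomap.symm
  · intro x y hxy
    obtain ⟨f, g, hg, e⟩ := c.exists_eval_mul_eq x
    obtain ⟨f', g', hg', e'⟩ := c.exists_eval_mul_eq y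
    have h : x * y * c.eval (g * g') = c.eval (f * f') := by
      rw [map_mul, map_mul, ← e, ← e']; ring
    have hgg : g * g' ∉ c.prime :=
      fun h => (Ideal.IsPrime.mem_or_mem inferInstance h).elim hg hg'
    rw [c.mem_iff_of_comap hgg h, hcomap] at hxy
    rw [c.mem_iff_of_comap hg e, c.mem_iff_of_comap hg' e', hcomap]
    exact (inferInstance : Q.IsPrime).mem_or_mem hxy

lemma sup_le_comap (p : Ideal (localRing z)) : I ⊔ c.ideal ≤ p.comap c.eval :=
  (c.sup_le_ker_eval hI).trans fun f hf => by
    rw [Ideal.mem_comap, RingHom.mem_ker.1 hf]; exact zero_mem _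

omit hI in
lemma comap_le_prime (p : Ideal (localRing z)) [p.IsPrime] : p.comap c.eval ≤ c.prime :=
  Ideal.comap_mono (IsLocalRing.le_maximalIdeal Ideal.IsPrime.ne_top')

lemma comap_mem_minimalPrimes {s : Set (MvPolynomial σ ℂ)} {p : Ideal (localRing z)}
    (hp : p ∈ (Ideal.span (c.eval '' s)).minimalPrimes) :
    p.comap c.eval ∈ (I ⊔ c.ideal ⊔ Ideal.span s).minimalPrimes := by
  have := hp.1.1
  refine ⟨⟨inferInstance, sup_le (c.sup_le_comap hI p) ?_⟩, ?_⟩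
  · rw [Ideal.span_le]
    exact fun f hf => hp.1.2 (Ideal.subset_span ⟨f, hf, rfl⟩)
  · rintro Q ⟨hQ, hle⟩ hQp
    obtain ⟨p', hp', rfl⟩ := c.exists_comap_eq hI (le_sup_left.trans hle)
      (hQp.trans (c.comap_le_prime p))
    refine Ideal.comap_mono (hp.2 ⟨hp', ?_⟩ (c.le_of_comap_le hQp))
    rw [Ideal.span_le]
    rintro _ ⟨f, hf, rfl⟩
    exact (le_sup_right.trans hle) (Ideal.subset_span hf)

/-- Choose as many elements as the height of `p` over whose span `p` is minimal, and clear
denominators. The numerators together with `S` generate an ideal over which the preimage of `p` is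
minimal, so Krull's height theorem applies. Knowing `S` up to radical suffices. -/
lemma height_comap_le [Finite σ] {S : Set (MvPolynomial σ ℂ)} (hS : S ⊆ (I ⊔ c.ideal : Ideal _))
    (hS' : I ⊔ c.ideal ≤ (Ideal.span S).radical) {n : ℕ} (hn : S.encard ≤ n)
    (p : Ideal (localRing z)) [p.IsPrime] : (p.comap c.eval).height ≤ n + p.height := by
  have := c.isNoetherianRing_localRing
  obtain ⟨a, ha, hcard⟩ := Ideal.exists_finset_card_eq_height_of_isNoetherianRing p
  choose f g hg e using c.exists_eval_mul_eq
  have hfin : S.Finite := Set.finite_of_encard_le_coe hn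
  have hspan : Ideal.span (a : Set (localRing z)) = Ideal.span (c.eval '' (f '' a)) := by
    refine le_antisymm ?_ ?_ <;> rw [Ideal.span_le]
    · intro x hx
      rw [SetLike.mem_coe, ← Ideal.mul_unit_mem_iff_mem _ (c.isUnit_eval_of_notMem (hg x)), e]
      exact Ideal.subset_span ⟨_, ⟨x, hx, rfl⟩, rfl⟩
    · rintro _ ⟨_, ⟨x, hx, rfl⟩, rfl⟩
      rw [← e]
      exact Ideal.mul_mem_right _ _ (Ideal.subset_span hx)
  rw [hspan] at ha
  have h1 := c.comap_mem_minimalPrimes hI ha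
  have h2 : p.comap c.eval ∈ (Ideal.span (S ∪ f '' a)).minimalPrimes := by
    refine ⟨⟨inferInstance, ?_⟩, ?_⟩
    · rw [Ideal.span_union]
      exact (sup_le_sup_right (Ideal.span_le.2 hS) _).trans h1.1.2
    · rintro Q ⟨hQ, hle⟩ hQp
      rw [Ideal.span_union] at hle
      exact h1.2 ⟨hQ, sup_le (hS'.trans (hQ.radical_le_iff.2 (le_sup_left.trans hle)))
        (le_sup_right.trans hle)⟩ hQp
  have h3 := Ideal.height_le_card_of_mem_minimalPrimes_span
    (hfin.union (a.finite_toSet.image f)) h2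
  refine h3.trans ?_
  rw [(hfin.union (a.finite_toSet.image f)).cast_ncard_eq, ← hcard]
  refine (Set.encard_union_le _ _).trans (add_le_add hn ?_)
  refine (Set.encard_image_le _ _).trans ?_
  rw [Set.encard_coe_eq_coe_finsetCard]

lemma height_prime_le [Finite σ] {S : Set (MvPolynomial σ ℂ)}
    (hS : S ⊆ (I ⊔ c.ideal : Ideal _))
    (hS' : I ⊔ c.ideal ≤ (Ideal.span S).radical) {n : ℕ} (hn : S.encard ≤ n)
    (hz : IsPrimeDivisor z) : c.prime.height ≤ n + 1 := by
  have h := c.height_comap_le hI hS hS' hn (IsLocalRing.maximalIdeal (localRing z))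
  have h1 : (IsLocalRing.maximalIdeal (localRing z)).height = 1 := by
    have := IsLocalRing.maximalIdeal_height_eq_ringKrullDim (R := localRing z)
    rw [hz] at this
    exact_mod_cast this
  rwa [h1] at h

/-- On a prime divisor, a function which vanishes on no component is contained in no prime ideal
but the maximal one. -/
lemma eq_maximalIdeal [Finite σ] {S : Set (MvPolynomial σ ℂ)}
    (hS : S ⊆ (I ⊔ c.ideal : Ideal _))
    (hS' : I ⊔ c.ideal ≤ (Ideal.span S).radical) {n : ℕ} (hn : S.encard ≤ n)
    (hz : IsPrimeDivisor z) (p : Ideal (localRing z)) [p.IsPrime]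
    (hp : (n : ℕ∞) < (p.comap c.eval).height) : p = IsLocalRing.maximalIdeal (localRing z) := by
  have h := c.height_comap_le hI hS hS' hn p
  have h1 : (IsLocalRing.maximalIdeal (localRing z)).height = 1 := by
    have := IsLocalRing.maximalIdeal_height_eq_ringKrullDim (R := localRing z)
    rw [hz] at this
    exact_mod_cast this
  by_contra hne
  have := c.isNoetherianRing_localRing
  have h2 : p < IsLocalRing.maximalIdeal (localRing z) :=
    lt_of_le_of_ne (IsLocalRing.le_maximalIdeal Ideal.IsPrime.ne_top') hne
  have h3 := Ideal.height_strict_mono_of_isPrime h2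
  rw [h1, Order.lt_one_iff] at h3
  rw [h3, add_zero] at h
  exact absurd hp h.not_gt

end Chart

end BiProj

namespace CubicSurface

open BiProj

/-! ### Tangent spaces of `Y` along the zero locus of the Hessian -/

section Tangent

/-- The tangent plane is spanned by `x`, `v` and one more vector. On it `T x x` and `T x v` vanish,
so the form `T x` is determined by its value on that last vector. -/
lemma IsTripleContact.apply_eq_zero_of_flat {K : Type*} [Field K] {T : Trilinear K}
    {i j k l : Fin 4} {x v : Fin 4 → K}
    (h : IsTripleContact T i j x v) (hT : T.IsSymm) (hN : T.IsNondegenerate)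
    (e : IsEnum i j k l) (hm : minor T x v k l = 0)
    (hII : T x (tangentVec T x k l) (tangentVec T x k l) = 0) {w w' : Fin 4 → K}
    (hw : T x x w = 0) (hw' : T x x w' = 0) : T x w w' = 0 := by
  obtain ⟨c, hc⟩ := h.exists_eq_mul e hT hN hm
  obtain ⟨r, hr⟩ := h.exists_eq_combination e hN hw
  obtain ⟨r', hr'⟩ := h.exists_eq_combination e hN hw'
  have h1 := apply_tangentVec T x k l
  rw [hr, hr']
  simp only [map_add, map_smul, LinearMap.add_apply, LinearMap.smul_apply, smul_eq_mul,
    hT.right x _ x, hc, h.xxx, h.xxv, hT.right x _ v, h1, hII]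
  simp

lemma comp_tangentVec {A A' : Type*} [CommRing A] [CommRing A'] [Algebra ℂ A] [Algebra ℂ A']
    {F : MvPolynomial (Fin 4) ℂ} (φ : A →ₐ[ℂ] A') (x : Fin 4 → A) (a b : Fin 4) :
    φ ∘ tangentVec (cubicForm A F) x a b = tangentVec (cubicForm A' F) (φ ∘ x) a b := by
  ext c
  simp only [Function.comp_apply, tangentVec, Pi.sub_apply, Pi.smul_apply, smul_eq_mul, map_sub,
    map_mul, map_cubicForm, comp_basisVec]
  rw [← comp_basisVec φ a, ← comp_basisVec φ b]
  simp only [Function.comp_apply]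

lemma direction_add {K : Type*} [CommRing K] (q q' : Pair → K) (i : Fin 4) :
    direction (q + q') i = direction q i + direction q' i := by
  ext a
  simp only [direction, pluckerMatrix, Pi.add_apply]
  split_ifs <;> ring

lemma direction_smul {K : Type*} [CommRing K] (r : K) (q : Pair → K) (i : Fin 4) :
    direction (r • q) i = r • direction q i := by
  ext a
  simp only [direction, pluckerMatrix, Pi.smul_apply, smul_eq_mul]
  split_ifs <;> ring

variable {F : MvPolynomial (Fin 4) ℂ} {K : Type*} [Field K] [Algebra ℂ K]
  [Algebra IncidenceRing K] [IsScalarTower ℂ IncidenceRing K]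

omit [IsScalarTower ℂ IncidenceRing K] in
lemma derivation_comp_direction (D : Derivation ℂ IncidenceRing K) (i : Fin 4) :
    D ∘ direction lineCoord i = direction (D ∘ lineCoord) i := by
  ext a
  simp only [direction, pluckerMatrix, Function.comp_apply]
  split_ifs <;> simp

omit [Algebra IncidenceRing K] [IsScalarTower ℂ IncidenceRing K] in
lemma derivation_comp_tangentVec {A : Type*} [CommRing A] [Algebra ℂ A] [Algebra A K]
    [IsScalarTower ℂ A K] (D : Derivation ℂ A K) (p : Fin 4 → A) (a b : Fin 4) :
    D ∘ tangentVec (cubicForm A F) p a b =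
      (2 * cubicForm K F (algebraMap _ K ∘ p) (D ∘ p) (basisVec K a)) • basisVec K b -
      (2 * cubicForm K F (algebraMap _ K ∘ p) (D ∘ p) (basisVec K b)) • basisVec K a := by
  have hb (a : Fin 4) : algebraMap A K ∘ basisVec A a = basisVec K a :=
    comp_basisVec (IsScalarTower.toAlgHom ℂ A K) a
  have hDb (a : Fin 4) : D ∘ basisVec A a = 0 := by
    ext c
    simp only [Function.comp_apply, Pi.single_apply, Pi.zero_apply]
    split_ifs <;> simp
  have h1 (a c d : Fin 4) : D (cubicForm A F p p (basisVec _ a) * basisVec _ c d) =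
      2 * cubicForm K F (algebraMap _ K ∘ p) (D ∘ p) (basisVec K a) * basisVec K c d := by
    rw [Derivation.leibniz, derivation_cubicForm_field, hb, hDb]
    have h2 : D (basisVec A c d) = 0 := congrFun (hDb c) d
    have h3 : algebraMap A K (basisVec A c d) = basisVec K c d := congrFun (hb c) d
    rw [h2, Algebra.smul_def (basisVec A c d), h3,
      cubicForm_isSymm.left (D ∘ p) (algebraMap A K ∘ p)]
    simp
    ring
  ext d
  simp only [Function.comp_apply, tangentVec, Pi.sub_apply, Pi.smul_apply, smul_eq_mul, map_sub, h1]

omit [Algebra IncidenceRing K] [IsScalarTower ℂ IncidenceRing K] in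
lemma derivation_secondForm {A : Type*} [CommRing A] [Algebra ℂ A] [Algebra A K]
    [IsScalarTower ℂ A K] (D : Derivation ℂ A K) (p : Fin 4 → A) {x y : Fin 4 → K}
    (hx : algebraMap A K ∘ p = x) (hy : D ∘ p = y) (a b c d : Fin 4) :
    D (cubicForm A F p (tangentVec (cubicForm A F) p a b) (tangentVec (cubicForm A F) p c d)) =
      cubicForm K F y (tangentVec (cubicForm K F) x a b) (tangentVec (cubicForm K F) x c d) +
      cubicForm K F x ((2 * cubicForm K F x y (basisVec K a)) • basisVec K b -
        (2 * cubicForm K F x y (basisVec K b)) • basisVec K a)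
        (tangentVec (cubicForm K F) x c d) +
      cubicForm K F x (tangentVec (cubicForm K F) x a b)
        ((2 * cubicForm K F x y (basisVec K c)) • basisVec K d -
          (2 * cubicForm K F x y (basisVec K d)) • basisVec K c) := by
  have hw (a b : Fin 4) : algebraMap A K ∘ tangentVec (cubicForm A F) p a b =
      tangentVec (cubicForm K F) x a b := by
    rw [← hx]
    exact comp_tangentVec (IsScalarTower.toAlgHom ℂ A K) p a b
  rw [derivation_cubicForm_field, hw, hw, derivation_comp_tangentVec D p a b,
    derivation_comp_tangentVec D p c d, hx, hy]

lemma derivation_comp_pointTangentVec (D : Derivation ℂ IncidenceRing K) (a b : Fin 4) :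
    D ∘ tangentVec (cubicForm IncidenceRing F) pointCoord a b =
      (2 * cubicForm K F (algebraMap _ K ∘ pointCoord) (D ∘ pointCoord) (basisVec K a)) •
        basisVec K b -
      (2 * cubicForm K F (algebraMap _ K ∘ pointCoord) (D ∘ pointCoord) (basisVec K b)) •
        basisVec K a :=
  derivation_comp_tangentVec D pointCoord a b

/-- The determinant of the differential of the projection, in a chart. -/
def jacobian (F : MvPolynomial (Fin 4) ℂ) (i k l : Fin 4) : IncidenceRing :=
  minor (cubicForm IncidenceRing F) pointCoord (direction lineCoord i) k l

/-- The values of the second fundamental form. -/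
def secondForm (F : MvPolynomial (Fin 4) ℂ) (a b c d : Fin 4) : IncidenceRing :=
  cubicForm IncidenceRing F pointCoord (tangentVec (cubicForm IncidenceRing F) pointCoord a b)
    (tangentVec (cubicForm IncidenceRing F) pointCoord c d)

lemma map_jacobian {A : Type*} [CommRing A] [Algebra ℂ A] (φ : IncidenceRing →ₐ[ℂ] A)
    (i k l : Fin 4) : φ (jacobian F i k l) =
      minor (cubicForm A F) (φ ∘ pointCoord) (direction (φ ∘ lineCoord) i) k l := by
  rw [jacobian, minor, map_cubicForm, comp_direction, comp_tangentVec, minor]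

lemma map_secondForm {A : Type*} [CommRing A] [Algebra ℂ A] (φ : IncidenceRing →ₐ[ℂ] A)
    (a b c d : Fin 4) : φ (secondForm F a b c d) =
      cubicForm A F (φ ∘ pointCoord) (tangentVec (cubicForm A F) (φ ∘ pointCoord) a b)
        (tangentVec (cubicForm A F) (φ ∘ pointCoord) c d) := by
  rw [secondForm, map_cubicForm, comp_tangentVec, comp_tangentVec]

/-- First order deformations of a line with triple contact, in the chart `x i = 1`, `v i = 0`,
`v j = 1`. -/
structure IsDeformation {K : Type*} [CommRing K] (T : Trilinear K) (i j : Fin 4)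
    (x v y u : Fin 4 → K) : Prop where
  yi : y i = 0
  ui : u i = 0
  uj : u j = 0
  xxy : T x x y = 0
  xvy : 2 * T x v y + T x x u = 0
  vvy : T v v y + 2 * T x v u = 0

lemma isDeformation_of_derivation (D : Derivation ℂ IncidenceRing K) {i j : Fin 4}
    (hD : ∀ f ∈ chartEquations F i j, D f = 0) :
    IsDeformation (cubicForm K F) i j (algebraMap _ K ∘ pointCoord)
      (algebraMap _ K ∘ direction lineCoord i) (D ∘ pointCoord) (D ∘ direction lineCoord i) := by
  have hT : (cubicForm K F).IsSymm := cubicForm_isSymm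
  have hchar : CharZero K := algebra_charZero K
  have hc (n : Fin 3) : D (contact F i n) = 0 := hD _ (.inl (.inr ⟨n, rfl⟩))
  set x := algebraMap IncidenceRing K ∘ pointCoord
  set v := algebraMap IncidenceRing K ∘ direction lineCoord i
  set y := D ∘ pointCoord
  set u := D ∘ direction lineCoord i with hu
  refine ⟨?_, ?_, ?_, ?_, ?_, ?_⟩
  · have := hD _ (.inl (.inl (.inl rfl)))
    rwa [map_sub, Derivation.map_one_eq_zero, sub_zero] at this
  · rw [hu, derivation_comp_direction]
    exact pluckerMatrix_self _ _
  · have := hD _ (.inl (.inl (.inr rfl)))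
    rwa [map_sub, Derivation.map_one_eq_zero, sub_zero] at this
  · have := hc 0
    simp only [contact, Matrix.cons_val_zero, derivation_cubicForm_field] at this
    change cubicForm K F y x x + cubicForm K F x y x + cubicForm K F x x y = 0 at this
    rw [hT.left y x, hT.right x y x] at this
    have h3 : (3 : K) * cubicForm K F x x y = 0 := by linear_combination this
    simpa using h3
  · have := hc 1
    simp only [contact, Matrix.cons_val_one, Matrix.cons_val_zero,
      derivation_cubicForm_field] at this
    change cubicForm K F y x v + cubicForm K F x y v + cubicForm K F x x u = 0 at this
    rw [hT.left y x, hT.right x y v] at this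
    linear_combination this
  · have := hc 2
    simp only [contact, Matrix.cons_val, derivation_cubicForm_field] at this
    change cubicForm K F y v v + cubicForm K F x u v + cubicForm K F x v u = 0 at this
    rw [hT.left y v, hT.right v y v, hT.right x u v] at this
    linear_combination this

/-- A tangent vector is thus determined by the motions of the point and of the direction, so the six
Plücker coordinates need no separate treatment. -/
lemma derivation_lineCoord (D : Derivation ℂ IncidenceRing K) {i j : Fin 4}
    (hD : ∀ f ∈ chartEquations F i j, D f = 0)
    (hK : ∀ f ∈ chartEquations F i j, algebraMap IncidenceRing K f = 0) :
    D ∘ lineCoord = wedge (D ∘ pointCoord) (algebraMap _ K ∘ direction lineCoord i) +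
      wedge (algebraMap _ K ∘ pointCoord) (D ∘ direction lineCoord i) := by
  have hdef := isDeformation_of_derivation D hD
  obtain ⟨h, -⟩ := isTripleContact_of_chartEquations
    (IsScalarTower.toAlgHom ℂ IncidenceRing K) hK
  have hxi : algebraMap IncidenceRing K (pointCoord i) = 1 := h.xi
  have hyi : D (pointCoord i) = 0 := hdef.yi
  have hvi : algebraMap IncidenceRing K (direction lineCoord i i) = 0 := by
    rw [direction, pluckerMatrix_self, map_zero]
  have hui : D (direction lineCoord i i) = 0 := hdef.ui
  ext p
  simp only [Pi.add_apply, wedge, Function.comp_apply]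
  by_cases hp : p.1.1 ≠ i ∧ p.1.2 ≠ i
  · have := hD _ (.inr ⟨p, hp, rfl⟩)
    rw [incidence, map_sub, map_sub, Derivation.leibniz, Derivation.leibniz,
      Derivation.leibniz] at this
    simp only [Algebra.smul_def, hxi, hyi] at this
    linear_combination this
  · rw [not_and_or, not_not, not_not] at hp
    rcases hp with rfl | rfl
    · have h1 : lineCoord p = direction lineCoord p.1.1 p.1.2 := (pluckerMatrix_pair _ p).symm
      rw [h1, hxi, hyi, hvi, hui]
      ring
    · have h1 : lineCoord p = -direction lineCoord p.1.2 p.1.1 := by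
        rw [direction, pluckerMatrix_swap, neg_neg, pluckerMatrix_pair]
      rw [h1, hxi, hyi, hvi, hui, map_neg]
      ring

/-- Tangent vectors are first-order deformations with stationary minor, which depend on one
parameter by `IsTripleContact.exists_functional`. At flat points this needs the second fundamental
form to vanish to first order too; `hS3` asks for those extra equations only there. -/
lemma finrank_tangent_le_one (hF : F.IsHomogeneous 3) (hns : IsNonsingular F) {i j k l : Fin 4}
    (e : IsEnum i j k l) {S : Set IncidenceRing} (hS : ∀ f ∈ S, algebraMap IncidenceRing K f = 0)
    (hS1 : chartEquations F i j ⊆ S) (hS2 : jacobian F i k l ∈ S)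
    (hS3 : algebraMap IncidenceRing K (secondForm F k l k l) = 0 →
      ∀ a b c d, secondForm F a b c d ∈ S) :
    Module.finrank K (tangent K S) ≤ 1 := by
  set φ : IncidenceRing →ₐ[ℂ] K := IsScalarTower.toAlgHom ℂ IncidenceRing K with hφ
  have hφ' : ⇑(algebraMap IncidenceRing K) = ⇑φ := rfl
  have hT : (cubicForm K F).IsSymm := cubicForm_isSymm
  have hN : (cubicForm K F).IsNondegenerate := cubicForm_isNondegenerate hF hns
  obtain ⟨h, hq⟩ := isTripleContact_of_chartEquations φ fun f hf => hS f (hS1 hf)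
  have hm := hS _ hS2
  rw [hφ', map_jacobian] at hm
  rw [hφ', map_secondForm] at hS3
  set x := φ ∘ pointCoord with hx
  set v := direction (φ ∘ lineCoord) i with hv
  set T := cubicForm K F with hTdef
  have hx0 : x ≠ 0 := fun h0 => by simpa [h0] using h.xi
  obtain ⟨f, f', hff⟩ := h.exists_functional hT hN e hm
    (fun y => T x (tangentVec T x k l) (tangentVec T x k l) = 0 → ∀ a b c d,
      T y (tangentVec T x a b) (tangentVec T x c d) +
      T x ((2 * T x y (basisVec K a)) • basisVec K b - (2 * T x y (basisVec K b)) • basisVec K a)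
        (tangentVec T x c d) +
      T x (tangentVec T x a b)
        ((2 * T x y (basisVec K c)) • basisVec K d - (2 * T x y (basisVec K d)) • basisVec K c)
        = 0) (fun hII y hy hxy => by
    exact exists_eq_smul_of_flat hT hN hx0 hxy (fun w w' => h.apply_eq_zero_of_flat hT hN e hm hII)
      (hy hII))
  -- The parameter, as a linear form on the tangent space; its injectivity gives the bound.
  let L : tangent K S →ₗ[K] K :=
    { toFun := fun ξ => f (ξ.1 ∘ Sum.inl) + f' (direction (ξ.1 ∘ Sum.inr) i)
      map_add' := fun ξ ξ' => by
        have h1 : (ξ + ξ').1 ∘ Sum.inl = ξ.1 ∘ Sum.inl + ξ'.1 ∘ Sum.inl := rfl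
        have h2 : (ξ + ξ').1 ∘ Sum.inr = ξ.1 ∘ Sum.inr + ξ'.1 ∘ Sum.inr := rfl
        rw [h1, h2, direction_add, map_add, map_add]
        ring
      map_smul' := fun r ξ => by
        have h1 : (r • ξ).1 ∘ Sum.inl = r • (ξ.1 ∘ Sum.inl) := rfl
        have h2 : (r • ξ).1 ∘ Sum.inr = r • (ξ.1 ∘ Sum.inr) := rfl
        rw [h1, h2, direction_smul, map_smul, map_smul]
        simp only [smul_eq_mul, RingHom.id_apply]
        ring }
  refine (LinearMap.finrank_le_finrank_of_injective (f := L) ?_).trans (Module.finrank_self K).le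
  rw [injective_iff_map_eq_zero]
  rintro ⟨ξ, hξ⟩ hL
  rw [mem_tangent] at hξ
  set D : Derivation ℂ IncidenceRing K := mkDerivation ℂ ξ with hD
  set y : Fin 4 → K := ξ ∘ Sum.inl with hy
  set u : Fin 4 → K := direction (ξ ∘ Sum.inr) i with hu
  have hDx : D ∘ pointCoord = y := by
    ext a
    exact mkDerivation_X ℂ _ _
  have hDl : D ∘ lineCoord = ξ ∘ Sum.inr := by
    ext a
    exact mkDerivation_X ℂ _ _
  have hDv : D ∘ direction lineCoord i = u := by
    rw [derivation_comp_direction, hDl]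
  have hcx : algebraMap IncidenceRing K ∘ pointCoord = x := rfl
  have hcv : algebraMap IncidenceRing K ∘ direction lineCoord i = v := by
    rw [hφ', comp_direction]
  have hcw (a b : Fin 4) : algebraMap IncidenceRing K ∘
      tangentVec (cubicForm IncidenceRing F) pointCoord a b = tangentVec T x a b := by
    rw [hφ', comp_tangentVec]
  have hdef := isDeformation_of_derivation D fun f hf => hξ f (hS1 hf)
  have hline := derivation_lineCoord D (fun f hf => hξ f (hS1 hf)) fun f hf => hS f (hS1 hf)
  rw [hDx, hcx, hcv, hDv] at hdef hline
  obtain ⟨hyi, hui, huj, h0, h1, h2⟩ := hdef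
  have h3 := hξ _ hS2
  rw [jacobian, minor, derivation_cubicForm_field, hDx, hDv, hcx, hcv, hcw,
    derivation_comp_pointTangentVec D, hDx, hcx] at h3
  obtain ⟨hy0, hu0⟩ := hff y u (fun hII a b c d => by
    have := hξ _ (hS3 hII a b c d)
    rwa [secondForm, derivation_secondForm D pointCoord hcx hDx] at this)
    hyi hui huj h0 h1 h2 h3 hL
  ext s
  rcases s with a | p
  · exact congrFun hy0 a
  · have := congrFun hline p
    rw [hDl, hy0, hu0] at this
    simpa [wedge] using this

/-- The Hessian determinant is the square of the Jacobian on the variety of lines with triple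
contact. -/
lemma map_rename_hessian (hF : F.IsHomogeneous 3) {A : Type*} [CommRing A] [Algebra ℂ A]
    (φ : IncidenceRing →ₐ[ℂ] A) {i j k l : Fin 4} (e : IsEnum i j k l)
    (h : ∀ f ∈ chartEquations F i j, φ f = 0) :
    φ (rename Sum.inl (hessian F)) = φ (jacobian F i k l) ^ 2 := by
  obtain ⟨h1, -⟩ := isTripleContact_of_chartEquations φ h
  rw [map_jacobian, ← det_formMatrix_eq_sq cubicForm_isSymm e h1.xi h1.vi h1.vj h1.xxx h1.xxv
    h1.xvv]
  have h2 := map_hessian hF (φ.comp (rename Sum.inl))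
  rw [AlgHom.comp_apply] at h2
  rw [h2]
  congr 2
  ext a
  simp [pointCoord]

lemma algebraMap_residueField_eq_zero_iff {R : Type*} [CommRing R] (Q : Ideal R) [Q.IsPrime]
    (f : R) : algebraMap R Q.ResidueField f = 0 ↔ f ∈ Q :=
  Ideal.algebraMap_residueField_eq_zero

section Prime

variable (hF : F.IsHomogeneous 3) (hns : IsNonsingular F) {i j k l : Fin 4} (e : IsEnum i j k l)
  (Q : Ideal IncidenceRing) [Q.IsPrime] (hQ : chartEquations F i j ⊆ Q)
  (hQ' : rename Sum.inl (hessian F) ∈ Q)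

include hF e hQ hQ'

lemma jacobian_mem : jacobian F i k l ∈ Q := by
  have h := map_rename_hessian hF (IsScalarTower.toAlgHom ℂ IncidenceRing Q.ResidueField) e
    fun f hf => (algebraMap_residueField_eq_zero_iff Q f).2 (hQ hf)
  have h1 := (algebraMap_residueField_eq_zero_iff Q _).2 hQ'
  rw [IsScalarTower.coe_toAlgHom', h1] at h
  exact (algebraMap_residueField_eq_zero_iff Q _).1 ((pow_eq_zero_iff two_ne_zero).1 h.symm)

include hns

/-- Of the ten coordinates at most one remains as tangent direction. Taking all of `Q` as equations
makes the ones needed at flat points available. So the zero locus of the Hessian in `Y` has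
dimension at most one, including the fibres over flat points. -/
lemma nine_le_height : 9 ≤ Q.height := by
  set K := Q.ResidueField
  set φ := IsScalarTower.toAlgHom ℂ IncidenceRing K
  have hm := jacobian_mem hF e Q hQ hQ'
  have hz (f) (hf : f ∈ Q) : φ f = 0 := (algebraMap_residueField_eq_zero_iff Q f).2 hf
  obtain ⟨h, -⟩ := isTripleContact_of_chartEquations φ fun f hf => hz f (hQ hf)
  have h1 := finrank_tangent_le_one (K := K) hF hns e (S := Q) hz hQ hm fun hII a b c d => by
    change φ _ = 0 at hII
    refine (algebraMap_residueField_eq_zero_iff Q _).1 ?_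
    change φ _ = 0
    rw [map_secondForm] at hII ⊢
    have hm' := hz _ hm
    rw [map_jacobian] at hm'
    exact h.apply_eq_zero_of_flat cubicForm_isSymm (cubicForm_isNondegenerate hF hns) e hm' hII
      (apply_tangentVec _ _ _ _) (apply_tangentVec _ _ _ _)
  have h2 := le_finrank_tangent_add_height K Q (algebraMap_residueField_eq_zero_iff Q) Q le_rfl
  have h3 : Fintype.card (Fin 4 ⊕ Pair) = 10 := by decide
  rw [h3] at h2
  have h4 : (10 : ℕ∞) ≤ 1 + Q.height := by
    refine le_trans (by exact_mod_cast h2) ?_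
    gcongr
    exact_mod_cast h1
  have h5 : (1 : ℕ∞) + 9 ≤ 1 + Q.height := by
    refine le_trans ?_ h4
    norm_num
  exact (ENat.add_le_add_iff_left (by norm_num)).1 h5

end Prime

end Tangent

end CubicSurface

namespace CubicSurface

open BiProj

/-! ### The derivative of a determinant -/

section DerivationDet

lemma derivation_prod {A K ι : Type*} [CommRing A] [Algebra ℂ A] [CommRing K] [Algebra ℂ K]
    [Algebra A K] [DecidableEq ι] (D : Derivation ℂ A K) (s : Finset ι) (f : ι → A) :
    D (∏ a ∈ s, f a) = ∑ a ∈ s, ∏ b ∈ s, if b = a then D (f b) else algebraMap A K (f b) := by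
  induction s using Finset.induction_on with
  | empty => simp
  | insert a s ha ih =>
    rw [Finset.prod_insert ha, Derivation.leibniz, ih, Finset.sum_insert ha,
      Finset.prod_insert ha, if_pos rfl, add_comm]
    congr 1
    · rw [Algebra.smul_def, mul_comm, map_prod]
      refine congrArg _ (Finset.prod_congr rfl fun b hb => ?_)
      rw [if_neg (fun h : b = a => ha (h ▸ hb))]
    · rw [Finset.smul_sum]
      refine Finset.sum_congr rfl fun b hb => ?_
      rw [Finset.prod_insert ha, if_neg (fun h : a = b => ha (h ▸ hb)), Algebra.smul_def]

/-- Jacobi's formula. -/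
lemma derivation_det {A K n : Type*} [CommRing A] [Algebra ℂ A] [CommRing K] [Algebra ℂ K]
    [Algebra A K] [DecidableEq n] [Fintype n] (D : Derivation ℂ A K) (M : Matrix n n A) :
    D M.det = ∑ a, ∑ b, (M.map (algebraMap A K)).adjugate a b * D (M b a) := by
  -- Cramer's rule: each inner sum is the determinant with column `a` differentiated.
  have h1 (a : n) : ∑ b, (M.map (algebraMap A K)).adjugate a b * D (M b a) =
      ((M.map (algebraMap A K)).updateCol a fun b => D (M b a)).det := by
    rw [← Matrix.cramer_apply, Matrix.cramer_eq_adjugate_mulVec]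
    rfl
  simp_rw [h1, Matrix.det_apply]
  rw [map_sum, Finset.sum_comm]
  refine Finset.sum_congr rfl fun g _ => ?_
  rw [Units.smul_def, map_zsmul, derivation_prod, Finset.smul_sum]
  refine Finset.sum_congr rfl fun a _ => ?_
  rw [Units.smul_def]
  refine congrArg _ (Finset.prod_congr rfl fun b _ => ?_)
  rw [Matrix.updateCol_apply, Matrix.map_apply]
  split_ifs with h
  · rw [h]
  · rfl

end DerivationDet

/-! ### The Hessian along parabolic curves of the surface -/

section Surface

variable {F : MvPolynomial (Fin 4) ℂ} (hF : F.IsHomogeneous 3) (hns : IsNonsingular F) {i : Fin 4}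
  {K : Type*} [Field K] [Algebra ℂ K] [Algebra (MvPolynomial (Fin 4) ℂ) K]
  [IsScalarTower ℂ (MvPolynomial (Fin 4) ℂ) K]
  (q : Ideal (MvPolynomial (Fin 4) ℂ)) [q.IsPrime]
  (hqK : ∀ f, algebraMap (MvPolynomial (Fin 4) ℂ) K f = 0 ↔ f ∈ q)
  (hi : X i - 1 ∈ q) (hFq : F ∈ q)

/-- The point of affine space with values in an algebra over the polynomial ring. -/
def genericPoint (σ K : Type*) [CommRing K] [Algebra (MvPolynomial σ ℂ) K] : σ → K :=
  fun a => algebraMap (MvPolynomial σ ℂ) K (X a)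

omit [Algebra (MvPolynomial (Fin 4) ℂ) K] [IsScalarTower ℂ (MvPolynomial (Fin 4) ℂ) K] in
lemma aeval_genericPoint {σ : Type*} [Algebra (MvPolynomial σ ℂ) K]
    [IsScalarTower ℂ (MvPolynomial σ ℂ) K] (f : MvPolynomial σ ℂ) :
    aeval (genericPoint σ K) f = algebraMap (MvPolynomial σ ℂ) K f := by
  have h : aeval (genericPoint σ K) = IsScalarTower.toAlgHom ℂ (MvPolynomial σ ℂ) K :=
    algHom_ext fun a => by simp [genericPoint]
  rw [h]
  rfl

include hqK

omit [Algebra ℂ K] [IsScalarTower ℂ (MvPolynomial (Fin 4) ℂ) K] [q.IsPrime] in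
include hi in
lemma genericPoint_eq_one : genericPoint (Fin 4) K i = 1 := by
  have h := (hqK _).2 hi
  rwa [map_sub, map_one, sub_eq_zero] at h

omit [q.IsPrime] in
include hF hFq in
lemma cubicForm_genericPoint : cubicForm K F (genericPoint _ K) (genericPoint _ K)
    (genericPoint _ K) = 0 := by
  rw [← six_mul_aeval_eq hF, aeval_genericPoint, (hqK _).2 hFq, mul_zero]

include hF hns hi hFq in
/-- A cubic surface is curved at the generic points of its curves. -/
lemma four_le_height_of_adjugate_eq_zero
    (hadj : (formMatrix (cubicForm K F) (genericPoint _ K)).adjugate = 0) : 4 ≤ q.height := by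
  set x := genericPoint (Fin 4) K with hx
  set T := cubicForm K F
  have hT : T.IsSymm := cubicForm_isSymm
  have hN : T.IsNondegenerate := cubicForm_isNondegenerate hF hns
  have hchar : CharZero K := algebra_charZero K
  have hxi : x i = 1 := genericPoint_eq_one q hqK hi
  have hx0 : x ≠ 0 := fun h => by simp [h] at hxi
  have hxx : T x x x = 0 := cubicForm_genericPoint hF q hqK hFq
  have hII (w w') (hw : T x x w = 0) (hw' : T x x w' = 0) : T x w w' = 0 :=
    apply_eq_zero_of_adjugate_eq_zero hT hN two_ne_zero hx0 hxx hadj w w' hw hw'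
  set P : Fin 4 → MvPolynomial (Fin 4) ℂ := X with hP
  set φ : MvPolynomial (Fin 4) ℂ →ₐ[ℂ] K := IsScalarTower.toAlgHom ℂ _ K
  have hφP : φ ∘ P = x := rfl
  have hcP : algebraMap (MvPolynomial (Fin 4) ℂ) K ∘ P = x := rfl
  have hE (a b c d : Fin 4) : cubicForm _ F P (tangentVec (cubicForm _ F) P a b)
      (tangentVec (cubicForm _ F) P c d) ∈ q := by
    refine (hqK _).1 ?_
    change φ _ = 0
    rw [map_cubicForm, comp_tangentVec, comp_tangentVec, hφP]
    exact hII _ _ (apply_tangentVec _ _ _ _) (apply_tangentVec _ _ _ _)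
  -- All values of the second fundamental form lie in `q`, so a tangent vector preserves flatness to
  -- first order and is a multiple of `x`. The normalization `y i = 0` makes it zero, and the
  -- ambient dimension being four, the height is at least four.
  have h0 : tangent K (q : Set (MvPolynomial (Fin 4) ℂ)) = ⊥ := by
    rw [eq_bot_iff]
    intro y hy
    rw [mem_tangent] at hy
    set D : Derivation ℂ (MvPolynomial (Fin 4) ℂ) K := mkDerivation ℂ y
    replace hy : ∀ g ∈ q, D g = 0 := hy
    have hDP : D ∘ P = y := by
      ext a
      exact mkDerivation_X ℂ _ _
    have hyi : y i = 0 := by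
      have := hy _ hi
      rw [map_sub, Derivation.map_one_eq_zero, sub_zero] at this
      rw [← hDP]
      exact this
    have hxy : T x x y = 0 := by
      have h6 : cubicForm _ F P P P ∈ q := by
        rw [hP, ← six_mul_eq hF]
        exact Ideal.mul_mem_left _ _ hFq
      have := hy _ h6
      rw [derivation_cubicForm_field, hDP, hcP, hT.left y x, hT.right x y x] at this
      have h3 : (3 : K) * T x x y = 0 := by linear_combination this
      simpa using h3
    obtain ⟨r, hr⟩ := exists_eq_smul_of_flat hT hN hx0 hxy hII fun a b c d => by
      have := hy _ (hE a b c d)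
      rwa [derivation_secondForm D P hcP hDP] at this
    have hr0 : r = 0 := by simpa [hr, hxi] using hyi
    rw [Submodule.mem_bot, hr, hr0, zero_smul]
  have h2 := le_finrank_tangent_add_height K q hqK q le_rfl
  rw [h0, finrank_bot] at h2
  simpa using h2

variable (hh : hessian F ∈ q) (hq : q.height ≤ 3)

include hF hns hi hFq hq in
lemma adjugate_genericPoint_ne_zero :
    (formMatrix (cubicForm K F) (genericPoint _ K)).adjugate ≠ 0 := fun h => by
  have h1 := (four_le_height_of_adjugate_eq_zero hF hns q hqK hi hFq h).trans hq
  exact absurd h1 (by decide)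

omit [q.IsPrime] in
include hF hh in
lemma det_genericPoint : (formMatrix (cubicForm K F) (genericPoint _ K)).det = 0 := by
  have h := map_hessian hF (aeval (R := ℂ) (genericPoint (Fin 4) K))
  rw [aeval_genericPoint, (hqK _).2 hh, aeval_comp_X] at h
  exact h.symm

include hF hns hi hFq hh hq in
/-- The Hessian vanishes to first order along the parabolic curves. -/
lemma exists_mul_mem_span_hessian (f : MvPolynomial (Fin 4) ℂ) (hf : f ∈ q) :
    ∃ s ∉ q, s * f ∈ Ideal.span {X i - 1, F, hessian F} := by
  set x := genericPoint (Fin 4) K with hx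
  set T := cubicForm K F
  have hT : T.IsSymm := cubicForm_isSymm
  have hN : T.IsNondegenerate := cubicForm_isNondegenerate hF hns
  have hchar : CharZero K := algebra_charZero K
  have hxi : x i = 1 := genericPoint_eq_one q hqK hi
  have hxx : T x x x = 0 := cubicForm_genericPoint hF q hqK hFq
  have hdet : (formMatrix T x).det = 0 := det_genericPoint hF q hqK hh
  obtain ⟨b, hb⟩ := exists_adjugate_diag_ne_zero hT hdet
    (adjugate_genericPoint_ne_zero hF hns q hqK hi hFq hq)
  set P : Fin 4 → MvPolynomial (Fin 4) ℂ := X with hP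
  set φ : MvPolynomial (Fin 4) ℂ →ₐ[ℂ] K := IsScalarTower.toAlgHom ℂ _ K
  have hcP : algebraMap (MvPolynomial (Fin 4) ℂ) K ∘ P = x := rfl
  have hcb (a : Fin 4) : algebraMap (MvPolynomial (Fin 4) ℂ) K ∘ basisVec _ a = basisVec K a :=
    comp_basisVec φ a
  set u := kernelVec T x b
  have hu0 : u ≠ 0 := fun h => hb (congrFun h b)
  obtain ⟨g, hg⟩ := exists_functional_of_parabolic hT hN hxi hxx hu0 (apply_kernelVec hT hdet b)
  have hS : ({X i - 1, F, hessian F} : Set (MvPolynomial (Fin 4) ℂ)) ⊆ q := by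
    rintro _ (rfl | rfl | rfl) <;> assumption
  refine exists_mul_mem_span_of_finrank_tangent_le K q hqK _ hS
    ?_ f hf
  -- Three conditions on `y` in four variables: the normalization, tangency to the surface, and
  -- tangency to the Hessian in the form `T y u u = 0`.
  have h1 : Module.finrank K (tangent K ({X i - 1, F, hessian F} : Set (MvPolynomial (Fin 4) ℂ)))
      ≤ 1 := by
    refine (LinearMap.finrank_le_finrank_of_injective
      (f := g.comp (tangent K _).subtype) ?_).trans (Module.finrank_self K).le
    rw [injective_iff_map_eq_zero]
    rintro ⟨y, hy⟩ hL
    rw [mem_tangent] at hy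
    set D : Derivation ℂ (MvPolynomial (Fin 4) ℂ) K := mkDerivation ℂ y
    have hDP : D ∘ P = y := by
      ext a
      exact mkDerivation_X ℂ _ _
    have hDb (a : Fin 4) : D ∘ basisVec _ a = 0 := by
      ext c
      simp only [Function.comp_apply, Pi.single_apply, Pi.zero_apply]
      split_ifs <;> simp
    have hyi : y i = 0 := by
      have := hy _ (.inl rfl)
      rw [map_sub, Derivation.map_one_eq_zero, sub_zero] at this
      rw [← hDP]
      exact this
    have hxy : T x x y = 0 := by
      have h6 : D (cubicForm _ F P P P) = 0 := by
        rw [hP, ← six_mul_eq hF, Derivation.leibniz, hy _ (.inr (.inl rfl))]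
        have : D 6 = 0 := by
          rw [show (6 : MvPolynomial (Fin 4) ℂ) = algebraMap ℂ _ 6 from (map_ofNat _ 6).symm]
          exact D.map_algebraMap 6
        rw [this]
        simp
      rw [derivation_cubicForm_field, hDP, hcP, hT.left y x, hT.right x y x] at h6
      have h3 : (3 : K) * T x x y = 0 := by linear_combination h6
      simpa using h3
    -- Jacobi's formula for the Hessian, with the rank-one adjugate written through its column `u`.
    have hyu : T y u u = 0 := by
      have h7 := hy _ (.inr (.inr rfl))
      rw [hessian_eq_det hF, derivation_det, ← hP] at h7
      have hmap : (formMatrix (cubicForm _ F) P).map (algebraMap (MvPolynomial (Fin 4) ℂ) K) =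
          formMatrix T x := by
        ext c d
        change φ _ = _
        rw [formMatrix, Matrix.of_apply, map_cubicForm, comp_basisVec, comp_basisVec]
        rfl
      rw [hmap] at h7
      rw [← adjugate_mul_sum_adjugate hT hdet b y]
      refine mul_eq_zero_of_right _ (Eq.trans ?_ h7)
      refine Finset.sum_congr rfl fun c _ => Finset.sum_congr rfl fun d _ => ?_
      refine congrArg _ (Eq.symm ?_)
      change D (cubicForm _ F P (basisVec _ d) (basisVec _ c)) = _
      rw [derivation_cubicForm_field, hDP, hDb, hDb, hcb, hcb]
      simp [T]
    exact Subtype.ext (hg y hyi hxy hyu hL)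
  refine (add_le_add (Nat.cast_le.2 h1) hq).trans ?_
  rw [Fintype.card_fin]
  norm_num

end Surface

end CubicSurface

namespace BiProj

/-! ### Lengths of cokernels of exterior squares -/

section ExteriorSquare

variable {B M M' : Type*} [CommRing B] [AddCommGroup M] [Module B M] [AddCommGroup M'] [Module B M']
  (L : M' →ₗ[B] M)

lemma ιMulti_mem_range {a : Fin 2 → M} (h : ∀ n, a n ∈ LinearMap.range L) :
    exteriorPower.ιMulti B 2 a ∈ LinearMap.range (exteriorPower.map 2 L) := by
  choose b hb using h
  exact ⟨exteriorPower.ιMulti B 2 b, by rw [exteriorPower.map_apply_ιMulti]; congr; ext n; exact hb n⟩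

/-- The exterior square of multiplication by `δ` is multiplication by `δ ^ 2`. -/
lemma sq_smul_mem_range {δ : B} (h : ∀ m : M, δ • m ∈ LinearMap.range L) (y : ⋀[B]^2 M) :
    δ ^ 2 • y ∈ LinearMap.range (exteriorPower.map 2 L) := by
  have hy : y ∈ Submodule.span B (Set.range (exteriorPower.ιMulti B 2 (M := M))) := by
    rw [exteriorPower.ιMulti_span]; trivial
  induction hy using Submodule.span_induction with
  | mem y hy =>
    obtain ⟨a, rfl⟩ := hy
    have h1 : δ ^ 2 • exteriorPower.ιMulti B 2 a = exteriorPower.ιMulti B 2 (δ • a) := by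
      have := (exteriorPower.ιMulti B 2 (M := M)).map_smul_univ (fun _ => δ) a
      simp only [Finset.prod_const, Finset.card_univ, Fintype.card_fin] at this
      exact this.symm
    rw [h1]
    exact ιMulti_mem_range L fun n => h (a n)
  | zero => rw [smul_zero]; exact zero_mem _
  | add y z _ _ hy hz => rw [smul_add]; exact add_mem hy hz
  | smul b y _ hy => rw [smul_comm]; exact Submodule.smul_mem _ _ hy

/-- The alternating form `x ∧ y ↦ p x * q y - p y * q x`. -/
def wedgeForm {K : Type*} [CommRing K] [Algebra B K] (p q : M →ₗ[B] K) : M [⋀^Fin 2]→ₗ[B] K where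
  toFun v := p (v 0) * q (v 1) - p (v 1) * q (v 0)
  map_update_add' v n x y := by
    fin_cases n <;> simp [Function.update] <;> ring
  map_update_smul' v n r x := by
    fin_cases n <;> simp [Function.update, Algebra.smul_def] <;> ring
  map_eq_zero_of_eq' v a b h hab := by
    have h01 : v 0 = v 1 := by
      fin_cases a <;> fin_cases b <;> first | exact h | exact h.symm | exact absurd rfl hab
    rw [h01, sub_self]

/-- The alternating form `p ∧ q` vanishes on the image because `p` does on that of `L`, but it does
not vanish on `x ∧ y`. -/
lemma range_map_ne_top {K : Type*} [CommRing K] [Algebra B K] (p q : M →ₗ[B] K)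
    (hp : ∀ x, p (L x) = 0) {x y : M} (hxy : p x * q y - p y * q x ≠ 0) :
    LinearMap.range (exteriorPower.map 2 L) ≠ ⊤ := by
  intro h
  set Ω := exteriorPower.alternatingMapLinearEquiv (wedgeForm p q)
  have h1 (z) (hz : z ∈ LinearMap.range (exteriorPower.map 2 L)) : Ω z = 0 := by
    obtain ⟨t, rfl⟩ := hz
    have ht : t ∈ Submodule.span B (Set.range (exteriorPower.ιMulti B 2 (M := M'))) := by
      rw [exteriorPower.ιMulti_span]; trivial
    induction ht using Submodule.span_induction with
    | mem t ht =>
      obtain ⟨a, rfl⟩ := ht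
      rw [exteriorPower.map_apply_ιMulti, exteriorPower.alternatingMapLinearEquiv_apply_ιMulti]
      change p (L (a 0)) * q (L (a 1)) - p (L (a 1)) * q (L (a 0)) = 0
      rw [hp, hp, zero_mul, zero_mul, sub_self]
    | zero => simp
    | add y z _ _ hy hz => rw [map_add, map_add, hy, hz, add_zero]
    | smul b y _ hy => rw [map_smul, map_smul, hy, smul_zero]
  have h2 := h1 (exteriorPower.ιMulti B 2 ![x, y]) (by rw [h]; trivial)
  rw [exteriorPower.alternatingMapLinearEquiv_apply_ιMulti] at h2
  exact hxy h2

/-- A criterion for the cokernel of `⋀² L` to be simple. -/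
lemma length_coker_eq_one [IsLocalRing B] {δ : B} (hδ : IsLocalRing.maximalIdeal B = Ideal.span {δ})
    {e₁ e₂ : M} (he : Submodule.span B {e₁, e₂} = ⊤) (he₁ : δ • e₁ ∈ LinearMap.range L)
    (he₂ : e₂ ∈ LinearMap.range L) (hL : LinearMap.range (exteriorPower.map 2 L) ≠ ⊤) :
    Module.length B ((⋀[B]^2 M) ⧸ LinearMap.range (exteriorPower.map 2 L)) = 1 := by
  set N := LinearMap.range (exteriorPower.map 2 L)
  set c : (⋀[B]^2 M) ⧸ N := Submodule.Quotient.mk (exteriorPower.ιMulti B 2 ![e₁, e₂]) with hc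
  -- The exterior square of a module with two generators is cyclic.
  have hspan : Submodule.span B {exteriorPower.ιMulti B 2 ![e₁, e₂]} = ⊤ := by
    rw [eq_top_iff, ← exteriorPower.ιMulti_span_of_span B 2 M he, Submodule.span_le]
    rintro _ ⟨a, ha, rfl⟩
    have h (n : Fin 2) : a n = e₁ ∨ a n = e₂ := by
      have := ha ⟨n, rfl⟩
      simpa using this
    rw [SetLike.mem_coe, Submodule.mem_span_singleton]
    have ha2 : a = ![a 0, a 1] := by ext n; fin_cases n <;> rfl
    rcases h 0 with h0 | h0 <;> rcases h 1 with h1 | h1 <;> rw [ha2, h0, h1]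
    · refine ⟨0, ?_⟩
      rw [zero_smul]
      exact ((exteriorPower.ιMulti B 2 (M := M)).map_eq_zero_of_eq ![e₁, e₁] (i := 0) (j := 1) rfl
        (by decide)).symm
    · exact ⟨1, one_smul _ _⟩
    · refine ⟨-1, ?_⟩
      have := (exteriorPower.ιMulti B 2 (M := M)).map_swap ![e₁, e₂] (i := 0) (j := 1) (by decide)
      rw [neg_one_smul, ← this]
      congr 1
      ext n
      fin_cases n <;> simp
    · refine ⟨0, ?_⟩
      rw [zero_smul]
      exact ((exteriorPower.ιMulti B 2 (M := M)).map_eq_zero_of_eq ![e₂, e₂] (i := 0) (j := 1) rfl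
        (by decide)).symm
  have hsurj : Function.Surjective (LinearMap.toSpanSingleton B ((⋀[B]^2 M) ⧸ N) c) := by
    intro z
    obtain ⟨z, rfl⟩ := Submodule.Quotient.mk_surjective N z
    have hz : z ∈ Submodule.span B {exteriorPower.ιMulti B 2 ![e₁, e₂]} := by rw [hspan]; trivial
    obtain ⟨b, rfl⟩ := Submodule.mem_span_singleton.1 hz
    exact ⟨b, rfl⟩
  -- The annihilator of the generator of the cokernel contains `δ`, because `δ • e₁` and `e₂` both
  -- lie in the image of `L`; it is proper because the cokernel is nonzero.
  have hker : LinearMap.ker (LinearMap.toSpanSingleton B ((⋀[B]^2 M) ⧸ N) c) =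
      IsLocalRing.maximalIdeal B := by
    refine le_antisymm (IsLocalRing.le_maximalIdeal fun h => hL ?_) ?_
    · rw [eq_top_iff, ← hspan, Submodule.span_singleton_le_iff_mem]
      have h1 : (1 : B) ∈ LinearMap.ker (LinearMap.toSpanSingleton B ((⋀[B]^2 M) ⧸ N) c) := by
        rw [h]; trivial
      rw [LinearMap.mem_ker, LinearMap.toSpanSingleton_apply, one_smul, hc,
        Submodule.Quotient.mk_eq_zero] at h1
      exact h1
    · rw [hδ, Ideal.span_le, Set.singleton_subset_iff]
      change δ • c = 0
      rw [hc, ← Submodule.Quotient.mk_smul, Submodule.Quotient.mk_eq_zero]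
      have h1 : δ • exteriorPower.ιMulti B 2 ![e₁, e₂] =
          exteriorPower.ιMulti B 2 ![δ • e₁, e₂] := by
        have := (exteriorPower.ιMulti B 2 (M := M)).map_update_smul ![e₁, e₂] 0 δ e₁
        have h2 : Function.update ![e₁, e₂] 0 (δ • e₁) = ![δ • e₁, e₂] := by
          ext n; fin_cases n <;> rfl
        have h3 : Function.update ![e₁, e₂] 0 e₁ = ![e₁, e₂] := by
          ext n; fin_cases n <;> rfl
        rw [h2, h3] at this
        exact this.symm
      rw [h1]
      refine ιMulti_mem_range L fun n => ?_
      fin_cases n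
      exacts [he₁, he₂]
  rw [Module.length_eq_one_iff, isSimpleModule_iff_quot_maximal]
  refine ⟨_, IsLocalRing.maximalIdeal.isMaximal B, ⟨?_⟩⟩
  rw [← hker]
  exact (LinearMap.quotKerEquivOfSurjective _ hsurj).symm

/-- A finite module is generated by elements on which all functionals with values in the residue
field are determined. -/
lemma span_eq_top_of_forall_functional [IsLocalRing B] [Module.Finite B M] (P : Submodule B M)
    (h : ∀ p : M →ₗ[B] IsLocalRing.ResidueField B, (∀ x ∈ P, p x = 0) → p = 0) : P = ⊤ := by
  by_contra hP
  -- A proper `P` lies in a maximal submodule; the quotient by that is the residue field, and the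
  -- projection is a nonzero functional killing `P`.
  obtain ⟨Q, hQ, hPQ⟩ := (eq_top_or_exists_le_coatom P).resolve_left hP
  have hs := isSimpleModule_iff_isCoatom.2 hQ
  obtain ⟨m, hm, ⟨e⟩⟩ := isSimpleModule_iff_quot_maximal.1 hs
  obtain rfl := IsLocalRing.eq_maximalIdeal hm
  set p : M →ₗ[B] IsLocalRing.ResidueField B := e.toLinearMap ∘ₗ Q.mkQ
  have hp : p = 0 := h p fun x hx => by
    have : Q.mkQ x = 0 := by
      rw [Submodule.mkQ_apply, Submodule.Quotient.mk_eq_zero]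
      exact hPQ hx
    change e (Q.mkQ x) = 0
    rw [this, map_zero]
  refine hQ.1 (eq_top_iff.2 fun x _ => ?_)
  have h1 : e (Q.mkQ x) = 0 := LinearMap.congr_fun hp x
  rwa [e.map_eq_zero_iff, Submodule.mkQ_apply, Submodule.Quotient.mk_eq_zero] at h1

/-- The module is finite over `B ⧸ (a)`, which is Artinian because the maximal ideal is minimal over
`a`. -/
lemma length_ne_top_of_smul_eq_zero [IsLocalRing B] [IsNoetherianRing B] [Module.Finite B M]
    {a : B} (ha : IsLocalRing.maximalIdeal B ∈ (Ideal.span {a}).minimalPrimes)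
    (h : ∀ x : M, a • x = 0) : Module.length B M ≠ ⊤ := by
  have h1 : Module.IsTorsionBySet B M (Ideal.span {a} : Ideal B) := by
    rintro x ⟨b, hb⟩
    obtain ⟨r, rfl⟩ := Ideal.mem_span_singleton'.1 hb
    rw [mul_smul, h, smul_zero]
  let _ := h1.module
  have h2 : IsArtinianRing (B ⧸ Ideal.span {a}) :=
    IsLocalRing.quotient_artinian_of_mem_minimalPrimes_of_isLocalRing _ ha
  have h3 : IsScalarTower B (B ⧸ Ideal.span {a}) M := h1.isScalarTower
  have h4 : Module.Finite (B ⧸ Ideal.span {a}) M := Module.Finite.of_restrictScalars_finite B _ _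
  have h5 : IsArtinian B M := isArtinian_of_surjective_algebraMap (R := B ⧸ Ideal.span {a})
    (Ideal.Quotient.mk_surjective)
  exact Module.length_ne_top

end ExteriorSquare

/-- A Noetherian local ring with a principal maximal ideal which is not nilpotent is reduced. -/
lemma eq_zero_of_isNilpotent {A : Type*} [CommRing A] [IsLocalRing A] [IsNoetherianRing A] {δ : A}
    (hδ : IsLocalRing.maximalIdeal A = Ideal.span {δ}) (hn : ¬ IsNilpotent δ) {f : A}
    (hf : IsNilpotent f) : f = 0 := by
  by_contra h0
  -- By Krull's intersection theorem a nonzero `f` has a finite order, hence equals a unit times a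
  -- power of `δ`. If it is nilpotent, then so is `δ`.
  have h1 : ∃ n, f ∉ IsLocalRing.maximalIdeal A ^ n := by
    by_contra! h
    refine h0 ?_
    have h2 := Ideal.iInf_pow_eq_bot_of_isLocalRing (IsLocalRing.maximalIdeal A)
      Ideal.IsPrime.ne_top'
    rw [← Ideal.mem_bot, ← h2, Ideal.mem_iInf]
    exact h
  classical
  obtain ⟨n, hn1, hn2⟩ : ∃ n, f ∈ IsLocalRing.maximalIdeal A ^ n ∧
      f ∉ IsLocalRing.maximalIdeal A ^ (n + 1) := by
    have h2 := Nat.find_spec h1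
    rcases h3 : Nat.find h1 with _ | n
    · rw [h3, pow_zero, Ideal.one_eq_top] at h2
      exact absurd trivial h2
    · exact ⟨n, not_not.1 (Nat.find_min h1 (by lia)), h3 ▸ h2⟩
  rw [hδ, Ideal.span_singleton_pow, Ideal.mem_span_singleton'] at hn1 hn2
  obtain ⟨u, rfl⟩ := hn1
  have hu : IsUnit u := by
    by_contra hu
    have h2 : u ∈ IsLocalRing.maximalIdeal A := hu
    rw [hδ, Ideal.mem_span_singleton'] at h2
    obtain ⟨r, rfl⟩ := h2
    exact hn2 ⟨r, by ring⟩
  obtain ⟨m, hm⟩ := hf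
  rw [mul_pow, (hu.pow m).mul_right_eq_zero, ← pow_mul] at hm
  exact hn ⟨_, hm⟩

namespace Chart

variable {σ : Type} {w : σ → ℕ × ℕ} {I : Ideal (MvPolynomial σ ℂ)} {z : Point w I} (c : Chart z)

lemma derivation_eq_zero {W : Type*} [AddCommGroup W] [Module (localRing z) W] [Module ℂ W]
    (D : Derivation ℂ (localRing z) W)
    (h : ∀ s, D (c.eval (X s)) = 0) : D = 0 := by
  have h1 (f : MvPolynomial σ ℂ) : D (c.eval f) = 0 := by
    induction f using MvPolynomial.induction_on with
    | C a =>
      have : c.eval (C a) = algebraMap ℂ _ a := c.eval.commutes a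
      rw [this, D.map_algebraMap]
    | add f g hf hg => rw [map_add, map_add, hf, hg, add_zero]
    | mul_X f s hf => rw [map_mul, D.leibniz, hf, h, smul_zero, smul_zero, add_zero]
  ext x
  obtain ⟨f, g, hg, e⟩ := c.exists_eval_mul_eq x
  have h2 := h1 f
  rw [← e, D.leibniz, h1 g, smul_zero, zero_add] at h2
  exact (c.isUnit_eval_of_notMem hg).smul_eq_zero.1 h2

/-- The differentials of the coordinates span the module of differentials. -/
lemma eq_top_of_forall_D_mem (P : Submodule (localRing z) (Ω[localRing z⁄ℂ]))
    (h : ∀ s, KaehlerDifferential.D ℂ (localRing z) (c.eval (X s)) ∈ P) : P = ⊤ := by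
  have h1 := c.derivation_eq_zero (P.mkQ.compDer (KaehlerDifferential.D ℂ (localRing z)))
    fun s => (Submodule.Quotient.mk_eq_zero P).2 (h s)
  rw [eq_top_iff, ← KaehlerDifferential.span_range_derivation ℂ (localRing z), Submodule.span_le]
  rintro _ ⟨x, rfl⟩
  exact (Submodule.Quotient.mk_eq_zero P).1 (DFunLike.congr_fun h1 x)

include c in
lemma finite_kaehlerDifferential [Finite σ] :
    Module.Finite (localRing z) (Ω[localRing z⁄ℂ]) := by
  have h := c.eq_top_of_forall_D_mem (Submodule.span _ (Set.range fun s =>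
    KaehlerDifferential.D ℂ (localRing z) (c.eval (X s)))) fun s => Submodule.subset_span ⟨s, rfl⟩
  exact ⟨⟨(Set.finite_range _).toFinset, by rw [Set.Finite.coe_toFinset]; exact h⟩⟩

end Chart

end BiProj

namespace BiProj

/-! ### Derivations as homomorphisms to dual numbers -/

section DerivationAlgHom

variable {A K : Type*} [CommRing A] [Algebra ℂ A] [CommRing K] [Algebra ℂ K] [Algebra A K]
  [IsScalarTower ℂ A K]

/-- The homomorphism to the dual numbers given by a derivation. -/
def derivationAlgHom (D : Derivation ℂ A K) : A →ₐ[ℂ] TrivSqZeroExt K K where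
  toFun f := (algebraMap A K f, D f)
  map_one' := by ext <;> simp
  map_zero' := by ext <;> simp
  map_add' f g := by
    ext
    · exact map_add _ f g
    · exact map_add D f g
  map_mul' f g := by
    ext
    · exact map_mul _ f g
    · refine (D.leibniz f g).trans ?_
      rw [Algebra.smul_def, Algebra.smul_def]
      exact congrArg _ (mul_comm _ _)
  commutes' a := by
    ext
    · simp [TrivSqZeroExt.algebraMap_eq_inl', ← IsScalarTower.algebraMap_apply]
    · simp [TrivSqZeroExt.algebraMap_eq_inl']

lemma fst_derivationAlgHom (D : Derivation ℂ A K) (f : A) :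
    (derivationAlgHom D f).fst = algebraMap A K f := rfl

lemma snd_derivationAlgHom (D : Derivation ℂ A K) (f : A) : (derivationAlgHom D f).snd = D f := rfl

end DerivationAlgHom

namespace Chart

variable {σ : Type} {w : σ → ℕ × ℕ} {I : Ideal (MvPolynomial σ ℂ)} {z : Point w I} (c : Chart z)

/-- The residue field as an algebra over the polynomial ring. -/
abbrev residueAlgebra : Algebra (MvPolynomial σ ℂ) (IsLocalRing.ResidueField (localRing z)) :=
  ((algebraMap (localRing z) (IsLocalRing.ResidueField (localRing z))).comp
    c.eval.toRingHom).toAlgebra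

lemma residueAlgebra_isScalarTower :
    letI := c.residueAlgebra
    IsScalarTower ℂ (MvPolynomial σ ℂ) (IsLocalRing.ResidueField (localRing z)) := by
  let _ := c.residueAlgebra
  refine IsScalarTower.of_algebraMap_eq fun a => ?_
  change _ = algebraMap (localRing z) (IsLocalRing.ResidueField (localRing z)) (c.eval _)
  rw [c.eval.commutes, ← IsScalarTower.algebraMap_apply]

lemma residue_eval_eq_zero_iff (f : MvPolynomial σ ℂ) :
    algebraMap (localRing z) (IsLocalRing.ResidueField (localRing z)) (c.eval f) = 0 ↔
      f ∈ c.prime :=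
  IsLocalRing.residue_eq_zero_iff _

/-- Derivations of the polynomial ring which vanish on the equations descend to the local ring. -/
lemma exists_derivation (hI : I.IsHomogeneous (piece w)) {K : Type*} [CommRing K] [Algebra ℂ K]
    [Algebra (localRing z) K] [IsScalarTower ℂ (localRing z) K] [Algebra (MvPolynomial σ ℂ) K]
    [IsScalarTower ℂ (MvPolynomial σ ℂ) K]
    (hK : ∀ f, algebraMap (MvPolynomial σ ℂ) K f = algebraMap (localRing z) K (c.eval f))
    (D : Derivation ℂ (MvPolynomial σ ℂ) K) (hD : ∀ f ∈ I ⊔ c.ideal, D f = 0) :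
    ∃ D' : Derivation ℂ (localRing z) K, ∀ f, D' (c.eval f) = D f := by
  -- As homomorphisms to the dual numbers, derivations descend by the universal property of the
  -- local ring; an element outside `c.prime` becomes a unit since its first component is one.
  obtain ⟨ψ, hψ⟩ := c.exists_lift hI (derivationAlgHom D) (fun f hf => by
      ext
      · rw [fst_derivationAlgHom, hK, RingHom.mem_ker.1 (c.sup_le_ker_eval hI hf), map_zero]; rfl
      · rw [snd_derivationAlgHom, hD f hf]; rfl)
    (fun g hg => by
      rw [TrivSqZeroExt.isUnit_iff_isUnit_fst, fst_derivationAlgHom, hK]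
      exact (c.isUnit_eval_of_notMem hg).map _)
  have hψfst (x : localRing z) : (ψ x).fst = algebraMap _ K x := by
    obtain ⟨f, g, hg, e⟩ := c.exists_eval_mul_eq x
    refine ((c.isUnit_eval_of_notMem hg).map (algebraMap (localRing z) K)).mul_right_cancel ?_
    rw [← map_mul, e, ← hK f, ← hK g, ← fst_derivationAlgHom D f, ← fst_derivationAlgHom D g,
      ← hψ, ← hψ, ← e, map_mul, TrivSqZeroExt.fst_mul]
  refine ⟨Derivation.mk' ((TrivSqZeroExt.sndHom K K).restrictScalars ℂ ∘ₗ ψ.toLinearMap)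
    fun x y => ?_, fun f => ?_⟩
  · change (ψ (x * y)).snd = x • (ψ y).snd + y • (ψ x).snd
    rw [map_mul, TrivSqZeroExt.snd_mul, hψfst, hψfst, op_smul_eq_mul, smul_eq_mul,
      Algebra.smul_def, Algebra.smul_def, mul_comm (ψ x).snd]
  · change (ψ (c.eval f)).snd = D f
    rw [hψ, snd_derivationAlgHom]

end Chart

end BiProj

/-! ### The projection in coordinates -/

namespace CubicSurface

open BiProj

variable {F : MvPolynomial (Fin 4) ℂ} (hF : F.IsHomogeneous 3)
  {D : Point (twoWeight (Fin 4) Pair) (tripleContactIdeal F)} {i j : Fin 4}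
  (hi : pointCoord i ∉ D.ideal) (hj : pluckerMatrix lineCoord i j ∉ D.ideal)

include hi in
lemma X_notMem_proj : X i ∉ (proj (surfaceIdeal_le hF) D).ideal := by
  intro h
  refine hi ?_
  have h' : rename (Sum.inl : Fin 4 → Fin 4 ⊕ Pair) (X i : MvPolynomial (Fin 4) ℂ) ∈ D.ideal := h
  rwa [rename_X] at h'

/-- Both charts divide the point coordinates by the same coordinate `i`, so in charts the projection
is the inclusion of polynomial rings. -/
lemma ambientMap_ambientEval (f : MvPolynomial (Fin 4) ℂ) :
    ambientMap (surfaceIdeal_le hF) D ((pointChart _ (X_notMem_proj hF hi)).ambientEval f) =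
      (incidenceChart D hi hj).ambientEval (rename Sum.inl f) := by
  set c := incidenceChart D hi hj
  set c' := pointChart _ (X_notMem_proj hF hi)
  suffices h : (ambientMap (surfaceIdeal_le hF) D).comp c'.ambientEval.toRingHom =
      c.ambientEval.toRingHom.comp (rename Sum.inl).toRingHom from DFunLike.congr_fun h f
  refine ringHom_ext (fun r => ?_) fun a => ?_
  · change ambientMap _ D (c'.ambientEval (C r)) = c.ambientEval (rename Sum.inl (C r))
    rw [rename_C]
    have h1 : c'.ambientEval (C r) = algebraMap ℂ _ r := c'.ambientEval.commutes r
    have h2 : c.ambientEval (C r) = algebraMap ℂ _ r := c.ambientEval.commutes r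
    rw [h1, h2]
    apply HomogeneousLocalization.val_injective
    rw [val_ambientMap]
    change locMap (surfaceIdeal_le hF) D (algebraMap (MvPolynomial (Fin 4) ℂ) _ (C r)) =
      algebraMap IncidenceRing _ (C r)
    rw [locMap_algebraMap]
    congr 1
    exact rename_C _ r
  · change ambientMap _ D (c'.ambientEval (X a)) = c.ambientEval (rename Sum.inl (X a))
    rw [rename_X]
    apply HomogeneousLocalization.val_injective
    have h1 := c'.val_ambientEval_mul (d := (1, 0)) (f := X a) (isWeightedHomogeneous_X ℂ _ _)
    have h2 := c.val_ambientEval_mul (pointCoord_mem a)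
    have ht : c'.t (1, 0) = X i := pow_one _
    have ht' : c.t (1, 0) = pointCoord i := by simp [c, incidenceChart]
    have hu : IsUnit (algebraMap _ (Localization.AtPrime D.ideal) (pointCoord i)) :=
      IsLocalization.map_units (M := D.ideal.primeCompl) _ ⟨_, hi⟩
    refine hu.mul_right_cancel ?_
    rw [ht'] at h2
    change _ = (c.ambientEval (pointCoord a)).val * _
    rw [h2, val_ambientMap]
    have h3 := congrArg (locMap (surfaceIdeal_le hF) D) h1
    rw [map_mul, ht, locMap_algebraMap, locMap_algebraMap] at h3
    have h4 (b : Fin 4) : inclGraded (Fin 4) Pair (X b) = pointCoord b := rename_X _ _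
    rwa [h4, h4] at h3

lemma pullback_eval (f : MvPolynomial (Fin 4) ℂ) :
    pullback (surfaceIdeal_le hF) D ((pointChart _ (X_notMem_proj hF hi)).eval f) =
      (incidenceChart D hi hj).eval (rename Sum.inl f) :=
  congrArg (Ideal.Quotient.mk (localIdeal D)) (ambientMap_ambientEval hF hi hj f)

lemma mem_pointChart_prime_iff (f : MvPolynomial (Fin 4) ℂ) :
    f ∈ (pointChart _ (X_notMem_proj hF hi)).prime ↔
      rename Sum.inl f ∈ (incidenceChart D hi hj).prime := by
  rw [Chart.mem_prime, Chart.mem_prime, not_iff_not]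
  have h1 := Chart.isUnit_quotientMk ((incidenceChart D hi hj).ambientEval (rename Sum.inl f))
  have h2 := Chart.isUnit_quotientMk ((pointChart _ (X_notMem_proj hF hi)).ambientEval f)
  refine h2.trans (Iff.trans ?_ h1.symm)
  rw [← ambientMap_ambientEval hF hi hj, isUnit_map_iff (ambientMap (surfaceIdeal_le hF) D)]

end CubicSurface

namespace BiProj

lemma isUnit_ofNat_of_algebra (B : Type*) [CommRing B] [Algebra ℂ B] (n : ℕ) [n.AtLeastTwo] :
    IsUnit (OfNat.ofNat n : B) := by
  have h : IsUnit (OfNat.ofNat n : ℂ) := (OfNat.ofNat_ne_zero n).isUnit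
  have h1 := h.map (algebraMap ℂ B)
  rwa [map_ofNat] at h1

/-! ### The order of the Jacobian and the image of the differentials -/

section JacobianOrder

variable {A B : Type} [CommRing A] [CommRing B] [Algebra ℂ A] [Algebra ℂ B] (f : A →ₐ[ℂ] B)

/-- The image of the differentials of `A` in the differentials of `B`. -/
def differentialImage : Submodule B (Ω[B⁄ℂ]) :=
  Submodule.span B (Set.range fun a => KaehlerDifferential.D ℂ B (f a))

lemma range_mapBaseChange_eq :
    letI : Algebra A B := f.toRingHom.toAlgebra
    haveI : IsScalarTower ℂ A B := IsScalarTower.of_algebraMap_eq fun c => (f.commutes c).symm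
    LinearMap.range (KaehlerDifferential.mapBaseChange ℂ A B) = differentialImage f := by
  let _ : Algebra A B := f.toRingHom.toAlgebra
  have _ : IsScalarTower ℂ A B := IsScalarTower.of_algebraMap_eq fun c => (f.commutes c).symm
  refine le_antisymm ?_ ?_
  · rintro _ ⟨x, rfl⟩
    induction x using TensorProduct.induction_on with
    | zero => rw [map_zero]; exact zero_mem _
    | add x y hx hy => rw [map_add]; exact add_mem hx hy
    | tmul b y =>
      rw [KaehlerDifferential.mapBaseChange_tmul]
      refine Submodule.smul_mem _ _ ?_
      have hy : y ∈ Submodule.span A (Set.range (KaehlerDifferential.D ℂ A)) := by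
        rw [KaehlerDifferential.span_range_derivation]; trivial
      induction hy using Submodule.span_induction with
      | mem y hy =>
        obtain ⟨a, rfl⟩ := hy
        rw [KaehlerDifferential.map_D]
        exact Submodule.subset_span ⟨a, rfl⟩
      | zero => rw [map_zero]; exact zero_mem _
      | add x y _ _ hx hy => rw [map_add]; exact add_mem hx hy
      | smul a y _ hy =>
        rw [map_smul, ← algebraMap_smul B a]
        exact Submodule.smul_mem _ _ hy
  · rw [differentialImage, Submodule.span_le]
    rintro _ ⟨a, rfl⟩
    refine ⟨1 ⊗ₜ KaehlerDifferential.D ℂ A a, ?_⟩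
    rw [KaehlerDifferential.mapBaseChange_tmul, KaehlerDifferential.map_D, one_smul]
    rfl

lemma jacobianOrder_eq_zero {δ : B} (hδ : IsUnit δ)
    (h : ∀ m : Ω[B⁄ℂ], δ • m ∈ differentialImage f) : jacobianOrder f = 0 := by
  let _ : Algebra A B := f.toRingHom.toAlgebra
  have _ : IsScalarTower ℂ A B := IsScalarTower.of_algebraMap_eq fun c => (f.commutes c).symm
  refine Module.length_eq_zero_iff.2 ?_
  rw [Submodule.Quotient.subsingleton_iff, eq_top_iff]
  intro y _
  have h1 := sq_smul_mem_range (KaehlerDifferential.mapBaseChange ℂ A B) (δ := δ)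
    (fun m => by rw [range_mapBaseChange_eq f]; exact h m) y
  exact (Submodule.smul_mem_iff_of_isUnit _ (hδ.pow 2)).1 h1

lemma jacobianOrder_ne_top [IsLocalRing B] [IsNoetherianRing B] [Module.Finite B (Ω[B⁄ℂ])] {δ : B}
    (hδ : IsLocalRing.maximalIdeal B ∈ (Ideal.span {δ ^ 2}).minimalPrimes)
    (h : ∀ m : Ω[B⁄ℂ], δ • m ∈ differentialImage f) : jacobianOrder f ≠ ⊤ := by
  let _ : Algebra A B := f.toRingHom.toAlgebra
  have _ : IsScalarTower ℂ A B := IsScalarTower.of_algebraMap_eq fun c => (f.commutes c).symm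
  refine length_ne_top_of_smul_eq_zero hδ fun y => ?_
  obtain ⟨y, rfl⟩ := Submodule.Quotient.mk_surjective _ y
  rw [← Submodule.Quotient.mk_smul, Submodule.Quotient.mk_eq_zero]
  exact sq_smul_mem_range _ (fun m => by rw [range_mapBaseChange_eq f]; exact h m) y

lemma jacobianOrder_eq_one [IsLocalRing B] {K : Type*} [CommRing K] [Algebra B K] {δ : B}
    (hδ : IsLocalRing.maximalIdeal B = Ideal.span {δ})
    {e₁ e₂ : Ω[B⁄ℂ]} (he : Submodule.span B {e₁, e₂} = ⊤) (he₁ : δ • e₁ ∈ differentialImage f)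
    (he₂ : e₂ ∈ differentialImage f) (p q : Ω[B⁄ℂ] →ₗ[B] K)
    (hp : ∀ x ∈ differentialImage f, p x = 0) {x y : Ω[B⁄ℂ]} (hxy : p x * q y - p y * q x ≠ 0) :
    jacobianOrder f = 1 := by
  let _ : Algebra A B := f.toRingHom.toAlgebra
  have _ : IsScalarTower ℂ A B := IsScalarTower.of_algebraMap_eq fun c => (f.commutes c).symm
  refine length_coker_eq_one _ hδ he (by rwa [range_mapBaseChange_eq f])
    (by rwa [range_mapBaseChange_eq f]) (range_map_ne_top _ p q (fun x => hp _ ?_) hxy)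
  rw [← range_mapBaseChange_eq f]
  exact ⟨x, rfl⟩

end JacobianOrder

end BiProj

namespace CubicSurface

open BiProj

/-! ### Relative differentials are killed by `δ` -/

section Module

variable {F : MvPolynomial (Fin 4) ℂ} {B : Type*} [CommRing B] [Algebra ℂ B] {i j k l : Fin 4}
  {x v : Fin 4 → B} {W : Type*} [AddCommGroup W] [Module B W] [Module ℂ W] [IsScalarTower ℂ B W]

/-- With `x` constant, differentiating `T x x v = 0` and `T x v v = 0` gives two linear equations in
the differentials of `v k` and `v l`, since `v i` and `v j` are constant. Up to the unit 2 their
determinant is the minor, and Cramer's rule applies. -/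
lemma IsTripleContact.minor_smul_derivation_eq_zero (h : IsTripleContact (cubicForm B F) i j x v)
    (e : IsEnum i j k l) (Δ : Derivation ℂ B W) (hΔ : ∀ a, Δ (x a) = 0) (a : Fin 4) :
    minor (cubicForm B F) x v k l • Δ (v a) = 0 := by
  set T := cubicForm B F
  have hT : T.IsSymm := cubicForm_isSymm
  have hi : Δ (v i) = 0 := by rw [h.vi, map_zero]
  have hj : Δ (v j) = 0 := by rw [h.vj, Derivation.map_one_eq_zero]
  have h1 : T x x (basisVec B k) • Δ (v k) + T x x (basisVec B l) • Δ (v l) = 0 := by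
    have := derivation_cubicForm (F := F) Δ x x v
    change Δ (T x x v) = _ at this
    rw [h.xxv, map_zero] at this
    simp only [hΔ, smul_zero, zero_add] at this
    rw [e.sum_eq, hi, hj, smul_zero, smul_zero, zero_add, zero_add] at this
    exact this.symm
  have h2 : T x v (basisVec B k) • Δ (v k) + T x v (basisVec B l) • Δ (v l) = 0 := by
    have := derivation_cubicForm (F := F) Δ x v v
    change Δ (T x v v) = _ at this
    rw [h.xvv, map_zero] at this
    simp only [hΔ, smul_zero, zero_add, cubicForm_isSymm.right x (basisVec B _) v,
      Finset.sum_add_distrib] at this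
    rw [e.sum_eq, hi, hj, smul_zero, smul_zero, zero_add, zero_add, ← two_smul B] at this
    exact (isUnit_ofNat_of_algebra B 2).smul_eq_zero.1 this.symm
  rw [minor_eq]
  rcases e.cases a with rfl | rfl | rfl | rfl
  · rw [hi, smul_zero]
  · rw [hj, smul_zero]
  · have h3 : (T x x (basisVec B a) * T x v (basisVec B l) -
        T x x (basisVec B l) * T x v (basisVec B a)) • Δ (v a) =
        T x v (basisVec B l) • (T x x (basisVec B a) • Δ (v a) + T x x (basisVec B l) • Δ (v l)) -
        T x x (basisVec B l) • (T x v (basisVec B a) • Δ (v a) + T x v (basisVec B l) • Δ (v l)) := by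
      module
    rw [h3, h1, h2, smul_zero, smul_zero, sub_zero]
  · have h3 : (T x x (basisVec B k) * T x v (basisVec B a) -
        T x x (basisVec B a) * T x v (basisVec B k)) • Δ (v a) =
        T x x (basisVec B k) • (T x v (basisVec B k) • Δ (v k) + T x v (basisVec B a) • Δ (v a)) -
        T x v (basisVec B k) • (T x x (basisVec B k) • Δ (v k) + T x x (basisVec B a) • Δ (v a)) := by
      module
    rw [h3, h1, h2, smul_zero, smul_zero, sub_zero]

end Module

section Local

variable {F : MvPolynomial (Fin 4) ℂ} (hF : F.IsHomogeneous 3) (hns : IsNonsingular F)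
  {D : Point (twoWeight (Fin 4) Pair) (tripleContactIdeal F)} {i j k l : Fin 4}
  (hi : pointCoord i ∉ D.ideal) (hj : pluckerMatrix lineCoord i j ∉ D.ideal)
  (e : IsEnum i j k l)

include hF in
lemma eval_eq_zero_of_mem_chartEquations : ∀ f ∈ chartEquations F i j,
    (incidenceChart D hi hj).eval f = 0 := fun _ hf =>
  RingHom.mem_ker.1 ((incidenceChart D hi hj).sup_le_ker_eval (tripleContactIdeal_isHomogeneous F)
    (chartEquations_subset hi hj hF hf))

include hF in
lemma D_eval_pointCoord_mem (a : Fin 4) :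
    KaehlerDifferential.D ℂ (localRing D) ((incidenceChart D hi hj).eval (pointCoord a)) ∈
      differentialImage (pullback (surfaceIdeal_le hF) D) := by
  have h := pullback_eval hF hi hj (X a)
  rw [rename_X] at h
  exact Submodule.subset_span ⟨_, congrArg _ h⟩

include hF e in
-- Modulo the differentials of the point coordinates, `δ` kills those of the direction and hence
-- those of the line coordinates, which are wedges of the two.
lemma jacobian_smul_mem (m : Ω[localRing D⁄ℂ]) :
    (incidenceChart D hi hj).eval (jacobian F i k l) • m ∈
      differentialImage (pullback (surfaceIdeal_le hF) D) := by
  set c := incidenceChart D hi hj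
  set N := differentialImage (pullback (surfaceIdeal_le hF) D)
  set δ := c.eval (jacobian F i k l) with hδ
  obtain ⟨h, hq⟩ := isTripleContact_of_chartEquations c.eval
    (eval_eq_zero_of_mem_chartEquations hF hi hj)
  set Δ : Derivation ℂ (localRing D) (Ω[localRing D⁄ℂ] ⧸ N) :=
    N.mkQ.compDer (KaehlerDifferential.D ℂ (localRing D))
  have hx (a) : Δ ((c.eval ∘ pointCoord) a) = 0 :=
    (Submodule.Quotient.mk_eq_zero N).2 (D_eval_pointCoord_mem hF hi hj a)
  have hv (a) : δ • Δ (direction (c.eval ∘ lineCoord) i a) = 0 := by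
    rw [hδ, map_jacobian]
    exact h.minor_smul_derivation_eq_zero e Δ hx a
  have h0 : δ • Δ = 0 := by
    refine c.derivation_eq_zero _ fun s => ?_
    rw [Derivation.smul_apply]
    rcases s with a | p
    · exact (congrArg _ (hx a)).trans (smul_zero _)
    · have hp : c.eval (X (Sum.inr p)) = _ := congrFun hq p
      rw [hp, wedge, map_sub, Derivation.leibniz, Derivation.leibniz, hx, hx, smul_zero, smul_zero,
        add_zero, add_zero, smul_sub, smul_comm, hv, smul_comm, hv, smul_zero, smul_zero, sub_zero]
  have hm : m ∈ Submodule.span (localRing D)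
      (Set.range (KaehlerDifferential.D ℂ (localRing D))) := by
    rw [KaehlerDifferential.span_range_derivation]; trivial
  induction hm using Submodule.span_induction with
  | mem m hm =>
    obtain ⟨b, rfl⟩ := hm
    exact (Submodule.Quotient.mk_eq_zero N).1 (DFunLike.congr_fun h0 b)
  | zero => rw [smul_zero]; exact zero_mem _
  | add x y _ _ hx hy => rw [smul_add]; exact add_mem hx hy
  | smul b y _ hy => rw [smul_comm]; exact Submodule.smul_mem _ _ hy

include e in
lemma jacobianOrder_eq_zero_of_notMem (h : jacobian F i k l ∉ (incidenceChart D hi hj).prime) :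
    jacobianOrder (pullback (surfaceIdeal_le hF) D) = 0 :=
  jacobianOrder_eq_zero _ ((incidenceChart D hi hj).isUnit_eval_of_notMem h)
    (jacobian_smul_mem hF hi hj e)

lemma chartEquations_encard_le (i j : Fin 4) : (chartEquations F i j).encard ≤ (8 : ℕ) :=
  encard_chartEquations_le F i j

include hF in
lemma chartEquations_subset_comap (p : Ideal (localRing D)) :
    chartEquations F i j ⊆ p.comap (incidenceChart D hi hj).eval := fun f hf => by
  rw [SetLike.mem_coe, Ideal.mem_comap, eval_eq_zero_of_mem_chartEquations hF hi hj f hf]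
  exact zero_mem _

include hF hns e in
/-- The Hessian vanishes on no component of the variety of lines with triple contact. -/
lemma eq_maximalIdeal_of_hessian_mem (hD : IsPrimeDivisor D) (p : Ideal (localRing D)) [p.IsPrime]
    (hp : (incidenceChart D hi hj).eval (rename Sum.inl (hessian F)) ∈ p) :
    p = IsLocalRing.maximalIdeal (localRing D) := by
  refine (incidenceChart D hi hj).eq_maximalIdeal (tripleContactIdeal_isHomogeneous F)
    (chartEquations_subset hi hj hF) (sup_ideal_le_radical hi hj hF)
    (chartEquations_encard_le i j) hD p ?_
  have h := nine_le_height hF hns e (p.comap (incidenceChart D hi hj).eval)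
    (chartEquations_subset_comap hF hi hj p) hp
  exact lt_of_lt_of_le (by norm_num) h

include hns hi hj e in
-- The cokernel is killed by `δ ^ 2`, the pullback of the Hessian, which lies in no prime of the
-- local ring except the maximal one. This also covers divisors contracted to flat points, where the
-- exact order is not needed.
lemma jacobianOrder_pullback_ne_top (hD : IsPrimeDivisor D) :
    jacobianOrder (pullback (surfaceIdeal_le hF) D) ≠ ⊤ := by
  set c := incidenceChart D hi hj
  by_cases h : jacobian F i k l ∈ c.prime
  · have := c.isNoetherianRing_localRing
    have := c.finite_kaehlerDifferential
    refine jacobianOrder_ne_top _ (δ := c.eval (jacobian F i k l)) ?_ (jacobian_smul_mem hF hi hj e)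
    rw [← map_rename_hessian hF c.eval e (eval_eq_zero_of_mem_chartEquations hF hi hj)]
    refine ⟨⟨inferInstance, ?_⟩, fun p hp _ => ?_⟩
    · rw [Ideal.span_le, Set.singleton_subset_iff,
        map_rename_hessian hF c.eval e (eval_eq_zero_of_mem_chartEquations hF hi hj)]
      exact Ideal.pow_mem_of_mem (IsLocalRing.maximalIdeal (localRing D)) h 2 (by norm_num)
    · have := hp.1
      rw [eq_maximalIdeal_of_hessian_mem hF hns hi hj e hD p
        (hp.2 (Ideal.mem_span_singleton_self _))]
  · rw [jacobianOrder_eq_zero_of_notMem hF hi hj e h]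
    exact ENat.zero_ne_top

end Local

end CubicSurface

/-! ### Reducedness of the chart equations at a parabolic divisor -/

/-- In a ring which is, up to nilpotents, one-dimensional and regular, the equations are reduced. -/
lemma Ideal.exists_mul_mem_span_of_mem_radical {R : Type*} [CommRing R] [IsNoetherianRing R]
    (q : Ideal R) [q.IsPrime] {S : Set R} (hS : S ⊆ q) {n : ℕ} (hn : S.encard ≤ n)
    (hq : n < q.height) {δ : R} (hδ : δ ∈ q)
    (h : ∀ f ∈ q, ∃ s ∉ q, s * f ∈ Ideal.span (insert δ S)) {f : R}
    (hf : f ∈ (Ideal.span S).radical) : ∃ s ∉ q, s * f ∈ Ideal.span S := by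
  set L := Localization.AtPrime q
  set J : Ideal L := (Ideal.span S).map (algebraMap R L)
  have hmem (g : R) : algebraMap R L g ∈ J ↔ ∃ s ∉ q, s * g ∈ Ideal.span S := by
    rw [IsLocalization.algebraMap_mem_map_algebraMap_iff q.primeCompl]
    rfl
  have hJq : J ≤ IsLocalRing.maximalIdeal L := by
    rw [Ideal.map_le_iff_le_comap, Ideal.span_le]
    intro g hg
    exact (IsLocalization.AtPrime.to_map_mem_maximal_iff L q g).2 (hS hg)
  have : Nontrivial (L ⧸ J) := Ideal.Quotient.nontrivial_iff.2 fun h0 => by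
    rw [h0, top_le_iff] at hJq
    exact Ideal.IsPrime.ne_top' hJq
  have : IsLocalRing (L ⧸ J) :=
    IsLocalRing.of_surjective' (Ideal.Quotient.mk J) Ideal.Quotient.mk_surjective
  set π : R →+* L ⧸ J := (Ideal.Quotient.mk J).comp (algebraMap R L) with hπ
  have hπ0 (g : R) : π g = 0 ↔ ∃ s ∉ q, s * g ∈ Ideal.span S := by
    rw [← hmem, hπ, RingHom.comp_apply, Ideal.Quotient.eq_zero_iff_mem]
  have hu (s : R) (hs : s ∉ q) : IsUnit (π s) :=
    (IsLocalization.map_units L (⟨s, hs⟩ : q.primeCompl)).map (Ideal.Quotient.mk J)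
  have hπδ (g : R) (hg : g ∈ q) : π g ∈ Ideal.span {π δ} := by
    obtain ⟨s, hs, hsg⟩ := h g hg
    rw [Ideal.mem_span_insert] at hsg
    obtain ⟨a, t, ht, e⟩ := hsg
    have ht0 : π t = 0 := (hπ0 t).2 ⟨1, fun h1 => Ideal.IsPrime.ne_top' ((Ideal.eq_top_iff_one q).2 h1),
      by rwa [one_mul]⟩
    have := congrArg π e
    rw [map_mul, map_add, map_mul, ht0, add_zero] at this
    rw [← Ideal.unit_mul_mem_iff_mem _ (hu s hs), this]
    exact Ideal.mul_mem_left _ _ (Ideal.mem_span_singleton_self _)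
  -- The quotient `L ⧸ J` has its maximal ideal generated by `δ`, so it is reduced unless `δ` is
  -- nilpotent.
  have hmax : IsLocalRing.maximalIdeal (L ⧸ J) = Ideal.span {π δ} := by
    refine le_antisymm ?_ ?_
    · intro y hy
      obtain ⟨z, rfl⟩ := Ideal.Quotient.mk_surjective y
      have hz : z ∈ IsLocalRing.maximalIdeal L := fun h0 => hy (h0.map (Ideal.Quotient.mk J))
      rw [← Localization.AtPrime.map_eq_maximalIdeal] at hz
      have : Ideal.map (algebraMap R L) q ≤ (Ideal.span {π δ}).comap (Ideal.Quotient.mk J) := by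
        rw [Ideal.map_le_iff_le_comap]
        exact fun g hg => hπδ g hg
      exact this hz
    · rw [Ideal.span_le, Set.singleton_subset_iff]
      intro h0
      have h1 := h0.map (Ideal.Quotient.lift J (IsLocalRing.residue L) fun a ha =>
        (IsLocalRing.residue_eq_zero_iff a).2 (hJq ha))
      rw [hπ, RingHom.comp_apply, Ideal.Quotient.lift_mk, (IsLocalRing.residue_eq_zero_iff _).2
        ((IsLocalization.AtPrime.to_map_mem_maximal_iff L q δ).2 hδ)] at h1
      exact not_isUnit_zero h1
  -- If `δ` were nilpotent, `q` would be minimal over `S`, and Krull's theorem would bound its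
  -- height by `n`.
  have hnil : ¬ IsNilpotent (π δ) := by
    rintro ⟨m, hm⟩
    rw [← map_pow, hπ0] at hm
    obtain ⟨s, hs, hsm⟩ := hm
    have hmin : q ∈ (Ideal.span S).minimalPrimes := by
      refine ⟨⟨inferInstance, Ideal.span_le.2 hS⟩, fun p ⟨hp, hSp⟩ hpq g hg => ?_⟩
      have hδp : δ ∈ p := hp.mem_of_pow_mem m ((hp.mem_or_mem (hSp hsm)).resolve_left
        fun h0 => hs (hpq h0))
      obtain ⟨t, ht, htg⟩ := h g hg
      refine (hp.mem_or_mem (Ideal.span_le.2 ?_ htg)).resolve_left fun h0 => ht (hpq h0)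
      exact Set.insert_subset hδp (Ideal.span_le.1 hSp)
    have hfin : S.Finite := Set.finite_of_encard_le_coe hn
    have h1 : q.height ≤ S.encard := by
      have := Ideal.height_le_card_of_mem_minimalPrimes_span hfin hmin
      rwa [hfin.encard_eq_coe] 
    exact absurd hq (not_lt.2 (h1.trans hn))
  rw [← hπ0]
  refine BiProj.eq_zero_of_isNilpotent hmax hnil ?_
  obtain ⟨m, hm⟩ := hf
  exact ⟨m, by rw [← map_pow, hπ0]; exact ⟨1, fun h1 => Ideal.IsPrime.ne_top' ((Ideal.eq_top_iff_one q).2 h1), by rwa [one_mul]⟩⟩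

lemma Derivation.eq_zero_of_mul_mem_span {R K : Type*} [CommRing R] [Algebra ℂ R] [Field K]
    [Algebra ℂ K] [Algebra R K] [IsScalarTower ℂ R K] (D : Derivation ℂ R K) {S : Set R}
    (hS : ∀ f ∈ S, algebraMap R K f = 0) (hD : ∀ f ∈ S, D f = 0) {s f : R}
    (hs : algebraMap R K s ≠ 0) (hf : algebraMap R K f = 0) (h : s * f ∈ Ideal.span S) :
    D f = 0 := by
  have key : ∀ g ∈ Ideal.span S, D g = 0 ∧ algebraMap R K g = 0 := fun g hg => by
    induction hg using Submodule.span_induction with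
    | mem g hg => exact ⟨hD g hg, hS g hg⟩
    | zero => simp
    | add a b _ _ ha hb => simp [ha, hb]
    | smul a g _ hg => simp [Algebra.smul_def, hg]
  have h1 := (key _ h).1
  rw [Derivation.leibniz, Algebra.smul_def, Algebra.smul_def, hf, zero_mul, add_zero] at h1
  exact (mul_eq_zero.1 h1).resolve_left hs

namespace CubicSurface

open BiProj

/-! ### Deformations of a line with triple contact at a parabolic point -/

section Parabolic

variable {K : Type*} [Field K] {T : Trilinear K} {i j k l : Fin 4} {x v : Fin 4 → K}
  (h : IsTripleContact T i j x v) (e : IsEnum i j k l) (hT : T.IsSymm) (hN : T.IsNondegenerate)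

include h e hN in
lemma IsTripleContact.tangentVec_ne_zero : tangentVec T x k l ≠ 0 := fun h0 => by
  have hk := congrFun h0 k
  have hl := congrFun h0 l
  simp only [tangentVec, Pi.sub_apply, Pi.smul_apply, smul_eq_mul, Pi.single_eq_same,
    Pi.single_eq_of_ne e.kl, Pi.single_eq_of_ne e.kl.symm, Pi.zero_apply, mul_zero, mul_one,
    sub_zero, zero_sub, neg_eq_zero] at hk hl
  exact (h.gradient_ne_zero e hN).elim (· hl) (· hk)

include h e hT hN in
/-- The form of a cubic surface restricted to the tangent plane has rank one at the parabolic
points where the Hessian matrix has rank three. -/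
lemma IsTripleContact.secondForm_ne_zero (hm : minor T x v k l = 0)
    (hadj : (formMatrix T x).adjugate ≠ 0) :
    T x (tangentVec T x k l) (tangentVec T x k l) ≠ 0 := fun hw => by
  set w := tangentVec T x k l with hwdef
  have hdet : (formMatrix T x).det = 0 := by
    rw [det_formMatrix_eq_sq hT e h.xi h.vi h.vj h.xxx h.xxv h.xvv, hm]
    simp
  obtain ⟨b, hb⟩ := exists_adjugate_diag_ne_zero hT hdet hadj
  obtain ⟨c, hc⟩ := h.exists_eq_mul e hT hN hm
  have hgw : T x x w = 0 := apply_tangentVec T x k l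
  -- If the form also vanished on `w`, then `T x w` would vanish on the whole tangent plane and be a
  -- multiple of `T x x`, just like `T x v`.
  obtain ⟨c', hc'⟩ : ∃ c', ∀ z, T x w z = c' * T x x z := exists_eq_mul_of_ker_le fun z hz => by
    obtain ⟨r, hr⟩ := h.exists_eq_combination e hN hz
    rw [hr]
    simp only [map_add, map_smul, smul_eq_mul]
    rw [hT.right x w x, hT.right x w v, hc, hgw, hw]
    simp
  -- Hence `v - c • x` and `w - c' • x` both lie in the kernel of the Hessian matrix, which is
  -- one-dimensional as the adjugate is nonzero.
  have hker (y : Fin 4 → K) (r : K) (hy : ∀ z, T x y z = r * T x x z) (a : Fin 4) :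
      (formMatrix T x).adjugate b b * (y a - r * x a) =
        (y b - r * x b) * (formMatrix T x).adjugate a b := by
    refine adjugate_mul_comm_of_mulVec_eq_zero (y := fun a => y a - r * x a) ?_ b b a
    have hyr : (fun a => y a - r * x a) = y - r • x := rfl
    ext d
    rw [hyr, formMatrix_mulVec, hT.right x, map_sub, LinearMap.sub_apply, hy, map_smul,
      LinearMap.smul_apply, smul_eq_mul, sub_self, Pi.zero_apply]
  have h1 := hker v c hc
  have h2 := hker w c' hc'
  have hwi : w i = 0 := tangentVec_i e
  have hwj : w j = 0 := tangentVec_j e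
  have h1i := h1 i
  have h1j := h1 j
  have h2i := h2 i
  have h2j := h2 j
  rw [h.vi, h.xi] at h1i
  rw [hwi, h.xi] at h2i
  rw [h.vj] at h1j
  rw [hwj] at h2j
  -- In the coordinates `i` and `j` the vectors `x`, `v`, `w` are `(1, x j)`, `(0, 1)` and `(0, 0)`.
  -- Two multiples of a single kernel vector can have these shapes only if the second one is zero.
  have hwb : w b - c' * x b = 0 := by
    have : (formMatrix T x).adjugate b b * (w b - c' * x b) = 0 := by
      linear_combination (w b - c' * x b) * h1j - (v b - c * x b) * h2j -
        x j * (w b - c' * x b) * h1i + x j * (v b - c * x b) * h2i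
    exact (mul_eq_zero.1 this).resolve_left hb
  have hz (a) : w a - c' * x a = 0 := by
    have := h2 a
    rw [hwb, zero_mul] at this
    exact (mul_eq_zero.1 this).resolve_left hb
  have hc0 : c' = 0 := by
    have := hz i
    rw [hwi, h.xi] at this
    linear_combination -this
  refine h.tangentVec_ne_zero e hN (funext fun a => ?_)
  have := hz a
  rwa [hc0, zero_mul, sub_zero] at this

include h e hT hN in
/-- The deformations of a line with triple contact at a parabolic point. -/
lemma IsTripleContact.exists_deformation (hm : minor T x v k l = 0) :
    ∃ (y₀ : Fin 4 → K) (a b : Fin 4), y₀ a ≠ 0 ∧ tangentVec T x k l b ≠ 0 ∧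
      IsDeformation T i j x v y₀ 0 ∧ IsDeformation T i j x v 0 (tangentVec T x k l) ∧
      ∀ y u, IsDeformation T i j x v y u → y a = 0 → u b = 0 → y = 0 ∧ u = 0 := by
  set w := tangentVec T x k l with hwdef
  obtain ⟨c, hc⟩ := h.exists_eq_mul e hT hN hm
  have hgw : T x x w = 0 := apply_tangentVec T x k l
  have hwi : w i = 0 := tangentVec_i e
  have hwj : w j = 0 := tangentVec_j e
  have hx0 : x ≠ 0 := fun h0 => by simpa [h0] using h.xi
  obtain ⟨b, hb⟩ := Function.ne_iff.1 (h.tangentVec_ne_zero e hN)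
  have hg : T x x ≠ 0 := fun h0 => hx0 (hN.ne_zero x fun z => by rw [h0]; rfl)
  have hvx : T v v x = 0 := by rw [hT.right, hT.left, h.xvv]
  obtain ⟨f, hf⟩ := exists_functional_of_not_proportional (φ := T x x) (ψ := T v v) h.xi h.xxx
    hvx hg fun c' hc' => by
      obtain ⟨r, hr⟩ := hN.pencil x v c c' hx0 hc hc'
      have h1 := congrFun hr i
      have h3 := congrFun hr j
      simp only [Pi.smul_apply, smul_eq_mul, h.vi, h.vj, h.xi, mul_one] at h1 h3
      rw [← h1, zero_mul] at h3
      exact one_ne_zero h3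
  -- Three linear conditions in four variables have a nonzero solution. By the functional `f` it
  -- spans the space of solutions, so `y a` and `u b` are coordinates on the plane of deformations:
  -- `Y` has a two-dimensional tangent space here.
  obtain ⟨y₀, hy₀, hy0⟩ : ∃ y₀ : Fin 4 → K, y₀ i = 0 ∧ T x x y₀ = 0 ∧ T v v y₀ = 0 ∧ y₀ ≠ 0 := by
    have := LinearMap.ker_ne_bot_of_finrank_lt
      (f := (LinearMap.pi ![LinearMap.proj i, T x x, T v v] : (Fin 4 → K) →ₗ[K] (Fin 3 → K)))
      (by simp)
    obtain ⟨y₀, hy, hy0⟩ := Submodule.exists_mem_ne_zero_of_ne_bot this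
    have hy' (n : Fin 3) := congrFun (LinearMap.mem_ker.1 hy) n
    exact ⟨y₀, hy' 0, hy' 1, hy' 2, hy0⟩
  obtain ⟨hxxy, hvvy, hy0⟩ := hy0
  obtain ⟨a, ha⟩ := Function.ne_iff.1 hy0
  have hf0 : f y₀ ≠ 0 := fun h0 => hy0 (hf y₀ hy₀ hxxy hvvy h0)
  refine ⟨y₀, a, b, ha, hb, ⟨hy₀, rfl, rfl, hxxy, by simp [hc, hxxy], by simp [hvvy]⟩,
    ⟨rfl, hwi, hwj, by simp, by simp [hgw], by simp [hc, hgw]⟩, fun y u hyu hya hub => ?_⟩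
  have hxxu : T x x u = 0 := by
    have := hyu.xvy
    rwa [hc, hyu.xxy, mul_zero, mul_zero, zero_add] at this
  have hvv : T v v y = 0 := by
    have := hyu.vvy
    rwa [hc, hxxu, mul_zero, mul_zero, add_zero] at this
  constructor
  · have h0 : y - (f y / f y₀) • y₀ = 0 := by
      refine hf _ ?_ ?_ ?_ ?_
      · simp [hyu.yi, hy₀]
      · simp [hyu.xxy, hxxy]
      · simp [hvv, hvvy]
      · simp [hf0]
    have h1 := congrFun h0 a
    simp only [Pi.sub_apply, Pi.smul_apply, smul_eq_mul, hya, zero_sub, Pi.zero_apply,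
      neg_eq_zero] at h1
    rwa [(mul_eq_zero.1 h1).resolve_right ha, zero_smul, sub_zero] at h0
  · obtain ⟨r, hr⟩ := h.exists_eq_combination e hN hxxu
    rw [hyu.ui, hyu.uj, zero_mul, sub_zero, zero_smul, zero_smul, zero_add, zero_add] at hr
    have h1 := congrFun hr b
    rw [hub, Pi.smul_apply, smul_eq_mul] at h1
    rw [hr, (mul_eq_zero.1 h1.symm).resolve_right hb, zero_smul]

end Parabolic

/-! ### Derivations attached to deformations -/

section Derivation

variable {F : MvPolynomial (Fin 4) ℂ} {K : Type*} [Field K] [Algebra ℂ K]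
  [Algebra IncidenceRing K] [IsScalarTower ℂ IncidenceRing K] {i j : Fin 4}

/-- The derivation of the ring of coordinates given by a deformation of a line. -/
def deformationDerivation (i : Fin 4) (y u : Fin 4 → K) : Derivation ℂ IncidenceRing K :=
  mkDerivation ℂ (Sum.elim y (wedge y (algebraMap _ K ∘ direction lineCoord i) +
    wedge (algebraMap _ K ∘ pointCoord) u))

lemma deformationDerivation_comp_pointCoord (i : Fin 4) (y u : Fin 4 → K) :
    deformationDerivation i y u ∘ pointCoord = y := by
  ext a
  exact mkDerivation_X ℂ _ _

lemma deformationDerivation_comp_lineCoord (i : Fin 4) (y u : Fin 4 → K) :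
    deformationDerivation i y u ∘ lineCoord =
      wedge y (algebraMap _ K ∘ direction lineCoord i) +
        wedge (algebraMap _ K ∘ pointCoord) u := by
  ext a
  exact mkDerivation_X ℂ _ _

variable (hK : ∀ f ∈ chartEquations F i j, algebraMap IncidenceRing K f = 0)

include hK in
lemma deformationDerivation_comp_direction {y u : Fin 4 → K} (hy : y i = 0) (hu : u i = 0) :
    deformationDerivation i y u ∘ direction lineCoord i = u := by
  obtain ⟨h, -⟩ := isTripleContact_of_chartEquations
    (IsScalarTower.toAlgHom ℂ IncidenceRing K) hK
  have hxi : algebraMap IncidenceRing K (pointCoord i) = 1 := h.xi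
  have hvi : algebraMap IncidenceRing K (direction lineCoord i i) = 0 := by
    rw [direction, pluckerMatrix_self, map_zero]
  rw [derivation_comp_direction, deformationDerivation_comp_lineCoord, direction_add,
    direction_wedge, direction_wedge, hy, hu, Function.comp_apply, Function.comp_apply, hxi, hvi]
  simp

include hK in
-- Converse of `isDeformation_of_derivation`: the incidence equations hold by the product rule for
-- `wedge`, and the contact equations are those of the deformation.
lemma deformationDerivation_eq_zero {y u : Fin 4 → K}
    (h : IsDeformation (cubicForm K F) i j (algebraMap _ K ∘ pointCoord)
      (algebraMap _ K ∘ direction lineCoord i) y u) :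
    ∀ f ∈ chartEquations F i j, deformationDerivation i y u f = 0 := by
  set D := deformationDerivation i y u
  have hDx : D ∘ pointCoord = y := deformationDerivation_comp_pointCoord i y u
  have hDv : D ∘ direction lineCoord i = u := deformationDerivation_comp_direction hK h.yi h.ui
  have hT : (cubicForm K F).IsSymm := cubicForm_isSymm
  obtain ⟨hc, -⟩ := isTripleContact_of_chartEquations
    (IsScalarTower.toAlgHom ℂ IncidenceRing K) hK
  have hxi : algebraMap IncidenceRing K (pointCoord i) = 1 := hc.xi
  have hDi : D (pointCoord i) = 0 := (congrFun hDx i).trans h.yi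
  rintro _ ((⟨rfl | rfl⟩ | ⟨n, rfl⟩) | ⟨p, hp, rfl⟩)
  · rw [map_sub, Derivation.map_one_eq_zero, sub_zero, hDi]
  · rw [map_sub, Derivation.map_one_eq_zero, sub_zero]
    exact (congrFun hDv j).trans h.uj
  · set x := algebraMap IncidenceRing K ∘ pointCoord
    set v := algebraMap IncidenceRing K ∘ direction lineCoord i
    fin_cases n
    · change D (cubicForm _ F pointCoord pointCoord pointCoord) = 0
      rw [derivation_cubicForm_field, hDx, hT.left y, hT.right x y, h.xxy]
      simp
    · change D (cubicForm _ F pointCoord pointCoord (direction lineCoord i)) = 0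
      rw [derivation_cubicForm_field, hDx, hDv, hT.left y, hT.right x y]
      linear_combination h.xvy
    · change D (cubicForm _ F pointCoord (direction lineCoord i) (direction lineCoord i)) = 0
      rw [derivation_cubicForm_field, hDx, hDv, hT.left y, hT.right v y, hT.right x u]
      linear_combination h.vvy
  · have hl := congrFun (deformationDerivation_comp_lineCoord i y u) p
    have h1 (a) : D (pointCoord a) = y a := congrFun hDx a
    have h2 (a) : D (direction lineCoord i a) = u a := congrFun hDv a
    change D (lineCoord p) = _ at hl
    rw [incidence, map_sub, map_sub, Derivation.leibniz, Derivation.leibniz,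
      Derivation.leibniz, hDi, hl, h1, h1, h2, h2]
    simp only [Algebra.smul_def, hxi, Pi.add_apply, wedge, Function.comp_apply]
    ring

end Derivation

end CubicSurface

namespace BiProj.Chart

variable {σ : Type} {w : σ → ℕ × ℕ} {I : Ideal (MvPolynomial σ ℂ)} {z : Point w I} (c : Chart z)

/-- The derivation of the polynomial ring induced by a derivation of the local ring. -/
def compEval {K : Type*} [CommRing K] [Algebra ℂ K] [Algebra (localRing z) K]
    [Algebra (MvPolynomial σ ℂ) K]
    (hK : ∀ f, algebraMap (MvPolynomial σ ℂ) K f = algebraMap (localRing z) K (c.eval f))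
    (D : Derivation ℂ (localRing z) K) : Derivation ℂ (MvPolynomial σ ℂ) K :=
  Derivation.mk' (D.toLinearMap ∘ₗ c.eval.toLinearMap) fun a b => by
    change D (c.eval (a * b)) = a • D (c.eval b) + b • D (c.eval a)
    simp only [map_mul, Derivation.leibniz, Algebra.smul_def, hK]

lemma maximalIdeal_eq_span_of_forall {S : Set (MvPolynomial σ ℂ)} (hS : ∀ f ∈ S, c.eval f = 0)
    {δ : MvPolynomial σ ℂ} (hδ : δ ∈ c.prime)
    (h : ∀ f ∈ c.prime, ∃ s ∉ c.prime, s * f ∈ Ideal.span (insert δ S)) :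
    IsLocalRing.maximalIdeal (localRing z) = Ideal.span {c.eval δ} := by
  refine le_antisymm (fun b hb => ?_) ?_
  · obtain ⟨f, g, hg, hfg⟩ := c.exists_eval_mul_eq b
    have hf : f ∈ c.prime := by
      change c.eval f ∈ IsLocalRing.maximalIdeal (localRing z)
      rw [← hfg]
      exact Ideal.mul_mem_right _ _ hb
    obtain ⟨s, hs, hsf⟩ := h f hf
    have h1 : Ideal.span (insert δ S) ≤ (Ideal.span {c.eval δ}).comap c.eval := by
      rw [Ideal.span_le]
      rintro f (rfl | hf)
      · exact Ideal.mem_span_singleton_self _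
      · rw [SetLike.mem_coe, Ideal.mem_comap, hS f hf]
        exact zero_mem _
    have h2 := h1 hsf
    rw [Ideal.mem_comap, map_mul, ← hfg,
      Ideal.unit_mul_mem_iff_mem _ (c.isUnit_eval_of_notMem hs), mul_comm,
      Ideal.unit_mul_mem_iff_mem _ (c.isUnit_eval_of_notMem hg)] at h2
    exact h2
  · rw [Ideal.span_le, Set.singleton_subset_iff]
    exact hδ

end BiProj.Chart

namespace CubicSurface

open BiProj

/-! ### The Jacobian vanishes to order one at a parabolic divisor -/

section Order

variable {F : MvPolynomial (Fin 4) ℂ} (hF : F.IsHomogeneous 3) (hns : IsNonsingular F)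
  {D : Point (twoWeight (Fin 4) Pair) (tripleContactIdeal F)} {i j k l : Fin 4}
  (hi : pointCoord i ∉ D.ideal) (hj : pluckerMatrix lineCoord i j ∉ D.ideal)
  (e : IsEnum i j k l)
  {K : Type*} [Field K] [Algebra ℂ K] [Algebra (localRing D) K] [IsScalarTower ℂ (localRing D) K]
  [Algebra IncidenceRing K] [IsScalarTower ℂ IncidenceRing K]
  (hK : ∀ f, algebraMap IncidenceRing K f =
    algebraMap (localRing D) K ((incidenceChart D hi hj).eval f))

omit [IsScalarTower ℂ (localRing D) K] [Algebra IncidenceRing K]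
  [IsScalarTower ℂ IncidenceRing K] in
include hF in
/-- Derivations of the coordinates of the surface. -/
lemma derivation_pullback_eq_zero (Δ : Derivation ℂ (localRing D) K)
    (h : ∀ a, Δ ((incidenceChart D hi hj).eval (pointCoord a)) = 0)
    (a : localRing (proj (surfaceIdeal_le hF) D)) : Δ (pullback (surfaceIdeal_le hF) D a) = 0 := by
  set c := incidenceChart D hi hj
  set c' := pointChart _ (X_notMem_proj hF hi)
  have h1 (f : MvPolynomial (Fin 4) ℂ) : Δ (c.eval (rename Sum.inl f)) = 0 := by
    induction f using MvPolynomial.induction_on with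
    | C r =>
      rw [rename_C, ← algebraMap_eq, AlgHom.commutes, Derivation.map_algebraMap]
    | add f g hf hg => rw [map_add, map_add, map_add, hf, hg, add_zero]
    | mul_X f a hf =>
      rw [map_mul, map_mul, Derivation.leibniz, hf, rename_X, smul_zero, add_zero]
      exact (congrArg _ (h a)).trans (smul_zero _)
  obtain ⟨f, g, hg, hfg⟩ := c'.exists_eval_mul_eq a
  have h2 := congrArg (fun b => Δ (pullback (surfaceIdeal_le hF) D b)) hfg
  simp only [map_mul] at h2
  rw [pullback_eval hF hi hj, pullback_eval hF hi hj, Derivation.leibniz, h1, h1, smul_zero,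
    zero_add, ← pullback_eval hF hi hj] at h2
  exact (((c'.isUnit_eval_of_notMem hg).map (pullback (surfaceIdeal_le hF) D)).smul_eq_zero).1 h2

include hF hns e hK in
-- The height of `D` in the chart is exactly 9 and the tangent space of `δ = 0` is at most a line,
-- so `δ` is a uniformizer. Near `D` the module of differentials is generated by `dv b` and `dx a`;
-- the second is pulled back from the surface, while the first is so only after multiplication by
-- `δ`.
lemma jacobianOrder_eq_one_aux (hD : IsPrimeDivisor D)
    (hKm : ∀ f, algebraMap IncidenceRing K f = 0 ↔ f ∈ (incidenceChart D hi hj).prime)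
    (htop : ∀ P : Submodule (localRing D) (Ω[localRing D⁄ℂ]),
      (∀ p : Ω[localRing D⁄ℂ] →ₗ[localRing D] K, (∀ x ∈ P, p x = 0) → p = 0) → P = ⊤)
    (hm : jacobian F i k l ∈ (incidenceChart D hi hj).prime)
    (hII : secondForm F k l k l ∉ (incidenceChart D hi hj).prime) :
    jacobianOrder (pullback (surfaceIdeal_le hF) D) = 1 := by
  set c := incidenceChart D hi hj with hc
  have hJ := tripleContactIdeal_isHomogeneous F
  have heq := eval_eq_zero_of_mem_chartEquations hF hi hj
  have hS : chartEquations F i j ⊆ c.prime := fun f hf => by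
    change c.eval f ∈ IsLocalRing.maximalIdeal (localRing D)
    rw [heq f hf]
    exact zero_mem _
  have hSK (f) (hf : f ∈ chartEquations F i j) : algebraMap IncidenceRing K f = 0 :=
    (hKm f).2 (hS hf)
  have hins : insert (jacobian F i k l) (chartEquations F i j) ⊆ c.prime :=
    Set.insert_subset hm hS
  have hh : rename Sum.inl (hessian F) ∈ c.prime := by
    change c.eval _ ∈ IsLocalRing.maximalIdeal (localRing D)
    rw [map_rename_hessian hF c.eval e heq]
    exact Ideal.pow_mem_of_mem (IsLocalRing.maximalIdeal (localRing D)) hm 2 (by norm_num)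
  have h9 : 9 ≤ c.prime.height := nine_le_height hF hns e c.prime hS hh
  have h9' : c.prime.height ≤ 9 := c.height_prime_le hJ (chartEquations_subset hi hj hF)
    (sup_ideal_le_radical hi hj hF) (chartEquations_encard_le i j) hD
  have hfin := finrank_tangent_le_one (K := K) hF hns e
    (fun f hf => (hKm f).2 (hins hf)) (Set.subset_insert _ _)
    (Set.mem_insert _ _) fun h0 => absurd ((hKm _).1 h0) hII
  -- Tangent dimension at most 1 and height at most 9 in ten variables: the chart equations and `δ`
  -- generate the prime locally.
  have hgen := exists_mul_mem_span_of_finrank_tangent_le K c.prime hKm _ hins (by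
    have h3 : Fintype.card (Fin 4 ⊕ Pair) = 1 + 9 := by decide
    rw [h3]
    rw [Nat.cast_add]
    refine add_le_add ?_ h9'
    exact_mod_cast hfin)
  have hmax := c.maximalIdeal_eq_span_of_forall heq hm hgen
  -- A derivation killing the chart equations must kill the whole ideal of `Y`, which is only known
  -- to lie in their radical. Reducedness at `D`, a consequence of `hgen`, closes this gap.
  have hdesc (d : Derivation ℂ IncidenceRing K) (hd : ∀ f ∈ chartEquations F i j, d f = 0) :
      ∃ Δ : Derivation ℂ (localRing D) K, ∀ f, Δ (c.eval f) = d f := by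
    refine c.exists_derivation hJ hK d fun f hf => ?_
    obtain ⟨s, hs, hsf⟩ := Ideal.exists_mul_mem_span_of_mem_radical c.prime hS
      (chartEquations_encard_le i j) (lt_of_lt_of_le (by norm_num) h9) hm hgen
      (sup_ideal_le_radical hi hj hF hf)
    exact d.eq_zero_of_mul_mem_span hSK hd (fun h0 => hs ((hKm s).1 h0))
      ((hKm f).2 (c.sup_le_comap hJ (IsLocalRing.maximalIdeal (localRing D)) hf)) hsf
  obtain ⟨ht, -⟩ := isTripleContact_of_chartEquations
    (IsScalarTower.toAlgHom ℂ IncidenceRing K) hSK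
  have hm' := (hKm _).2 hm
  change IsScalarTower.toAlgHom ℂ IncidenceRing K _ = 0 at hm'
  rw [map_jacobian] at hm'
  have hv : algebraMap IncidenceRing K ∘ direction lineCoord i =
      direction (IsScalarTower.toAlgHom ℂ IncidenceRing K ∘ lineCoord) i :=
    comp_direction (IsScalarTower.toAlgHom ℂ IncidenceRing K) _ _
  obtain ⟨y₀, a, b, ha, hb, hy, hu, hyu⟩ := ht.exists_deformation e cubicForm_isSymm
    (cubicForm_isNondegenerate hF hns) hm'
  rw [← hv] at hy hu hyu
  set x₀ := IsScalarTower.toAlgHom ℂ IncidenceRing K ∘ pointCoord with hx₀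
  set w := tangentVec (cubicForm K F) x₀ k l
  -- `Δ₁` turns the line with its point fixed, so it spans the kernel of the differential of the
  -- projection; `Δ₂` moves the point.
  obtain ⟨Δ₁, hΔ₁⟩ := hdesc _ (deformationDerivation_eq_zero hSK hu)
  obtain ⟨Δ₂, hΔ₂⟩ := hdesc _ (deformationDerivation_eq_zero hSK hy)
  have h1x (a) : Δ₁ (c.eval (pointCoord a)) = 0 := (hΔ₁ _).trans
    (congrFun (deformationDerivation_comp_pointCoord i 0 w) a)
  have h1v (a) : Δ₁ (c.eval (direction lineCoord i a)) = w a := (hΔ₁ _).trans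
    (congrFun (deformationDerivation_comp_direction hSK hu.yi hu.ui) a)
  have h2x (a) : Δ₂ (c.eval (pointCoord a)) = y₀ a := (hΔ₂ _).trans
    (congrFun (deformationDerivation_comp_pointCoord i y₀ 0) a)
  refine jacobianOrder_eq_one _ hmax (e₁ := KaehlerDifferential.D ℂ _
    (c.eval (direction lineCoord i b))) (e₂ := KaehlerDifferential.D ℂ _ (c.eval (pointCoord a)))
    (htop _ fun p hp => ?_) (jacobian_smul_mem hF hi hj e _) (D_eval_pointCoord_mem hF hi hj a)
    Δ₁.liftKaehlerDifferential Δ₂.liftKaehlerDifferential (fun z hz => ?_)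
    (x := KaehlerDifferential.D ℂ _ (c.eval (direction lineCoord i b)))
    (y := KaehlerDifferential.D ℂ _ (c.eval (pointCoord a))) ?_
  -- A functional killing both generators is a deformation with `y a = 0` and `u b = 0`, hence zero.
  · set Δ := p.compDer (KaehlerDifferential.D ℂ (localRing D)) with hΔ
    set d := c.compEval hK Δ
    have hd (f) : d f = Δ (c.eval f) := rfl
    have hdS (f) (hf : f ∈ chartEquations F i j) : d f = 0 := by rw [hd, heq f hf, map_zero]
    have hdef := isDeformation_of_derivation d hdS
    obtain ⟨hy0, hu0⟩ := hyu _ _ hdef (hp _ (Submodule.subset_span (.inr rfl)))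
      (hp _ (Submodule.subset_span (.inl rfl)))
    have hl := derivation_lineCoord d hdS hSK
    rw [hy0, hu0] at hl
    have hΔ0 : Δ = 0 := c.derivation_eq_zero _ fun s => by
      rcases s with a | q
      · exact congrFun hy0 a
      · refine (congrFun hl q).trans ?_
        simp [wedge]
    refine LinearMap.ext fun z => ?_
    have hz : z ∈ Submodule.span (localRing D)
        (Set.range (KaehlerDifferential.D ℂ (localRing D))) := by
      rw [KaehlerDifferential.span_range_derivation]; trivial
    have hker : Submodule.span (localRing D)
        (Set.range (KaehlerDifferential.D ℂ (localRing D))) ≤ LinearMap.ker p := by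
      rw [Submodule.span_le]
      rintro _ ⟨t, rfl⟩
      exact DFunLike.congr_fun hΔ0 t
    exact hker hz
  · have hker : differentialImage (pullback (surfaceIdeal_le hF) D) ≤
        LinearMap.ker Δ₁.liftKaehlerDifferential := by
      rw [differentialImage, Submodule.span_le]
      rintro _ ⟨t, rfl⟩
      rw [SetLike.mem_coe, LinearMap.mem_ker, Derivation.liftKaehlerDifferential_comp_D]
      exact derivation_pullback_eq_zero hF hi hj Δ₁ h1x t
    exact hker hz
  · simp only [Derivation.liftKaehlerDifferential_comp_D, h1x, h1v, h2x, zero_mul, sub_zero]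
    exact mul_ne_zero hb ha

include hns e in
/-- The ramification is simple along the parabolic divisors. -/
lemma jacobianOrder_pullback_eq_one (hD : IsPrimeDivisor D)
    (hm : jacobian F i k l ∈ (incidenceChart D hi hj).prime)
    (hII : secondForm F k l k l ∉ (incidenceChart D hi hj).prime) :
    jacobianOrder (pullback (surfaceIdeal_le hF) D) = 1 := by
  let c := incidenceChart D hi hj
  let _ := c.residueAlgebra
  have := c.residueAlgebra_isScalarTower
  have := c.isNoetherianRing_localRing
  have := c.finite_kaehlerDifferential
  exact jacobianOrder_eq_one_aux (K := IsLocalRing.ResidueField (localRing D)) hF hns hi hj e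
    (fun _ => rfl) hD c.residue_eval_eq_zero_iff span_eq_top_of_forall_functional hm hII

end Order

end CubicSurface

namespace BiProj

/-! ### Points of products of projective spaces and their local rings -/

section Core

variable {σ : Type} (w : σ → ℕ × ℕ) {K : Type*} [Field K] [Algebra ℂ K]
  (ψ : MvPolynomial σ ℂ →ₐ[ℂ] K)

/-- The orbit map of a point under the torus which scales the coordinates. -/
def torusMap : MvPolynomial σ ℂ →ₐ[ℂ] MvPolynomial (Fin 2) K :=
  aeval fun s => X 0 ^ (w s).1 * X 1 ^ (w s).2 * C (ψ (X s))

variable {w}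

/-- Different bidegrees land on different monomials. This makes the kernel of the orbit map a
homogeneous prime, whatever `ψ` is. -/
lemma torusMap_apply {d : ℕ × ℕ} {f : MvPolynomial σ ℂ} (hf : f ∈ piece w d) :
    torusMap w ψ f = monomial (Finsupp.single 0 d.1 + Finsupp.single 1 d.2) (ψ f) := by
  have h : aeval (fun s => C (ψ (X s))) f = (C (ψ f) : MvPolynomial (Fin 2) K) := by
    have : (aeval (fun s => C (ψ (X s))) : MvPolynomial σ ℂ →ₐ[ℂ] MvPolynomial (Fin 2) K) =
        (IsScalarTower.toAlgHom ℂ K (MvPolynomial (Fin 2) K)).comp ψ := by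
      ext s
      simp
    rw [this]
    rfl
  rw [torusMap, CubicSurface.aeval_scale hf, h, X_pow_eq_monomial, X_pow_eq_monomial, C_apply,
    monomial_mul, monomial_mul, add_zero, one_mul, one_mul]

lemma torusMap_eq_zero_iff {d : ℕ × ℕ} {f : MvPolynomial σ ℂ} (hf : f ∈ piece w d) :
    torusMap w ψ f = 0 ↔ ψ f = 0 := by
  rw [torusMap_apply ψ hf, monomial_eq_zero]

open DirectSum in
lemma map_decompose_eq_zero {f : MvPolynomial σ ℂ} (hf : torusMap w ψ f = 0) (d : ℕ × ℕ) :
    ψ (decompose (piece w) f d) = 0 := by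
  classical
  set e : ℕ × ℕ → (Fin 2 →₀ ℕ) := fun d => Finsupp.single 0 d.1 + Finsupp.single 1 d.2 with he'
  have he : Function.Injective e := fun d d' h => by
    ext
    · simpa [e] using DFunLike.congr_fun h 0
    · simpa [e] using DFunLike.congr_fun h 1
  have h1 : coeff (e d) (torusMap w ψ f) = ψ (decompose (piece w) f d) := by
    conv_lhs => rw [← sum_support_decompose (piece w) f]
    rw [map_sum, coeff_sum, Finset.sum_eq_single d]
    · rw [torusMap_apply ψ (SetLike.coe_mem _), coeff_monomial, if_pos rfl]
    · intro d' _ hd'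
      rw [torusMap_apply ψ (SetLike.coe_mem _), coeff_monomial, if_neg fun h => hd' (he h)]
    · intro hd
      rw [DFinsupp.notMem_support_iff.1 hd, ZeroMemClass.coe_zero, map_zero, coeff_zero]
  rw [← h1, hf, coeff_zero]

/-- The point of the product of projective spaces given by homogeneous coordinates in a field. -/
def corePoint {I : Ideal (MvPolynomial σ ℂ)} (hI : I.IsHomogeneous (piece w))
    (hψ : ∀ s, ∃ t, w t = w s ∧ ψ (X t) ≠ 0) (hIψ : ∀ d, ∀ f ∈ piece w d, f ∈ I → ψ f = 0) :
    Point w I where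
  ideal := RingHom.ker (torusMap w ψ)
  isPrime := RingHom.ker_isPrime _
  isHomogeneous d f hf := by
    rw [RingHom.mem_ker] at hf ⊢
    rw [torusMap_eq_zero_iff ψ (SetLike.coe_mem _)]
    exact map_decompose_eq_zero ψ hf d
  relevant s := by
    obtain ⟨t, ht, h⟩ := hψ s
    refine ⟨t, ht, fun h0 => h ?_⟩
    rwa [RingHom.mem_ker, torusMap_eq_zero_iff ψ (isWeightedHomogeneous_X ℂ w t)] at h0
  le_ideal f hf := by
    classical
    rw [RingHom.mem_ker, ← DirectSum.sum_support_decompose (piece w) f, map_sum]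
    refine Finset.sum_eq_zero fun d _ => ?_
    rw [torusMap_eq_zero_iff ψ (SetLike.coe_mem _)]
    exact hIψ d _ (SetLike.coe_mem _) (hI d hf)

lemma mem_corePoint {I : Ideal (MvPolynomial σ ℂ)} (hI : I.IsHomogeneous (piece w))
    (hψ : ∀ s, ∃ t, w t = w s ∧ ψ (X t) ≠ 0) (hIψ : ∀ d, ∀ f ∈ piece w d, f ∈ I → ψ f = 0)
    {d : ℕ × ℕ} {f : MvPolynomial σ ℂ} (hf : f ∈ piece w d) :
    f ∈ (corePoint ψ hI hψ hIψ).ideal ↔ ψ f = 0 :=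
  torusMap_eq_zero_iff ψ hf

end Core

section Ext

variable {σ : Type} {w : σ → ℕ × ℕ} {I : Ideal (MvPolynomial σ ℂ)}

lemma Point.ext_of_homogeneous {z z' : Point w I}
    (h : ∀ d, ∀ f ∈ piece w d, f ∈ z.ideal ↔ f ∈ z'.ideal) : z = z' := by
  have := HomogeneousIdeal.ext' (I := ⟨z.ideal, z.isHomogeneous⟩)
    (J := ⟨z'.ideal, z'.isHomogeneous⟩) h
  exact Point.ext (congrArg HomogeneousSubmodule.toSubmodule this)

/-- A point is determined by its ideal in a chart. -/
lemma Chart.eq_of_prime_eq {z z' : Point w I} (c : Chart z) (c' : Chart z')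
    (h : c.prime = c'.prime) : z = z' :=
  Point.ext_of_homogeneous fun d f hf => by
    rw [← c.mem_prime_iff hf, ← c'.mem_prime_iff hf, h]

/-- Ideals of a chart are determined by their bihomogeneous elements. -/
lemma Chart.le_of_homogeneous {z : Point w I} (c : Chart z) {P Q : Ideal (MvPolynomial σ ℂ)}
    (hP : c.ideal ≤ P) (hQ : c.ideal ≤ Q) (h : ∀ d, ∀ f ∈ piece w d, f ∈ P → f ∈ Q) : P ≤ Q := by
  intro f hf
  obtain ⟨m, g, hg, hfg⟩ := c.exists_homogenization f
  have h1 : g ∈ P := by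
    have := sub_mem hf (hP hfg)
    rwa [sub_sub_cancel] at this
  have := add_mem (hQ hfg) (h _ g hg h1)
  rwa [sub_add_cancel] at this

/-- A prime divisor is recognized by a function which vanishes at no smaller prime. -/
lemma Chart.isPrimeDivisor_of_forall [Finite σ] {z : Point w I} (c : Chart z)
    (hI : I.IsHomogeneous (piece w)) {S : Set (MvPolynomial σ ℂ)}
    (hS : S ⊆ (I ⊔ c.ideal : Ideal _)) (hS' : I ⊔ c.ideal ≤ (Ideal.span S).radical) {n : ℕ}
    (hn : S.encard ≤ n) (hc : n + 1 ≤ c.prime.height) {f : MvPolynomial σ ℂ} (hf : f ∈ c.prime)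
    (h : ∀ p : Ideal (localRing z), p.IsPrime → f ∈ p.comap c.eval →
      c.prime ≤ p.comap c.eval) : IsPrimeDivisor z := by
  have := c.isNoetherianRing_localRing
  have h1 : (IsLocalRing.maximalIdeal (localRing z)).height = 1 := by
    refine le_antisymm ?_ ?_
    · refine Ideal.height_le_one_of_isPrincipal_of_mem_minimalPrimes (Ideal.span {c.eval f}) _
        ⟨⟨inferInstance, ?_⟩, fun p ⟨hp, hfp⟩ _ => ?_⟩
      · rw [Ideal.span_le, Set.singleton_subset_iff]
        exact hf
      · exact c.le_of_comap_le (h p hp (hfp (Ideal.mem_span_singleton_self _)))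
    -- The `n` equations account for only `n` of the height of `c.prime`, so the local ring has
    -- positive dimension.
    · have h2 := hc.trans (c.height_comap_le hI hS hS' hn (IsLocalRing.maximalIdeal (localRing z)))
      exact (ENat.add_le_add_iff_left (ENat.natCast_ne_top n)).1 h2
  have h3 := IsLocalRing.maximalIdeal_height_eq_ringKrullDim (R := localRing z)
  rw [h1] at h3
  exact h3.symm

/-- The order of vanishing of a section which does not vanish along a divisor. -/
lemma ord_localFraction_eq_zero {z : Point w I} (c : Chart z) {d : ℕ × ℕ}
    {s g : MvPolynomial σ ℂ} (hs : s ∈ piece w d) (hg : g ∈ piece w d) (hgz : g ∉ z.ideal)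
    (hsz : s ∉ z.ideal) : Ring.ord (localRing z) (localFraction z hs hg hgz) = 0 := by
  have h : IsUnit (localFraction z hs hg hgz) := by
    refine isUnit_of_mul_isUnit_left (y := c.eval g) ?_
    rw [c.localFraction_mul_eval hs hg hgz]
    exact (c.isUnit_eval hs).2 hsz
  exact Ring.ord_of_isUnit h

/-- The order of vanishing of a section which generates the ideal of a divisor. -/
lemma ord_localFraction_eq_one {z : Point w I} (c : Chart z) {d : ℕ × ℕ}
    {s g : MvPolynomial σ ℂ} (hs : s ∈ piece w d) (hg : g ∈ piece w d) (hgz : g ∉ z.ideal)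
    (h : IsLocalRing.maximalIdeal (localRing z) = Ideal.span {c.eval s}) :
    Ring.ord (localRing z) (localFraction z hs hg hgz) = 1 := by
  have h1 : Ideal.span {localFraction z hs hg hgz} = IsLocalRing.maximalIdeal (localRing z) := by
    rw [h, ← c.localFraction_mul_eval hs hg hgz,
      Ideal.span_singleton_mul_right_unit ((c.isUnit_eval hg).2 hgz)]
  rw [Ring.ord, h1]
  have : IsSimpleModule (localRing z) (localRing z ⧸ IsLocalRing.maximalIdeal (localRing z)) :=
    isSimpleModule_iff_isCoatom.2 (IsLocalRing.maximalIdeal.isMaximal _).out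
  exact Module.length_eq_one _ _

/-- A field extension of residue fields is trivial if the coordinates are in the image. -/
lemma surjective_of_forall_residue_mem {A : Type*} [Field A] {z : Point w I} (c : Chart z)
    (ρ : A →+* residueField z)
    (hC : ∀ r : ℂ, IsLocalRing.residue _ (algebraMap ℂ (ambientRing z) r) ∈ ρ.range)
    (h : ∀ s, IsLocalRing.residue _ (c.ambientEval (X s)) ∈ ρ.range) :
    Function.Surjective ρ := by
  have h1 (f : MvPolynomial σ ℂ) : IsLocalRing.residue _ (c.ambientEval f) ∈ ρ.range := by
    induction f using MvPolynomial.induction_on with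
    | C r =>
      have : c.ambientEval (C r) = algebraMap ℂ _ r := c.ambientEval.commutes r
      rw [this]
      exact hC r
    | add f g hf hg => rw [map_add, map_add]; exact add_mem hf hg
    | mul_X f s hf => rw [map_mul, map_mul]; exact mul_mem hf (h s)
  intro y
  obtain ⟨b, rfl⟩ := IsLocalRing.residue_surjective y
  obtain ⟨f, g, hg, hfg⟩ := c.exists_eval_mul_eq (Ideal.Quotient.mk _ b)
  have h2 : Ideal.Quotient.mk (localIdeal z) (b * c.ambientEval g - c.ambientEval f) = 0 := by
    rw [map_sub, map_mul]
    exact sub_eq_zero.2 hfg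
  have h3 : IsLocalRing.residue _ (b * c.ambientEval g - c.ambientEval f) = 0 := by
    rw [IsLocalRing.residue_eq_zero_iff]
    intro h4
    have := h4.map (Ideal.Quotient.mk (localIdeal z))
    rw [h2] at this
    exact not_isUnit_zero this
  rw [map_sub, map_mul, sub_eq_zero] at h3
  have h4 : IsLocalRing.residue _ (c.ambientEval g) ≠ 0 := by
    rw [Ne, IsLocalRing.residue_eq_zero_iff]
    intro h5
    refine h5 ((Chart.isUnit_quotientMk _).1 ?_)
    exact c.isUnit_eval_of_notMem hg
  obtain ⟨u, hu⟩ := h1 f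
  obtain ⟨v, hv⟩ := h1 g
  refine ⟨u / v, ?_⟩
  rw [map_div₀, hu, hv, ← h3, mul_div_cancel_right₀ _ h4]

end Ext

end BiProj

namespace CubicSurface

open BiProj

/-! ### The asymptotic line over a parabolic curve -/

section Section

lemma comp_kernelVec {A A' : Type*} [CommRing A] [CommRing A'] [Algebra ℂ A] [Algebra ℂ A']
    {F : MvPolynomial (Fin 4) ℂ} (φ : A →ₐ[ℂ] A') (x : Fin 4 → A) (b : Fin 4) :
    φ ∘ kernelVec (cubicForm A F) x b = kernelVec (cubicForm A' F) (φ ∘ x) b := by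
  have h : φ.mapMatrix (formMatrix (cubicForm A F) x) = formMatrix (cubicForm A' F) (φ ∘ x) := by
    ext a c
    rw [AlgHom.mapMatrix_apply, Matrix.map_apply, formMatrix, Matrix.of_apply, map_cubicForm,
      comp_basisVec, comp_basisVec]
    rfl
  ext a
  rw [kernelVec, ← h, ← AlgHom.map_adjugate]
  rfl

lemma comp_wedge {A A' : Type*} [CommRing A] [CommRing A'] [Algebra ℂ A] [Algebra ℂ A']
    (φ : A →ₐ[ℂ] A') (x y : Fin 4 → A) : φ ∘ wedge x y = wedge (φ ∘ x) (φ ∘ y) := by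
  ext p
  simp [wedge]

lemma eq_zero_of_isTripleContact {F : MvPolynomial (Fin 4) ℂ} {A : Type*} [CommRing A]
    [Algebra ℂ A] (φ : IncidenceRing →ₐ[ℂ] A) {i j : Fin 4} {v : Fin 4 → A}
    (h : IsTripleContact (cubicForm A F) i j (φ ∘ pointCoord) v)
    (hl : φ ∘ lineCoord = wedge (φ ∘ pointCoord) v) : ∀ f ∈ chartEquations F i j, φ f = 0 := by
  have hxi : φ (pointCoord i) = 1 := h.xi
  have hv : φ ∘ direction lineCoord i = v := by
    rw [comp_direction, hl, direction_wedge, h.xi, h.vi, one_smul, zero_smul, sub_zero]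
  rintro _ ((⟨rfl | rfl⟩ | ⟨n, rfl⟩) | ⟨p, hp, rfl⟩)
  · rw [map_sub, hxi, map_one, sub_self]
  · rw [map_sub, map_one, sub_eq_zero]
    exact (congrFun hv j).trans h.vj
  · fin_cases n
    · change φ (cubicForm _ F pointCoord pointCoord pointCoord) = 0
      rw [map_cubicForm, h.xxx]
    · change φ (cubicForm _ F pointCoord pointCoord (direction lineCoord i)) = 0
      rw [map_cubicForm, hv, h.xxv]
    · change φ (cubicForm _ F pointCoord (direction lineCoord i) (direction lineCoord i)) = 0
      rw [map_cubicForm, hv, h.xvv]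
  · have h1 (a) : φ (direction lineCoord i a) = v a := congrFun hv a
    have h2 : φ (lineCoord p) = φ (pointCoord p.1.1) * v p.1.2 - φ (pointCoord p.1.2) * v p.1.1 :=
      congrFun hl p
    rw [incidence, map_sub, map_sub, map_mul, map_mul, map_mul, hxi, h1, h1, h2]
    ring

variable (F : MvPolynomial (Fin 4) ℂ) (b : Fin 4)

/-- The direction of triple contact at the points of the parabolic curve. -/
def parabolicVec : Fin 4 → MvPolynomial (Fin 4) ℂ := kernelVec (cubicForm _ F) X b

/-- The lines with triple contact at the points of the parabolic curve. -/
def parabolicSection : IncidenceRing →ₐ[ℂ] MvPolynomial (Fin 4) ℂ :=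
  aeval (Sum.elim X (wedge X (parabolicVec F b)))

lemma parabolicSection_rename (f : MvPolynomial (Fin 4) ℂ) :
    parabolicSection F b (rename Sum.inl f) = f := by
  rw [parabolicSection, aeval_rename]
  exact aeval_X_left_apply f

lemma parabolicSection_lineCoord (p : Pair) :
    parabolicSection F b (lineCoord p) = wedge X (parabolicVec F b) p :=
  aeval_X _ _

variable {F b} (hF : F.IsHomogeneous 3) (hns : IsNonsingular F)

section Field

variable {K : Type*} [Field K] [Algebra ℂ K] (φ : IncidenceRing →ₐ[ℂ] K) {i j : Fin 4}
  (hij : i ≠ j) (hφ : ∀ f ∈ chartEquations F i j, φ f = 0)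
  (hh : φ (rename Sum.inl (hessian F)) = 0)
  (hb : φ (rename Sum.inl (parabolicVec F b b)) ≠ 0)

include hF hns hij hφ hh hb in
/-- At the points of the parabolic curve where the Hessian matrix has rank three, there is only one
line with triple contact. -/
lemma exists_eq_parabolicSection : ∃ s : K, ∀ d, ∀ f ∈ piece (twoWeight (Fin 4) Pair) d,
    φ f = s ^ d.2 * φ (rename Sum.inl (parabolicSection F b f)) := by
  obtain ⟨h, hl⟩ := isTripleContact_of_chartEquations φ hφ
  set φ₀ : MvPolynomial (Fin 4) ℂ →ₐ[ℂ] K := φ.comp (rename Sum.inl) with hφ₀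
  have hx : φ₀ ∘ X = φ ∘ pointCoord := by
    ext a
    simp [φ₀, pointCoord]
  set x := φ ∘ pointCoord
  have hu : φ₀ ∘ parabolicVec F b = kernelVec (cubicForm K F) x b := by
    rw [parabolicVec, comp_kernelVec, hx]
  have hdet : (formMatrix (cubicForm K F) x).det = 0 := by
    rw [← hx, ← map_hessian hF φ₀]
    exact hh
  obtain ⟨r, s, -, hv⟩ := h.exists_eq_add_smul_kernelVec cubicForm_isSymm
    (cubicForm_isNondegenerate hF hns) hij hdet (b := b) (by
      have := congrFun hu b
      rw [kernelVec] at this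
      rw [← this]
      exact hb)
  refine ⟨s, fun d f hf => ?_⟩
  have h1 : φ = aeval fun t => φ (X t) := by
    ext t
    simp
  have h2 : φ₀.comp (parabolicSection F b) =
      aeval fun t => φ₀ (parabolicSection F b (X t)) := by
    ext t
    simp
  -- Since `v = r • x + s • u`, the Plücker vector of the line is `s` times the wedge of `x` and
  -- `u`; the point coordinates are unchanged.
  have h3 : (fun t => φ (X t)) = fun t => 1 ^ (twoWeight (Fin 4) Pair t).1 *
      s ^ (twoWeight (Fin 4) Pair t).2 * φ₀ (parabolicSection F b (X t)) := by
    ext t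
    rcases t with a | p
    · have := parabolicSection_rename F b (X a)
      rw [rename_X] at this
      rw [this]
      simp [twoWeight, φ₀]
    · have h4 := congrFun hl p
      have h5 := congrFun (comp_wedge φ₀ X (parabolicVec F b)) p
      have h6 : φ₀ (parabolicSection F b (X (Sum.inr p))) = _ :=
        (congrArg φ₀ (parabolicSection_lineCoord F b p)).trans h5
      rw [h6, hx, hu]
      change φ (X (Sum.inr p)) = _ at h4
      rw [h4, hv]
      simp only [wedge, Pi.add_apply, Pi.smul_apply, smul_eq_mul, twoWeight, Sum.elim_inr]
      ring
  calc φ f = aeval (fun t => φ (X t)) f := DFunLike.congr_fun h1 f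
    _ = s ^ d.2 * φ₀ (parabolicSection F b f) := by
      rw [h3, aeval_scale hf, ← DFunLike.congr_fun h2 f, one_pow, one_mul]
      rfl

include hF hns hij hφ hh hb in
lemma algHom_eq_zero_iff {d : ℕ × ℕ} {f : IncidenceRing}
    (hf : f ∈ piece (twoWeight (Fin 4) Pair) d) :
    φ f = 0 ↔ φ (rename Sum.inl (parabolicSection F b f)) = 0 := by
  obtain ⟨s, hs⟩ := exists_eq_parabolicSection hF hns φ hij hφ hh hb
  have h1 : φ (pluckerMatrix lineCoord i j) = 1 := by
    have := hφ _ (.inl (.inl (.inr rfl)))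
    rwa [map_sub, map_one, sub_eq_zero] at this
  -- The normalized Plücker coordinate `i j` has the value 1 and is a multiple of `s`.
  have hs0 : s ≠ 0 := by
    rintro rfl
    rw [hs _ _ (pluckerMatrix_lineCoord_mem i j), pow_one, zero_mul] at h1
    exact zero_ne_one h1
  rw [hs d f hf, mul_eq_zero, or_iff_right (pow_ne_zero _ hs0)]

end Field

section Prime

variable {i j : Fin 4} (hij : i ≠ j) (Q : Ideal IncidenceRing) [Q.IsPrime]
  (hQ : chartEquations F i j ⊆ Q) (hh : rename Sum.inl (hessian F) ∈ Q)
  (hb : rename Sum.inl (parabolicVec F b b) ∉ Q)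

include hF hns hij hQ hh hb in
lemma mem_iff_parabolicSection {d : ℕ × ℕ} {f : IncidenceRing}
    (hf : f ∈ piece (twoWeight (Fin 4) Pair) d) :
    f ∈ Q ↔ rename Sum.inl (parabolicSection F b f) ∈ Q := by
  have h := algHom_eq_zero_iff hF hns (IsScalarTower.toAlgHom ℂ IncidenceRing Q.ResidueField) hij
    (fun f hf => (algebraMap_residueField_eq_zero_iff Q f).2 (hQ hf))
    ((algebraMap_residueField_eq_zero_iff Q _).2 hh)
    (fun h => hb ((algebraMap_residueField_eq_zero_iff Q _).1 h)) hf
  rwa [IsScalarTower.coe_toAlgHom', algebraMap_residueField_eq_zero_iff,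
    algebraMap_residueField_eq_zero_iff] at h

include hF hns hQ hb in
omit hij in
lemma secondForm_notMem {k l : Fin 4} (e : IsEnum i j k l) (hm : jacobian F i k l ∈ Q) :
    secondForm F k l k l ∉ Q := fun hII => by
  set φ := IsScalarTower.toAlgHom ℂ IncidenceRing Q.ResidueField
  have hφ (f) : φ f = 0 ↔ f ∈ Q := algebraMap_residueField_eq_zero_iff Q f
  obtain ⟨h, -⟩ := isTripleContact_of_chartEquations φ fun f hf => (hφ f).2 (hQ hf)
  rw [← hφ, map_secondForm] at hII
  rw [← hφ, map_jacobian] at hm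
  refine h.secondForm_ne_zero e cubicForm_isSymm (cubicForm_isNondegenerate hF hns) hm ?_ hII
  intro h0
  refine hb ((hφ _).1 ?_)
  have h1 := congrFun (comp_kernelVec (F := F) (φ.comp (rename Sum.inl)) X b) b
  have hx : φ.comp (rename Sum.inl) ∘ X = φ ∘ pointCoord := by
    ext a
    simp [pointCoord]
  rw [hx, kernelVec, h0] at h1
  exact h1

end Prime

section Curve

variable {i : Fin 4} {K : Type*} [Field K] [Algebra ℂ K] [Algebra (MvPolynomial (Fin 4) ℂ) K]
  [IsScalarTower ℂ (MvPolynomial (Fin 4) ℂ) K]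
  (q : Ideal (MvPolynomial (Fin 4) ℂ)) [q.IsPrime]
  (hqK : ∀ f, algebraMap (MvPolynomial (Fin 4) ℂ) K f = 0 ↔ f ∈ q)
  (hi : X i - 1 ∈ q) (hFq : F ∈ q) (hh : hessian F ∈ q)

include hF hns hqK hi hFq hh in
lemma exists_parabolicVec_notMem (hq : q.height ≤ 3) : ∃ b, parabolicVec F b b ∉ q := by
  obtain ⟨b, hb⟩ := exists_adjugate_diag_ne_zero cubicForm_isSymm (det_genericPoint hF q hqK hh)
    (adjugate_genericPoint_ne_zero hF hns q hqK hi hFq hq)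
  refine ⟨b, fun h => hb ?_⟩
  have h1 := congrFun (comp_kernelVec (F := F)
    (IsScalarTower.toAlgHom ℂ (MvPolynomial (Fin 4) ℂ) K) X b) b
  exact h1.symm.trans ((hqK _).2 h)

omit [q.IsPrime] in
include hF hns hqK hi hFq hh in
/-- The line with triple contact at the generic point of a parabolic curve. -/
lemma exists_isTripleContact (hb : parabolicVec F b b ∉ q) : ∃ (j : Fin 4) (s : K)
    (v : Fin 4 → K), s ≠ 0 ∧ IsTripleContact (cubicForm K F) i j (genericPoint _ K) v ∧
      wedge (genericPoint _ K) v =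
        s • (algebraMap (MvPolynomial (Fin 4) ℂ) K ∘ wedge X (parabolicVec F b)) := by
  set T := cubicForm K F
  have hT : T.IsSymm := cubicForm_isSymm
  set x : Fin 4 → K := genericPoint _ K
  have hxx : T x x x = 0 := cubicForm_genericPoint hF q hqK hFq
  have hxi : x i = 1 := genericPoint_eq_one q hqK hi
  have hx0 : x ≠ 0 := fun h0 => by simp [h0] at hxi
  set ι := IsScalarTower.toAlgHom ℂ (MvPolynomial (Fin 4) ℂ) K
  have hw : algebraMap (MvPolynomial (Fin 4) ℂ) K ∘ wedge X (parabolicVec F b) =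
      wedge x (kernelVec T x b) :=
    (comp_wedge ι X (parabolicVec F b)).trans
      (congrArg (wedge x) (comp_kernelVec (F := F) ι X b))
  rw [hw]
  set u := kernelVec T x b with hu
  have hxu (z) : T x u z = 0 := apply_kernelVec hT (det_genericPoint hF q hqK hh) b z
  have hu0 : u ≠ 0 := fun h0 => hb <| (hqK _).1 <|
    (congrFun (comp_kernelVec (F := F) ι X b) b).trans (congrFun h0 b)
  -- The kernel vector `u` is not a multiple of `x`, because `T x u` vanishes and `T x x` does not.
  -- This gives the coordinate in which the direction can be normalized.
  obtain ⟨j, hj⟩ : ∃ j, u j - u i * x j ≠ 0 := by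
    by_contra! h
    have hux : u = u i • x := funext fun j => by
      rw [Pi.smul_apply, smul_eq_mul, ← sub_eq_zero, h j]
    have hui : u i = 0 := by
      by_contra hui
      refine hx0 ((cubicForm_isNondegenerate hF hns).ne_zero x fun z => ?_)
      have := hxu z
      rw [hux, map_smul, LinearMap.smul_apply, smul_eq_mul] at this
      exact (mul_eq_zero.1 this).resolve_left hui
    exact hu0 (by rw [hux, hui, zero_smul])
  set s := (u j - u i * x j)⁻¹ with hs
  refine ⟨j, s, s • (u - u i • x), inv_ne_zero hj, ⟨hxi, ?_, ?_, hxx, ?_, ?_⟩, ?_⟩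
  · simp [hxi]
  · simp only [Pi.smul_apply, Pi.sub_apply, smul_eq_mul]
    exact inv_mul_cancel₀ hj
  · rw [map_smul, map_sub, map_smul, hT.right, hxu, hxx]
    simp
  · simp only [map_smul, map_sub, LinearMap.smul_apply, LinearMap.sub_apply, hxu, hT.right x x u,
      hxx]
    simp
  · ext p
    simp only [wedge, Pi.smul_apply, Pi.sub_apply, smul_eq_mul]
    ring

end Curve

end Section

end CubicSurface

namespace CubicSurface

open BiProj

variable {F : MvPolynomial (Fin 4) ℂ} (hF : F.IsHomogeneous 3) (hns : IsNonsingular F)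

/-! ### Existence of a point of `Y` over a parabolic curve -/

section Curve

variable {C : Point (oneWeight (Fin 4)) (surfaceIdeal F)} {i : Fin 4} (hi : X i ∉ C.ideal)

lemma surfaceIdeal_sup_pointChart :
    surfaceIdeal F ⊔ (pointChart C hi).ideal = Ideal.span {X i - 1, F} := by
  rw [pointChart_ideal, surfaceIdeal, ← Ideal.span_union, Set.union_comm]
  rfl

include hF in
lemma subset_pointChart_prime : {X i - 1, F} ⊆ ((pointChart C hi).prime : Set _) := by
  rw [← Ideal.span_le, ← surfaceIdeal_sup_pointChart hi]
  exact (pointChart C hi).sup_le_comap (surfaceIdeal_isHomogeneous hF)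
    (IsLocalRing.maximalIdeal (localRing C))

include hF in
lemma height_pointChart_prime_le (hC : IsPrimeDivisor C) : (pointChart C hi).prime.height ≤ 3 := by
  have h := (pointChart C hi).height_prime_le (surfaceIdeal_isHomogeneous hF)
    (S := {X i - 1, F}) (n := 2) (by rw [surfaceIdeal_sup_pointChart hi]; exact Ideal.subset_span)
    (by rw [surfaceIdeal_sup_pointChart hi]; exact Ideal.le_radical)
    ((Set.encard_insert_le _ _).trans (by rw [Set.encard_singleton]; norm_num)) hC
  exact h.trans (by norm_num)

include hF hns in
lemma exists_mul_mem_span_of_mem_pointChart_prime (hC : IsPrimeDivisor C)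
    (hh : hessian F ∈ C.ideal) (f : MvPolynomial (Fin 4) ℂ) (hf : f ∈ (pointChart C hi).prime) :
    ∃ s ∉ (pointChart C hi).prime, s * f ∈ Ideal.span {X i - 1, F, hessian F} :=
  have hS := subset_pointChart_prime hF hi
  exists_mul_mem_span_hessian hF hns (pointChart C hi).prime (algebraMap_residueField_eq_zero_iff _)
    (hS (.inl rfl)) (hS (.inr rfl)) (((pointChart C hi).mem_prime_iff (hessian_mem hF)).2 hh)
    (height_pointChart_prime_le hF hi hC) f hf

include hF hns in
lemma maximalIdeal_eq_span_hessian (hC : IsPrimeDivisor C) (hh : hessian F ∈ C.ideal) :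
    IsLocalRing.maximalIdeal (localRing C) = Ideal.span {(pointChart C hi).eval (hessian F)} := by
  refine (pointChart C hi).maximalIdeal_eq_span_of_forall (S := {X i - 1, F}) (fun f hf => ?_)
    (((pointChart C hi).mem_prime_iff (hessian_mem hF)).2 hh) fun f hf => ?_
  · refine (pointChart C hi).sup_le_ker_eval (surfaceIdeal_isHomogeneous hF) ?_
    rw [surfaceIdeal_sup_pointChart hi]
    exact Ideal.subset_span hf
  · obtain ⟨s, hs, h⟩ := exists_mul_mem_span_of_mem_pointChart_prime hF hns hi hC hh f hf
    refine ⟨s, hs, ?_⟩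
    have h1 : ({X i - 1, F, hessian F} : Set (MvPolynomial (Fin 4) ℂ)) =
        insert (hessian F) {X i - 1, F} := by
      ext
      simp only [Set.mem_insert_iff, Set.mem_singleton_iff]
      tauto
    rwa [h1] at h

include hF hns in
lemma exists_parabolicVec_notMem_pointChart_prime (hC : IsPrimeDivisor C)
    (hh : hessian F ∈ C.ideal) : ∃ b, parabolicVec F b b ∉ (pointChart C hi).prime :=
  have hS := subset_pointChart_prime hF hi
  exists_parabolicVec_notMem hF hns (pointChart C hi).prime (algebraMap_residueField_eq_zero_iff _)
    (hS (.inl rfl)) (hS (.inr rfl)) (((pointChart C hi).mem_prime_iff (hessian_mem hF)).2 hh)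
    (height_pointChart_prime_le hF hi hC)

include hF hns in
-- The line coordinates `ψ`, given by the section, and `ψ'`, normalized by `v j = 1`, differ by the
-- factor `s`, so both kill the same bihomogeneous polynomials. Normalized coordinates satisfy the
-- chart equations and so kill the ideal of `Y`; unnormalized ones restrict to the canonical map on
-- polynomials in the point, so the point they define lies over `C`.
lemma exists_proj_eq_aux {K : Type*} [Field K] [Algebra ℂ K] [Algebra (MvPolynomial (Fin 4) ℂ) K]
    [IsScalarTower ℂ (MvPolynomial (Fin 4) ℂ) K]
    (hqK : ∀ f, algebraMap (MvPolynomial (Fin 4) ℂ) K f = 0 ↔ f ∈ (pointChart C hi).prime)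
    (hC : IsPrimeDivisor C) (hh : hessian F ∈ C.ideal) :
    ∃ D : Point (twoWeight (Fin 4) Pair) (tripleContactIdeal F),
      proj (surfaceIdeal_le hF) D = C := by
  obtain ⟨b, hb⟩ := exists_parabolicVec_notMem_pointChart_prime hF hns hi hC hh
  have hS := subset_pointChart_prime hF hi
  obtain ⟨j, s, v, hs, hv, hw⟩ := exists_isTripleContact hF hns _ hqK (hS (.inl rfl))
    (hS (.inr rfl)) (((pointChart C hi).mem_prime_iff (hessian_mem hF)).2 hh) hb
  set ι := IsScalarTower.toAlgHom ℂ (MvPolynomial (Fin 4) ℂ) K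
  set x : Fin 4 → K := genericPoint _ K
  set ψ : IncidenceRing →ₐ[ℂ] K := ι.comp (parabolicSection F b)
  set ψ' : IncidenceRing →ₐ[ℂ] K := aeval (Sum.elim x (wedge x v)) with hψ'
  have hψX (a) : ψ (X (Sum.inl a)) = x a := by
    have := parabolicSection_rename F b (X a)
    rw [rename_X] at this
    exact congrArg ι this
  have hψp (p) : ψ (X (Sum.inr p)) = algebraMap (MvPolynomial (Fin 4) ℂ) K
      (wedge X (parabolicVec F b) p) := congrArg ι (parabolicSection_lineCoord F b p)
  have hscale {d : ℕ × ℕ} {f : IncidenceRing} (hf : f ∈ piece (twoWeight (Fin 4) Pair) d) :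
      ψ' f = s ^ d.2 * ψ f := by
    have h1 : ψ = aeval fun t => ψ (X t) := by
      ext t
      simp
    have h2 : Sum.elim x (wedge x v) = fun t => 1 ^ (twoWeight (Fin 4) Pair t).1 *
        s ^ (twoWeight (Fin 4) Pair t).2 * ψ (X t) := by
      ext t
      rcases t with a | p
      · rw [hψX]
        simp [twoWeight]
      · rw [hψp]
        have := congrFun hw p
        simpa [twoWeight] using this
    rw [hψ', h2, aeval_scale hf, ← h1, one_pow, one_mul]
  have hker : ∀ f ∈ tripleContactIdeal F, ψ' f = 0 := fun f hf => by
    have hx' : ψ' ∘ pointCoord = x := by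
      ext a
      simp [ψ', pointCoord]
    have hl' : ψ' ∘ lineCoord = wedge x v := by
      ext a
      simp [ψ', lineCoord]
    have h1 := eq_zero_of_isTripleContact ψ' (v := v) (by rwa [hx']) (by rw [hl', hx'])
    obtain ⟨n, hn⟩ := tripleContactIdeal_le_radical hF i j hf
    have h2 : Ideal.span (chartEquations F i j) ≤ RingHom.ker ψ' := Ideal.span_le.2 h1
    have h3 := h2 hn
    rw [RingHom.mem_ker, map_pow] at h3
    exact eq_zero_of_pow_eq_zero h3
  have hrel (t) : ∃ t', twoWeight (Fin 4) Pair t' = twoWeight (Fin 4) Pair t ∧ ψ (X t') ≠ 0 := by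
    rcases t with a | p
    · refine ⟨Sum.inl i, rfl, ?_⟩
      rw [hψX]
      exact hv.xi.trans_ne one_ne_zero
    · by_contra! h
      have h1 : wedge x v = 0 := by
        rw [hw]
        ext p'
        have := h (Sum.inr p') rfl
        rw [hψp] at this
        simp [this]
      have h2 := pluckerMatrix_wedge x v i j
      rw [h1, hv.xi, hv.vj, hv.vi, mul_zero, sub_zero, mul_one] at h2
      exact one_ne_zero (h2.symm.trans (by simp [pluckerMatrix]))
  have hJ := tripleContactIdeal_isHomogeneous F
  have hvan (d) (f) (hf : f ∈ piece (twoWeight (Fin 4) Pair) d) (hfJ : f ∈ tripleContactIdeal F) :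
      ψ f = 0 := by
    have := hscale hf
    rw [hker f hfJ] at this
    exact (mul_eq_zero.1 this.symm).resolve_left (pow_ne_zero _ hs)
  refine ⟨corePoint ψ hJ hrel hvan, Point.ext_of_homogeneous fun d f hf => ?_⟩
  refine (mem_corePoint ψ hJ hrel hvan ((inclGraded (Fin 4) Pair).map_mem hf)).trans ?_
  change ι (parabolicSection F b (rename Sum.inl f)) = 0 ↔ _
  rw [parabolicSection_rename]
  exact (hqK f).trans ((pointChart C hi).mem_prime_iff hf)

include hns in
/-- Over a parabolic curve there is a curve of lines with triple contact. -/
lemma exists_proj_eq (hC : IsPrimeDivisor C) (hh : hessian F ∈ C.ideal) :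
    ∃ D : Point (twoWeight (Fin 4) Pair) (tripleContactIdeal F),
      proj (surfaceIdeal_le hF) D = C := by
  obtain ⟨i, hi⟩ := exists_X_notMem C
  exact exists_proj_eq_aux hF hns hi (algebraMap_residueField_eq_zero_iff _) hC hh

end Curve

/-! ### Uniqueness of the point over a parabolic curve -/

section Fiber

include hF in
lemma chartEquations_subset_prime {D : Point (twoWeight (Fin 4) Pair) (tripleContactIdeal F)}
    {i j : Fin 4} (hi : pointCoord i ∉ D.ideal) (hj : pluckerMatrix lineCoord i j ∉ D.ideal) :
    chartEquations F i j ⊆ (incidenceChart D hi hj).prime :=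
  chartEquations_subset_comap hF hi hj (IsLocalRing.maximalIdeal (localRing D))

variable {C : Point (oneWeight (Fin 4)) (surfaceIdeal F)} {i : Fin 4} (hi : X i ∉ C.ideal)
  (hh : hessian F ∈ C.ideal) {D : Point (twoWeight (Fin 4) Pair) (tripleContactIdeal F)}
  (hD : proj (surfaceIdeal_le hF) D = C)

include hi hD in
lemma pointCoord_notMem : pointCoord i ∉ D.ideal := fun h => hi <| by
  rw [← hD]
  change rename Sum.inl (X i) ∈ D.ideal
  rwa [rename_X]

include hF hns hh hD in
-- The right-hand side depends on `C` only, which makes `D` unique: its ideal is obtained by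
-- substituting the asymptotic line into polynomials.
lemma mem_ideal_iff_parabolicSection {b : Fin 4} (hb : parabolicVec F b b ∉ (pointChart C hi).prime)
    {d : ℕ × ℕ} {f : IncidenceRing} (hf : f ∈ piece (twoWeight (Fin 4) Pair) d) :
    f ∈ D.ideal ↔ parabolicSection F b f ∈ (pointChart C hi).prime := by
  subst hD
  have hi' := pointCoord_notMem hF hi rfl
  obtain ⟨j, hij, hj⟩ := exists_pluckerMatrix_notMem hF D hi'
  rw [← (incidenceChart D hi' hj).mem_prime_iff hf, mem_iff_parabolicSection hF hns hij _
    (chartEquations_subset_prime hF hi' hj)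
    ((mem_pointChart_prime_iff hF hi' hj _).1
      (((pointChart _ hi).mem_prime_iff (hessian_mem hF)).2 hh))
    (fun h => hb ((mem_pointChart_prime_iff hF hi' hj _).2 h)) hf]
  exact (mem_pointChart_prime_iff hF hi' hj _).symm

include hns hi hh hD in
lemma eq_of_proj_eq (hC : IsPrimeDivisor C)
    {D' : Point (twoWeight (Fin 4) Pair) (tripleContactIdeal F)}
    (hD' : proj (surfaceIdeal_le hF) D' = C) : D = D' := by
  obtain ⟨b, hb⟩ := exists_parabolicVec_notMem_pointChart_prime hF hns hi hC hh
  exact Point.ext_of_homogeneous fun d f hf => by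
    rw [mem_ideal_iff_parabolicSection hF hns hi hh hD hb hf,
      mem_ideal_iff_parabolicSection hF hns hi hh hD' hb hf]

end Fiber

/-! ### The divisor over a parabolic curve: codimension, ramification, residue degree -/

section Divisor

variable {D : Point (twoWeight (Fin 4) Pair) (tripleContactIdeal F)} {i j k l : Fin 4}
  (hi : pointCoord i ∉ D.ideal) (hj : pluckerMatrix lineCoord i j ∉ D.ideal)
  (e : IsEnum i j k l) (hC : IsPrimeDivisor (proj (surfaceIdeal_le hF) D))
  (hh : hessian F ∈ (proj (surfaceIdeal_le hF) D).ideal)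

include hj hh hi in
lemma rename_hessian_mem : rename Sum.inl (hessian F) ∈ (incidenceChart D hi hj).prime :=
  (mem_pointChart_prime_iff hF hi hj _).1
    (((pointChart _ (X_notMem_proj hF hi)).mem_prime_iff (hessian_mem hF)).2 hh)

include hns hC hh e hi hj in
-- Let `p` be a prime of the local ring of `Y` containing the Hessian. The Hessian and the equations
-- of `X` generate the ideal of `C` locally, so `p` contains the ideal of `C`; substituting the
-- asymptotic line, it contains all of `c.prime`. Thus the maximal ideal is minimal over one
-- function.
lemma isPrimeDivisor_of_proj : IsPrimeDivisor D := by
  set c := incidenceChart D hi hj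
  set c' := pointChart _ (X_notMem_proj hF hi)
  have hJ := tripleContactIdeal_isHomogeneous F
  have hhc := rename_hessian_mem hF hi hj hh
  have hQ := chartEquations_subset_prime hF hi hj
  refine c.isPrimeDivisor_of_forall hJ (chartEquations_subset hi hj hF)
    (sup_ideal_le_radical hi hj hF) (chartEquations_encard_le i j)
    (nine_le_height hF hns e c.prime hQ hhc) hhc fun p _ hp => ?_
  obtain ⟨b, hb⟩ := exists_parabolicVec_notMem_pointChart_prime hF hns (X_notMem_proj hF hi) hC hh
  have hb' : rename Sum.inl (parabolicVec F b b) ∉ c.prime :=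
    fun h => hb ((mem_pointChart_prime_iff hF hi hj _).2 h)
  have hQp := chartEquations_subset_comap hF hi hj p
  have hspan : Ideal.span {X i - 1, F, hessian F} ≤
      (p.comap c.eval).comap (rename (Sum.inl : _ → Fin 4 ⊕ Pair)) := by
    rw [Ideal.span_le]
    rintro f (rfl | rfl | rfl)
    · rw [SetLike.mem_coe, Ideal.mem_comap, map_sub, rename_X, map_one]
      exact hQp (.inl (.inl (.inl rfl)))
    · refine (le_sup_left.trans (c.sup_le_comap hJ p)) ?_
      exact surfaceIdeal_le hF (Ideal.mem_span_singleton_self _)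
    · exact hp
  have hle (f : MvPolynomial (Fin 4) ℂ) (hf : f ∈ c'.prime) :
      rename Sum.inl f ∈ p.comap c.eval := by
    obtain ⟨s, hs, hsf⟩ := exists_mul_mem_span_of_mem_pointChart_prime hF hns
      (X_notMem_proj hF hi) hC hh f hf
    have h1 := hspan hsf
    rw [Ideal.mem_comap, map_mul] at h1
    refine ((inferInstance : (p.comap c.eval).IsPrime).mem_or_mem h1).resolve_left fun h2 => hs ?_
    exact (mem_pointChart_prime_iff hF hi hj _).2 (c.comap_le_prime p h2)
  refine c.le_of_homogeneous c.le_prime (le_sup_right.trans (c.sup_le_comap hJ p))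
    fun d f hf hfc => ?_
  refine (mem_iff_parabolicSection hF hns e.ij _ hQp hp
    (fun h => hb' (c.comap_le_prime p h)) hf).2 ?_
  rw [mem_iff_parabolicSection hF hns e.ij _ hQ hhc hb' hf] at hfc
  exact hle _ ((mem_pointChart_prime_iff hF hi hj _).2 hfc)

include hns hi hj e hC hh in
lemma jacobianOrder_eq_one_of_hessian_mem :
    jacobianOrder (pullback (surfaceIdeal_le hF) D) = 1 := by
  set c := incidenceChart D hi hj
  have hhc := rename_hessian_mem hF hi hj hh
  have hQ := chartEquations_subset_prime hF hi hj
  have hm := jacobian_mem hF e c.prime hQ hhc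
  refine jacobianOrder_pullback_eq_one hF hns hi hj e (isPrimeDivisor_of_proj hF hns hi hj e hC hh)
    hm fun hII => ?_
  obtain ⟨b, hb⟩ := exists_parabolicVec_notMem_pointChart_prime hF hns (X_notMem_proj hF hi) hC hh
  have hb' : rename Sum.inl (parabolicVec F b b) ∉ c.prime :=
    fun h => hb ((mem_pointChart_prime_iff hF hi hj _).2 h)
  exact secondForm_notMem hF hns c.prime hQ hb' e hm hII

include hns hi hj e hC hh in
-- The asymptotic line is given by polynomials in the point up to a scalar, so its coordinates lie
-- in the residue field of `C` once the scalar does.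
lemma residueDegree_eq_one : residueDegree (surfaceIdeal_le hF) D = 1 := by
  set c := incidenceChart D hi hj
  set c' := pointChart _ (X_notMem_proj hF hi)
  have hhc := rename_hessian_mem hF hi hj hh
  obtain ⟨b, hb⟩ := exists_parabolicVec_notMem_pointChart_prime hF hns (X_notMem_proj hF hi) hC hh
  have hb' : rename Sum.inl (parabolicVec F b b) ∉ c.prime :=
    fun h => hb ((mem_pointChart_prime_iff hF hi hj _).2 h)
  let ρ := IsLocalRing.ResidueField.map (ambientMap (surfaceIdeal_le hF) D)
  let φ : IncidenceRing →ₐ[ℂ] residueField D :=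
    (IsScalarTower.toAlgHom ℂ (ambientRing D) (residueField D)).comp c.ambientEval
  have hφ (f) : φ f = 0 ↔ f ∈ c.prime := by
    rw [Chart.mem_prime]
    refine (IsLocalRing.residue_eq_zero_iff (c.ambientEval f)).trans ?_
    exact not_congr (Chart.isUnit_quotientMk (c.ambientEval f)).symm
  have hρ (f : MvPolynomial (Fin 4) ℂ) : φ (rename Sum.inl f) ∈ ρ.range :=
    ⟨IsLocalRing.residue _ (c'.ambientEval f),
      congrArg (IsLocalRing.residue _) (ambientMap_ambientEval hF hi hj f)⟩
  obtain ⟨s, hs⟩ := exists_eq_parabolicSection hF hns φ e.ij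
    (fun f hf => (hφ f).2 (chartEquations_subset_prime hF hi hj hf)) ((hφ _).2 hhc)
    fun h => hb' ((hφ _).1 h)
  -- The scalar is the inverse of a Plücker coordinate of the section, because the corresponding
  -- coordinate on `D` is normalized to 1.
  have hsρ : s ∈ ρ.range := by
    have h1 : φ (pluckerMatrix lineCoord i j) = 1 := by
      have := (hφ _).2 (chartEquations_subset_prime hF hi hj (.inl (.inl (.inr rfl))))
      rwa [map_sub, map_one, sub_eq_zero] at this
    rw [hs _ _ (pluckerMatrix_lineCoord_mem i j), pow_one] at h1
    obtain ⟨t, ht⟩ := hρ (parabolicSection F b (pluckerMatrix lineCoord i j))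
    refine ⟨t⁻¹, ?_⟩
    rw [map_inv₀, ht]
    exact (eq_inv_of_mul_eq_one_left h1).symm
  have hsurj : Function.Surjective ρ := by
    refine surjective_of_forall_residue_mem c ρ (fun r => ?_) fun t => ?_
    · have h1 : c.ambientEval (C r) = algebraMap ℂ _ r := c.ambientEval.commutes r
      rw [← h1, ← rename_C Sum.inl r]
      exact hρ (C r)
    · rcases t with a | p
      · have := hρ (X a)
        rwa [rename_X] at this
      · have h1 := hs _ _ (lineCoord_mem p)
        change φ (lineCoord p) ∈ ρ.range
        rw [h1]
        exact mul_mem (pow_mem hsρ _) (hρ _)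
  let _ : Algebra (residueField (proj (surfaceIdeal_le hF) D)) (residueField D) := ρ.toAlgebra
  have h1 := (AlgEquiv.ofBijective
    (Algebra.ofId (residueField (proj (surfaceIdeal_le hF) D)) (residueField D))
    ⟨ρ.injective, hsurj⟩).toLinearEquiv.finrank_eq
  rw [Module.finrank_self] at h1
  exact h1.symm

end Divisor

end CubicSurface

/-! ### Coefficients of the push-forward -/

namespace BiProj

variable {α β : Type} {I : Ideal (MvPolynomial α ℂ)} {J : Ideal (MvPolynomial (α ⊕ β) ℂ)}
  (hIJ : I ≤ J.comap (inclGraded α β))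

open Classical in
lemma pushPrime_apply (D : PrimeDivisor (twoWeight α β) J) (C : PrimeDivisor (oneWeight α) I) :
    pushPrime hIJ D C = if proj hIJ D.1 = C.1 then residueDegree hIJ D.1 else 0 := by
  unfold pushPrime
  split_ifs with h1 h2 h2
  · have : (⟨proj hIJ D.1, h1⟩ : PrimeDivisor (oneWeight α) I) = C := Subtype.ext h2
    rw [this, Finsupp.single_eq_same]
  · exact Finsupp.single_eq_of_ne' fun h => h2 (congrArg Subtype.val h)
  · exact absurd (h2 ▸ C.2) h1
  · rfl

open Classical in
lemma push_apply (R : EffectiveDivisor (twoWeight α β) J) (C : PrimeDivisor (oneWeight α) I) :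
    push hIJ R C = R.sum fun D n =>
      if proj hIJ D.1 = C.1 then n * residueDegree hIJ D.1 else 0 := by
  rw [push, Finsupp.sum_apply]
  refine Finset.sum_congr rfl fun D _ => ?_
  simp only [Finsupp.smul_apply, pushPrime_apply, smul_eq_mul, mul_ite, mul_zero]

end BiProj

/-! ### The ramification divisor and its push-forward -/

namespace CubicSurface

open BiProj

variable {F : MvPolynomial (Fin 4) ℂ} (hF : F.IsHomogeneous 3) (hns : IsNonsingular F)

/-- Ramification forces `δ` to vanish along `D`, and the pulled-back Hessian is `δ ^ 2`. -/
lemma hessian_mem_of_jacobianOrder_ne_zero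
    {D : Point (twoWeight (Fin 4) Pair) (tripleContactIdeal F)}
    (h : jacobianOrder (pullback (surfaceIdeal_le hF) D) ≠ 0) :
    hessian F ∈ (proj (surfaceIdeal_le hF) D).ideal := by
  obtain ⟨i, j, hij, hi, hj⟩ := exists_incidenceChart hF D
  obtain ⟨k, l, e⟩ := exists_isEnum hij
  set c := incidenceChart D hi hj
  have h1 : jacobian F i k l ∈ c.prime := by
    by_contra h1
    exact h (jacobianOrder_eq_zero_of_notMem hF hi hj e h1)
  rw [← (pointChart _ (X_notMem_proj hF hi)).mem_prime_iff (hessian_mem hF),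
    mem_pointChart_prime_iff hF hi hj]
  change c.eval _ ∈ IsLocalRing.maximalIdeal (localRing D)
  rw [map_rename_hessian hF c.eval e (eval_eq_zero_of_mem_chartEquations hF hi hj)]
  exact Ideal.pow_mem_of_mem (IsLocalRing.maximalIdeal (localRing D)) h1 2 (by norm_num)

include hns in
/-- The ideal of a ramification divisor in a chart is a minimal prime. -/
lemma prime_mem_minimalPrimes {D : Point (twoWeight (Fin 4) Pair) (tripleContactIdeal F)}
    (hD : IsPrimeDivisor D) (hh : hessian F ∈ (proj (surfaceIdeal_le hF) D).ideal) {i j : Fin 4}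
    (hij : i ≠ j) (hi : pointCoord i ∉ D.ideal) (hj : pluckerMatrix lineCoord i j ∉ D.ideal) :
    (incidenceChart D hi hj).prime ∈ (tripleContactIdeal F ⊔
      Ideal.span {pointCoord i - 1, pluckerMatrix lineCoord i j - 1} ⊔
        Ideal.span {rename Sum.inl (hessian F)}).minimalPrimes := by
  obtain ⟨k, l, e⟩ := exists_isEnum hij
  set c := incidenceChart D hi hj with hc
  rw [← incidenceChart_ideal hi hj]
  refine c.comap_mem_minimalPrimes (tripleContactIdeal_isHomogeneous F)
    (p := IsLocalRing.maximalIdeal (localRing D)) ⟨⟨inferInstance, ?_⟩, fun p ⟨hp, hle⟩ _ => ?_⟩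
  · rw [Set.image_singleton, Ideal.span_le, Set.singleton_subset_iff]
    exact rename_hessian_mem hF hi hj hh
  · rw [eq_maximalIdeal_of_hessian_mem hF hns hi hj e hD p
      (hle (Ideal.subset_span ⟨_, rfl, rfl⟩))]

include hns in
-- There are finitely many charts. In each, a ramification divisor is a minimal prime over the ideal
-- of `Y` and the Hessian; such primes are finite in number and determine the divisor.
lemma finite_support_jacobianOrder :
    {D : PrimeDivisor (twoWeight (Fin 4) Pair) (tripleContactIdeal F) |
      (jacobianOrder (pullback (surfaceIdeal_le hF) D.1)).toNat ≠ 0}.Finite := by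
  refine Set.Finite.subset (s := ⋃ (i : Fin 4) (j : Fin 4) (P ∈ (tripleContactIdeal F ⊔
      Ideal.span {pointCoord i - 1, pluckerMatrix lineCoord i j - 1} ⊔
        Ideal.span {rename Sum.inl (hessian F)}).minimalPrimes),
      {D : PrimeDivisor (twoWeight (Fin 4) Pair) (tripleContactIdeal F) |
        ∃ hi hj, (incidenceChart D.1 (i := i) (j := j) hi hj).prime = P}) ?_ fun D hD => ?_
  · refine Set.finite_iUnion fun i => Set.finite_iUnion fun j => Set.Finite.biUnion
      (Ideal.finite_minimalPrimes_of_isNoetherianRing _ _) fun P _ => Set.Subsingleton.finite ?_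
    rintro D ⟨hi, hj, h⟩ D' ⟨hi', hj', h'⟩
    exact Subtype.ext (Chart.eq_of_prime_eq _ _ (h.trans h'.symm))
  · have hh := hessian_mem_of_jacobianOrder_ne_zero hF (D := D.1) fun h0 => hD (by rw [h0]; rfl)
    obtain ⟨i, j, hij, hi, hj⟩ := exists_incidenceChart hF D.1
    simp only [Set.mem_iUnion]
    exact ⟨i, j, _, prime_mem_minimalPrimes hF hns D.2 hh hij hi hj, hi, hj, rfl⟩

/-- The ramification divisor of the variety of lines with triple contact over the surface. -/
def ramificationDivisor : EffectiveDivisor (twoWeight (Fin 4) Pair) (tripleContactIdeal F) :=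
  Finsupp.ofSupportFinite (fun D => (jacobianOrder (pullback (surfaceIdeal_le hF) D.1)).toNat)
    (finite_support_jacobianOrder hF hns)

lemma ramificationDivisor_apply
    (D : PrimeDivisor (twoWeight (Fin 4) Pair) (tripleContactIdeal F)) :
    ramificationDivisor hF hns D =
      (jacobianOrder (pullback (surfaceIdeal_le hF) D.1)).toNat := rfl

lemma isRamificationDivisor_ramificationDivisor :
    IsRamificationDivisor (surfaceIdeal_le hF) (ramificationDivisor hF hns) := fun D => by
  obtain ⟨i, j, hij, hi, hj⟩ := exists_incidenceChart hF D.1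
  obtain ⟨k, l, e⟩ := exists_isEnum hij
  rw [ramificationDivisor_apply,
    ENat.natCast_toNat (jacobianOrder_pullback_ne_top hF hns hi hj e D.2)]

lemma push_ramificationDivisor_of_notMem
    {C : PrimeDivisor (oneWeight (Fin 4)) (surfaceIdeal F)} (hC : hessian F ∉ C.1.ideal) :
    push (surfaceIdeal_le hF) (ramificationDivisor hF hns) C = 0 := by
  rw [push_apply]
  refine Finset.sum_eq_zero fun D _ => ?_
  beta_reduce
  split_ifs with h
  · have h0 : jacobianOrder (pullback (surfaceIdeal_le hF) D.1) = 0 := by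
      by_contra h0
      have := hessian_mem_of_jacobianOrder_ne_zero hF h0
      rw [h] at this
      exact hC this
    rw [ramificationDivisor_apply, h0]
    exact zero_mul _
  · rfl

/-- The unique divisor over `C` contributes ramification order one times residue degree one. -/
lemma push_ramificationDivisor_of_mem
    {C : PrimeDivisor (oneWeight (Fin 4)) (surfaceIdeal F)} (hC : hessian F ∈ C.1.ideal) :
    push (surfaceIdeal_le hF) (ramificationDivisor hF hns) C = 1 := by
  obtain ⟨C, hCp⟩ := C
  obtain ⟨D, rfl⟩ := exists_proj_eq hF hns hCp hC
  obtain ⟨i, j, hij, hi, hj⟩ := exists_incidenceChart hF D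
  obtain ⟨k, l, e⟩ := exists_isEnum hij
  have hD := isPrimeDivisor_of_proj hF hns hi hj e hCp hC
  have h1 : ramificationDivisor hF hns ⟨D, hD⟩ = 1 := by
    rw [ramificationDivisor_apply, jacobianOrder_eq_one_of_hessian_mem hF hns hi hj e hCp hC]
    rfl
  rw [push_apply, Finsupp.sum, Finset.sum_eq_single ⟨D, hD⟩]
  · rw [if_pos rfl, h1, residueDegree_eq_one hF hns hi hj e hCp hC]
  · intro D' _ hD'
    rw [if_neg]
    intro h
    exact hD' (Subtype.ext (eq_of_proj_eq hF hns (X_notMem_proj hF hi) hC h hCp rfl))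
  · intro h
    rw [Finsupp.notMem_support_iff.1 h, zero_mul, ite_self]

/-- Both sides are 1 along curves on which the Hessian vanishes and 0 along all others. In
particular the divisor of the Hessian is reduced. -/
lemma isZeroDivisorOf_push_ramificationDivisor :
    IsZeroDivisorOf (hessian_mem hF)
      (push (surfaceIdeal_le hF) (ramificationDivisor hF hns)) := fun C g hg hgC => by
  obtain ⟨i, hi⟩ := exists_X_notMem C.1
  by_cases hh : hessian F ∈ C.1.ideal
  · rw [push_ramificationDivisor_of_mem hF hns hh, Nat.cast_one]
    exact ord_localFraction_eq_one (pointChart C.1 hi) _ hg hgC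
      (maximalIdeal_eq_span_hessian hF hns hi C.2 hh)
  · rw [push_ramificationDivisor_of_notMem hF hns hh, Nat.cast_zero]
    exact ord_localFraction_eq_zero (pointChart C.1 hi) _ hg hgC hh

end CubicSurface

end

theorem mainTheorem12 (F : MvPolynomial (Fin 4) ℂ) (hF : F.IsHomogeneous 3)
    (hns : IsNonsingular F) :
    ∃ R : EffectiveDivisor (twoWeight (Fin 4) Pair) (tripleContactIdeal F),
      IsRamificationDivisor (surfaceIdeal_le hF) R ∧
      IsZeroDivisorOf (hessian_mem hF) (push (surfaceIdeal_le hF) R) :=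
  ⟨ramificationDivisor hF hns, isRamificationDivisor_ramificationDivisor hF hns,
    isZeroDivisorOf_push_ramificationDivisor hF hns⟩
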